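/- Let $q\in\{0,1,2,\dots\}\cup\{\infty\}$ and let $G_0$ be one of $SU(\infty,q)$, $SO(\infty,q)$, $Sp(\infty,q)$, $SO^*(\infty)$, $Sp(\infty;\mathbb R)$. Let $m=q,\,q,\,2q,\,\infty,\,\infty$ respectively, let $V$ be the complex vector space with basis $\{\dots,e'_{-2},e'_{-1},e'_1,e'_2,\dots,e'_m\}$ (indices $i\in\mathbb Z\setminus\{0\}$ with $i\le m$), and put $\epsilon_i=1$ for $i<0$, $\epsilon_i=-1$ for $i>0$. Let $h$ be the hermitian form on $V$ with $h(e'_i,e'_j)=\epsilon_i\delta_{i,j}$, and, except for $SU(\infty,q)$, let $b$ be the bilinear form with - $SO(\infty,q)$: $b(e'_i,e'_j)=\epsilon_i\delta_{i,j}$ (symmetric); - $Sp(\infty,q)$: $b(e'_{2i-1},e'_{2i})=-1$, $b(e'_{2i},e'_{2i-1})=1$ for $i>0$, $b(e'_{2i+1},e'_{2i})=1$, $b(e'_{2i},e'_{2i+1})=-1$ for $i<0$, all other values $0$ (antisymmetric); - $SO^*(\infty)$: $b(e'_i,e'_j)=\delta_{i+j,0}$ (symmetric); - $Sp(\infty;\mathbb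 R)$: $b(e'_i,e'_j)=\epsilon_i\delta_{i+j,0}$ (antisymmetric). Fix a basis $E=\{e_i\}$ of $V$, with the same index set, such that $h(e_i,e_j)=\epsilon_i\delta_{i,j}$ and such that, if there is a form $b$, each $e_i$ is $b$-orthogonal to all but one of the $e_j$. Let $GL(V,E)$ be the group of invertible linear transformations of $V$ that fix all but finitely many elements of $E$, and let $G$ be $GL(V,E)$ for $SU(\infty,q)$ and the subgroup of $GL(V,E)$ preserving $b$ in the other cases. The topology of $G$, and of its subgroups, is the direct limit topology of the matrix groups $G_S=G\cap GL(V_S)$, where $S\subset E$ is finite, $V_S=\operatorname{Span}S$, and $GL(V_S)$ acts trivially on $E\setminus S$. Then $G_0$ is the group of all $g\in G$ that preserve $h$, with determinant $1$ for $SU(\infty,q)$ and $SO^*(\infty)$; for $SO(\infty,q)$ it is the topological identity component of that group. A generalized flag is a chain $\mathcal F$ of subspaces of $V$ in which every member has an immediate successor or an immediate predecessor in $\mathcal F$, and such that every nonzero $v\in V$ lies in $F''\setminus F'$ for some $F'\subset F''$ in $\mathcal F$ with $F''$ the immediate successor of $F'$. It is isotropic if $\mathcal F\cup\{F^\perp\mid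 F\in\mathcal F\}$ is a chain ($\perp$ relative to $b$); this is no condition for $SU(\infty,q)$. It is compatible with a basis if each of its members is spanned by a subset of that basis, and weakly compatible with $E$ if it is compatible with a basis containing all but finitely many elements of $E$. Two generalized flags $\mathcal F,\mathcal G$ are $E$-commensurable if both are weakly compatible with $E$ and there are a bijection $\varphi:\mathcal F\to\mathcal G$ and a finite dimensional $U\subset V$ with $F\subset\varphi(F)+U$, $\varphi(F)\subset F+U$ and $\dim(F\cap U)=\dim(\varphi(F)\cap U)$ for all $F\in\mathcal F$. Let $\mathcal F$ be an isotropic generalized flag (in particular, possibly a flag, i.e. one whose proper subspaces are ordered like a subset of $\mathbb Z$) that is compatible with $E$. Let $\mathcal Z_{\mathcal F,E}$ be the set of all isotropic generalized flags that are $E$-commensurable to $\mathcal F$. It carries the direct limit topology of the finite dimensional flag manifolds of the groups $G_S$: a set $U\subset\mathcal Z_{\mathcal F,E}$ is open if and only if $\{g\in G\mid g(\mathcal L)\in U\}$ is open in $G$ for every $\mathcal L\in\mathcal Z_{\mathcal F,E}$. **Theorem.** Let $\mathcal F^{(1)}\in\mathcal Z_{\mathcal F,E}$. Then the orbit $G_0(\mathcal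 F^{(1)})$ is open in $\mathcal Z_{\mathcal F,E}$ if and only if $\mathcal F^{(1)}$ is nondegenerate, i.e. the restriction of $h$ to every member $F$ of $\mathcal F^{(1)}$ is nondegenerate. -/

import Mathlib

open scoped ComplexConjugate

noncomputable section

namespace OpenOrbits

/-- The five classes of real groups `SU(∞,q)`, `SO(∞,q)`, `Sp(∞,q)` (with `q ≤ ∞`),
`SO*(∞)` and `Sp(∞;ℝ)`. -/
inductive RealForm : Type
  | SU (q : ℕ∞)
  | SO (q : ℕ∞)
  | Sp (q : ℕ∞)
  | SOStar
  | SpR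

namespace RealForm

/-- The number of negative squares of the hermitian form. -/
def neg : RealForm → ℕ∞
  | SU q => q
  | SO q => q
  | Sp q => 2 * q
  | SOStar => ⊤
  | SpR => ⊤

/-- The index set `{…, -2, -1, 1, 2, …, m}`, where `m = neg` is finite or infinite. -/
abbrev Idx (c : RealForm) : Type :=
  {i : ℤ // i ≠ 0 ∧ (i.toNat : ℕ∞) ≤ c.neg}

/-- The countable dimensional complex vector space `V`, with its coordinate basis. -/
abbrev V (c : RealForm) : Type := c.Idx →₀ ℂ

/-- The sign of an index: `+1` on negative indices, `-1` on positive ones. -/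
def sgn (i : ℤ) : ℂ := if i < 0 then 1 else -1

/-- The values of the hermitian form on the coordinate basis. -/
def hCoeff (i j : ℤ) : ℂ := if i = j then sgn i else 0

/-- The values of the bilinear form on the coordinate basis: symmetric for `SO` and `SOStar`,
antisymmetric for `Sp` and `SpR`.  There is no bilinear form for `SU`; the value `0` makes every
condition on it void in that case. -/
def bCoeff : RealForm → ℤ → ℤ → ℂ
  | SU _, _, _ => 0
  | SO _, i, j => if i = j then sgn i else 0
  | Sp _, i, j =>
      if 0 < i then
        if Odd i then (if j = i + 1 then -1 else 0) else (if j = i - 1 then 1 else 0)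
      else
        if Odd i then (if j = i - 1 then 1 else 0) else (if j = i + 1 then -1 else 0)
  | SOStar, i, j => if i + j = 0 then 1 else 0
  | SpR, i, j => if i + j = 0 then sgn i else 0

/-- The bilinear form `b`. -/
def b (c : RealForm) : c.V →ₗ[ℂ] c.V →ₗ[ℂ] ℂ :=
  Finsupp.linearCombination ℂ fun i : c.Idx =>
    Finsupp.linearCombination ℂ fun j : c.Idx => c.bCoeff i j

/-- The hermitian form `h`, linear in the first and conjugate linear in the second variable. -/
def h (c : RealForm) : c.V →ₗ[ℂ] c.V →ₛₗ[starRingEnd ℂ] ℂ :=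
  Finsupp.linearCombination ℂ fun i : c.Idx =>
    ((starLinearEquiv ℂ : ℂ ≃ₗ⋆[ℂ] ℂ) : ℂ →ₛₗ[starRingEnd ℂ] ℂ).comp
      (Finsupp.linearCombination ℂ fun j : c.Idx => conj (hCoeff i j))

theorem b_single (c : RealForm) (i j : c.Idx) :
    c.b (Finsupp.single i 1) (Finsupp.single j 1) = c.bCoeff i j := by
  simp [b]

theorem h_single (c : RealForm) (i j : c.Idx) :
    c.h (Finsupp.single i 1) (Finsupp.single j 1) = hCoeff i j := by
  simp [h]

/-- The bases `E` of `V` that are admitted: `E` is orthonormal for `h` up to the signs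
`h(e_i,e_i) = 1` for `i < 0` and `h(e_i,e_i) = -1` for `i > 0`, and each `e_i` is `b`-orthogonal
to all `e_j` but one.  The coordinate basis is one of these; in the orthogonal case
there are others that contain many `b`-isotropic vectors. -/
structure Adapted (c : RealForm) (E : Module.Basis c.Idx ℂ c.V) : Prop where
  h_eq : ∀ i j, c.h (E i) (E j) = hCoeff i j
  b_eq : ∃ ι : c.Idx → c.Idx, ∀ i j, j ≠ ι i → c.b (E i) (E j) = 0

end RealForm

section Flags

variable {I V : Type} [AddCommGroup V] [Module ℂ V]

/-- `F''` is the immediate successor of `F'` in the family `𝓕`. -/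
def ImmSucc (𝓕 : Set (Submodule ℂ V)) (F' F'' : Submodule ℂ V) : Prop :=
  F' ∈ 𝓕 ∧ F'' ∈ 𝓕 ∧ F' < F'' ∧ ∀ G ∈ 𝓕, ¬ (F' < G ∧ G < F'')

/-- Generalized flags: chains of subspaces in which every member has an immediate successor or
an immediate predecessor, such that every nonzero vector lies in `F'' \ F'` for some
pair of immediate neighbours `F' < F''`. -/
structure IsGeneralizedFlag (𝓕 : Set (Submodule ℂ V)) : Prop where
  chain : IsChain (· ≤ ·) 𝓕
  neighbour : ∀ F ∈ 𝓕, (∃ G, ImmSucc 𝓕 F G) ∨ ∃ G, ImmSucc 𝓕 G F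
  cover : ∀ v : V, v ≠ 0 → ∃ F' F'', ImmSucc 𝓕 F' F'' ∧ v ∈ F'' ∧ v ∉ F'

/-- `𝓕` is compatible with the basis `E`: every member is spanned by a subset of `E`. -/
def Compatible (E : Module.Basis I ℂ V) (𝓕 : Set (Submodule ℂ V)) : Prop :=
  ∀ F ∈ 𝓕, ∃ s : Set I, F = Submodule.span ℂ (E '' s)

/-- `𝓕` is weakly compatible with `E`: it is compatible with a basis that contains all but
finitely many elements of `E`. -/
def WeaklyCompatible (E : Module.Basis I ℂ V) (𝓕 : Set (Submodule ℂ V)) : Prop :=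
  ∃ L : Module.Basis I ℂ V, (Set.range E \ Set.range L).Finite ∧ Compatible L 𝓕

/-- `E`-commensurability of generalized flags. -/
def Commensurable (E : Module.Basis I ℂ V) (𝓕 𝓖 : Set (Submodule ℂ V)) : Prop :=
  WeaklyCompatible E 𝓕 ∧ WeaklyCompatible E 𝓖 ∧
    ∃ (φ : 𝓕 ≃ 𝓖) (U : Submodule ℂ V), FiniteDimensional ℂ U ∧
      ∀ F : 𝓕, (F : Submodule ℂ V) ≤ (φ F : Submodule ℂ V) ⊔ U ∧
        (φ F : Submodule ℂ V) ≤ (F : Submodule ℂ V) ⊔ U ∧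
        Module.finrank ℂ ↥((F : Submodule ℂ V) ⊓ U) =
          Module.finrank ℂ ↥((φ F : Submodule ℂ V) ⊓ U)

/-- Isotropy of `𝓕` for a symmetric or antisymmetric form `b`: `𝓕 ∪ {F^⊥ | F ∈ 𝓕}` is a chain,
i.e. for all members `F`, `G` either `F ⊆ G^⊥` or `G^⊥ ⊆ F`.  In particular every
member is isotropic or coisotropic. -/
def IsIsotropic (b : V →ₗ[ℂ] V →ₗ[ℂ] ℂ) (𝓕 : Set (Submodule ℂ V)) : Prop :=
  ∀ F ∈ 𝓕, ∀ G ∈ 𝓕,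
    (∀ v ∈ F, ∀ w ∈ G, b v w = 0) ∨ (∀ v : V, (∀ w ∈ G, b v w = 0) → v ∈ F)

/-- Nondegeneracy of `𝓕`: the restriction of `h` to every member is nondegenerate. -/
def IsNondegenerate (h : V →ₗ[ℂ] V →ₛₗ[starRingEnd ℂ] ℂ) (𝓕 : Set (Submodule ℂ V)) : Prop :=
  ∀ F ∈ 𝓕, ∀ v ∈ F, (∀ w ∈ F, h v w = 0) → v = 0

/-- The translate `g(𝓕) = {g(F) | F ∈ 𝓕}`. -/
def translate (g : V ≃ₗ[ℂ] V) (𝓕 : Set (Submodule ℂ V)) : Set (Submodule ℂ V) :=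
  (fun F : Submodule ℂ V => F.map (g : V →ₗ[ℂ] V)) '' 𝓕

end Flags

section Groups

variable {I V : Type} [AddCommGroup V] [Module ℂ V]

/-- `GL(V,E)`: the invertible transformations that fix all but finitely many elements of `E`. -/
def finitaryGL (E : Module.Basis I ℂ V) : Subgroup (V ≃ₗ[ℂ] V) where
  carrier := {g | {i | g (E i) ≠ E i}.Finite}
  one_mem' := by simp
  mul_mem' := by
    intro g k hg hk
    refine (Set.Finite.union hg hk).subset ?_
    intro i hi
    by_contra hn
    obtain ⟨h1, h2⟩ := not_or.mp hn
    have h1 : g (E i) = E i := not_not.mp h1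
    have h2 : k (E i) = E i := not_not.mp h2
    exact hi (by simp [LinearEquiv.mul_apply, h1, h2])
  inv_mem' := by
    intro g hg
    refine Set.Finite.subset hg ?_
    intro i hi hgi
    apply hi
    have : g⁻¹ (g (E i)) = E i := g.symm_apply_apply (E i)
    rwa [hgi] at this

/-- The transformations that preserve the bilinear form `b`. -/
def preserveBilin (b : V →ₗ[ℂ] V →ₗ[ℂ] ℂ) : Subgroup (V ≃ₗ[ℂ] V) where
  carrier := {g | ∀ v w, b (g v) (g w) = b v w}
  one_mem' := by simp
  mul_mem' := by
    intro g k hg hk v w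
    simp only [LinearEquiv.mul_apply]
    rw [hg, hk]
  inv_mem' := by
    intro g hg v w
    have e : ∀ x, g (g⁻¹ x) = x := fun x => g.apply_symm_apply x
    have := hg (g⁻¹ v) (g⁻¹ w)
    rw [e, e] at this
    exact this.symm

/-- The transformations that preserve the hermitian form `h`. -/
def preserveHerm (h : V →ₗ[ℂ] V →ₛₗ[starRingEnd ℂ] ℂ) : Subgroup (V ≃ₗ[ℂ] V) where
  carrier := {g | ∀ v w, h (g v) (g w) = h v w}
  one_mem' := by simp
  mul_mem' := by
    intro g k hg hk v w
    simp only [LinearEquiv.mul_apply]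
    rw [hg, hk]
  inv_mem' := by
    intro g hg v w
    have e : ∀ x, g (g⁻¹ x) = x := fun x => g.apply_symm_apply x
    have := hg (g⁻¹ v) (g⁻¹ w)
    rw [e, e] at this
    exact this.symm

/-- `g` comes from `GL(V_S)`, where `V_S` is the span of the `E i` with `i ∈ S`: it maps `V_S`
into itself and fixes the other elements of `E`. -/
def SupportedIn (E : Module.Basis I ℂ V) (S : Finset I) (g : V ≃ₗ[ℂ] V) : Prop :=
  (∀ i ∉ S, g (E i) = E i) ∧ ∀ i ∈ S, g (E i) ∈ Submodule.span ℂ (E '' (S : Set I))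

/-- The finitary transformation `g` has determinant one. -/
def HasDetOne [DecidableEq I] (E : Module.Basis I ℂ V) (g : V ≃ₗ[ℂ] V) : Prop :=
  ∃ S : Finset I, SupportedIn E S g ∧
    (Matrix.of fun i j : S => E.repr (g (E j)) i).det = 1

/-- The direct limit topology on a group `H` of finitary transformations: the final topology for
the inclusions of the subgroups `H_S = H ∩ GL(V_S)`, `S` finite, each of which carries
the topology of a group of matrices. -/
@[reducible]
def limTopology (E : Module.Basis I ℂ V) (H : Subgroup (V ≃ₗ[ℂ] V)) : TopologicalSpace H :=
  ⨆ S : Finset I,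
    TopologicalSpace.coinduced
      (Subtype.val : {g : H // SupportedIn E S (g : V ≃ₗ[ℂ] V)} → H)
      (TopologicalSpace.induced
        (fun g (i j : I) => E.repr ((g.1 : V ≃ₗ[ℂ] V) (E j)) i)
        (inferInstance : TopologicalSpace (I → I → ℂ)))

end Groups

namespace RealForm

variable (c : RealForm) (E : Module.Basis c.Idx ℂ c.V)

/-- The complex group `G`: `GL(V,E)`, `O(V,E,b)` or `Sp(V,E,b)`.  (For the first two, the
subgroup of elements of determinant one has the same flag manifolds, up to passing
to connected components in the orthogonal case.) -/
def complexGroup : Subgroup (c.V ≃ₗ[ℂ] c.V) := finitaryGL E ⊓ preserveBilin c.b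

/-- The subgroup of `G` that preserves the hermitian form. -/
def unitaryGroup : Subgroup (c.V ≃ₗ[ℂ] c.V) := complexGroup c E ⊓ preserveHerm c.h

/-- The real group `G₀`.  For `SO(∞,q)` it is the topological identity component of `O(∞,q)`. -/
def realGroup : Set (c.V ≃ₗ[ℂ] c.V) :=
  match c with
  | SU q => {g | g ∈ unitaryGroup (SU q) E ∧ HasDetOne E g}
  | SO q => Subtype.val ''
      (@connectedComponent (unitaryGroup (SO q) E) (limTopology E (unitaryGroup (SO q) E)) 1)
  | Sp q => {g | g ∈ unitaryGroup (Sp q) E}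
  | SOStar => {g | g ∈ unitaryGroup SOStar E ∧ HasDetOne E g}
  | SpR => {g | g ∈ unitaryGroup SpR E}

/-- The flag manifold `Z_{𝓕,E}`: the generalized flags (isotropic ones, if there is a bilinear
form) that are `E`-commensurable to `𝓕`. -/
def flagManifold (𝓕 : Set (Submodule ℂ c.V)) : Set (Set (Submodule ℂ c.V)) :=
  {𝓛 | IsGeneralizedFlag 𝓛 ∧ IsIsotropic c.b 𝓛 ∧ Commensurable E 𝓕 𝓛}

/-- The final topology for all orbit maps `g ↦ g(𝓛)` of `G`, where `G` carries the direct limit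
topology.  On each orbit `G(𝓛) = G/Q` (with `Q` the stabilizer of `𝓛`) this is the quotient
topology, i.e. the direct limit of the topologies of the finite dimensional flag
manifolds `G_S/Q_S`; different orbits are open and disjoint. -/
@[reducible]
def orbitTopology : TopologicalSpace (Set (Submodule ℂ c.V)) :=
  ⨆ 𝓛 : Set (Submodule ℂ c.V),
    TopologicalSpace.coinduced
      (fun g : complexGroup c E => translate (g : c.V ≃ₗ[ℂ] c.V) 𝓛)
      (limTopology E (complexGroup c E))

/-- The topology of `Z_{𝓕,E} = G/Q = lim G_S/Q_S`. -/
instance flagManifoldTopology (𝓕 : Set (Submodule ℂ c.V)) :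
    TopologicalSpace (flagManifold c E 𝓕) :=
  TopologicalSpace.induced Subtype.val (orbitTopology c E)

/-- The orbit `G₀(𝓛)` as a subset of `Z_{𝓕,E}`. -/
def realOrbit (𝓕 : Set (Submodule ℂ c.V)) (𝓛 : flagManifold c E 𝓕) :
    Set (flagManifold c E 𝓕) :=
  {𝓜 | ∃ g ∈ realGroup c E, 𝓜.1 = translate g 𝓛.1}

end RealForm

end OpenOrbits

end

/-! The topologies are direct limits, so openness is tested with transformations `u` in `G` that lie
near the identity and act on the span `V_T` of finitely many vectors of `E`. Weak compatibility
provides a finite `T` along which every member of the flag splits into a part inside `V_T` and a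
span of other vectors of `E` (`exists_splits`). Translates by such `u`, radicals and orthogonal
spaces are then governed by the part in `V_T`. When there is a form `b`, it is tied to `h` by an
antilinear map `τ` with `h x y = b x (τ y)`. Two signs, `σ` for the symmetry of `b` and `η` in `h (τ
x) (τ y) = η * conj (h x y)`, distinguish the four types of groups, so that they can be treated
together (`FormTriple`, `MonomialData`).

Nondegenerate implies open. A nondegenerate chain in `V_T` has `h`-orthogonal projections, and for
`u` near the identity the projections onto the translates by `u` are close to them. Summing products
of corresponding graded pieces gives an intertwiner near the identity (`transporter`). Its polar
decomposition turns it into a unitary `w` with `w F = u F` for all members `F`, and averaging with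
conjugation by `τ` makes `w` preserve `b` as well (`eventually_exists_unitary_map`). It remains to
put `w` into the real group: by a scalar of modulus one for `SU`, by continuity of the determinant
for `SO*`, by a Cayley path to the identity for `SO`.

Open implies nondegenerate. If the orbit is open, every small `u` moves each member `F` as some
unitary `k` does, because a finitary transformation that maps a weakly compatible chain to itself
fixes each member (`map_eq_self_of_mem_chain`). Hence `u F` and `F` have radicals of the same
dimension. For degenerate `F` this is refuted by an arbitrarily small `u` that fixes a complement
`N` of the radical and makes a radical vector `r` anisotropic. A transvection serves if `b` is zero
or antisymmetric, a Siegel transformation if `b` is symmetric (`HasDeformation`). If `F` is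
coisotropic and not isotropic, the argument is applied to its `b`-orthogonal space.

The Siegel transformation needs room beside a hyperbolic plane. It is missing only if `F` is
Lagrangian in `V_T`, `η = 1`, and the signs of `h` on `V_T` multiply to `-1` (`prod_sign_ne_one`).
Commensurability with a flag compatible with `E` excludes this: a Lagrangian coordinate subspace
pairs the indices of `T` into pairs of equal sign (`prod_sign_eq_one`). -/

noncomputable section

namespace OpenOrbits

open Filter Topology

/-! ### Deformations that make a radical vector anisotropic -/

section Deformation

variable {W : Type*} [AddCommGroup W] [Module ℂ W]

/-- Vectors of `F` that are `h`-orthogonal to `F`. -/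
def radical (h : W →ₗ[ℂ] W →ₛₗ[starRingEnd ℂ] ℂ) (F : Submodule ℂ W) : Submodule ℂ W where
  carrier := {x | x ∈ F ∧ ∀ y ∈ F, h x y = 0}
  zero_mem' := by simp
  add_mem' := by
    rintro x y ⟨hx, hx'⟩ ⟨hy, hy'⟩
    exact ⟨F.add_mem hx hy, fun z hz => by simp [hx' z hz, hy' z hz]⟩
  smul_mem' := by
    rintro a x ⟨hx, hx'⟩
    exact ⟨F.smul_mem a hx, fun z hz => by simp [hx' z hz]⟩

variable {h : W →ₗ[ℂ] W →ₛₗ[starRingEnd ℂ] ℂ} {b : W →ₗ[ℂ] W →ₗ[ℂ] ℂ}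
  {τ : W →ₛₗ[starRingEnd ℂ] W} {σ η : ℂ}

/-- Orthogonal projection onto a finite dimensional nondegenerate subspace. -/
theorem exists_orthogonal_projection (N : Submodule ℂ W) [FiniteDimensional ℂ N]
    (hN : ∀ x ∈ N, (∀ y ∈ N, h x y = 0) → x = 0) (x : W) :
    ∃ n ∈ N, ∀ y ∈ N, h (x - n) y = 0 := by
  classical
  let B := Module.finBasis ℂ N
  let Φ : W →ₗ[ℂ] (Fin (Module.finrank ℂ N) → ℂ) :=
    LinearMap.pi fun i => h.flip (B i : W)
  have key : ∀ z : W, Φ z = 0 → ∀ y ∈ N, h z y = 0 := by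
    intro z hz y hy
    have : y = ∑ i, B.repr ⟨y, hy⟩ i • (B i : W) := by
      have := congrArg N.subtype (B.sum_repr ⟨y, hy⟩)
      rw [map_sum] at this
      exact this.symm
    rw [this]
    simp only [map_sum, map_smulₛₗ]
    refine Finset.sum_eq_zero fun i _ => ?_
    have := congrFun hz i
    simp only [Φ, LinearMap.pi_apply, LinearMap.flip_apply, Pi.zero_apply] at this
    simp [this]
  have hinj : Function.Injective (Φ.comp N.subtype) := by
    rw [← LinearMap.ker_eq_bot, LinearMap.ker_eq_bot']
    intro n hn
    exact Subtype.ext (hN n n.2 (key n hn))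
  -- Nondegeneracy of `N` gives injectivity between spaces of equal dimension, so the Gram system
  -- for the projection is solvable.
  have hsurj : Function.Surjective (Φ.comp N.subtype) :=
    (LinearMap.injective_iff_surjective_of_finrank_eq_finrank (by simp)).1 hinj
  obtain ⟨n, hn⟩ := hsurj (Φ x)
  refine ⟨n, n.2, key _ ?_⟩
  rw [map_sub, ← hn]
  simp

/-- A polynomial function with a nonzero coefficient in degree one or two does not vanish at all small
positive reals. -/
theorem exists_small_ne_zero (f : ℝ → ℂ) (a₁ a₂ a₃ a₄ : ℂ)
    (hf : ∀ e : ℝ, f e = a₁ * e + a₂ * e ^ 2 + a₃ * e ^ 3 + a₄ * e ^ 4)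
    (hne : a₁ ≠ 0 ∨ a₂ ≠ 0) (δ : ℝ) (hδ : 0 < δ) : ∃ e : ℝ, 0 < e ∧ e < δ ∧ f e ≠ 0 := by
  by_contra hcon
  push Not at hcon
  let P : Polynomial ℂ := .C a₁ * .X + .C a₂ * .X ^ 2 + .C a₃ * .X ^ 3 + .C a₄ * .X ^ 4
  have hP : P = 0 := by
    refine Polynomial.eq_zero_of_infinite_isRoot P ?_
    refine Set.Infinite.mono (s := (fun e : ℝ => (e : ℂ)) '' Set.Ioo 0 δ) ?_ ?_
    · rintro _ ⟨e, he, rfl⟩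
      have := hcon e he.1 he.2
      rw [hf] at this
      simpa [P, Polynomial.IsRoot] using this
    · exact (Set.Ioo_infinite hδ).image (Complex.ofReal_injective.injOn)
  have h1 : P.coeff 1 = a₁ := by simp [P]
  have h2 : P.coeff 2 = a₂ := by simp [P]
  rw [hP] at h1 h2
  rcases hne with h | h
  · exact h h1.symm
  · exact h h2.symm

/-- The rank of `h` increases along a family that fixes a nondegenerate complement `N` of the radical and
moves a vector of the radical to an anisotropic vector orthogonal to `N`. -/
theorem finrank_radical_map_lt [FiniteDimensional ℂ W] (hherm : ∀ x y, h y x = conj (h x y))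
    (F N : Submodule ℂ W) (hNF : N ⊓ radical h F = ⊥)
    (hsup : N ⊔ radical h F = F) (r : W) (hr : r ∈ radical h F)
    (U : Module.End ℂ W) (hU : Function.Injective U) (hUN : ∀ n ∈ N, U n = n)
    (hUr : ∀ n ∈ N, h (U r) n = 0) (hne : h (U r) (U r) ≠ 0) :
    Module.finrank ℂ (radical h (F.map U)) < Module.finrank ℂ (radical h F) := by
  have hN : ∀ x ∈ N, (∀ y ∈ N, h x y = 0) → x = 0 := by
    intro x hx hxN
    have hxF : x ∈ F := hsup ▸ Submodule.mem_sup_left hx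
    have : x ∈ N ⊓ radical h F := by
      refine ⟨hx, hxF, fun y hy => ?_⟩
      rw [← hsup] at hy
      obtain ⟨n, hn, z, hz, rfl⟩ := Submodule.mem_sup.1 hy
      rw [map_add, hxN n hn, hherm, hz.2 x hxF]
      simp
    rwa [hNF, Submodule.mem_bot] at this
  -- A nondegenerate subspace of `F.map U` with one dimension more than `N`. It meets the new
  -- radical in zero, so that radical has smaller dimension than the old one.
  set N₁ := N ⊔ ℂ ∙ (U r) with hN₁
  have hN₁F : N₁ ≤ F.map U := by
    refine sup_le ?_ ?_
    · intro n hn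
      exact ⟨n, hsup ▸ Submodule.mem_sup_left hn, hUN n hn⟩
    · rw [Submodule.span_singleton_le_iff_mem]
      exact ⟨r, hr.1, rfl⟩
  have hinf : N₁ ⊓ radical h (F.map U) = ⊥ := by
    rw [eq_bot_iff]
    rintro x ⟨hx, -, hx'⟩
    obtain ⟨n, hn, z, hz, rfl⟩ := Submodule.mem_sup.1 hx
    obtain ⟨a, rfl⟩ := Submodule.mem_span_singleton.1 hz
    have hn0 : n = 0 := by
      refine hN n hn fun y hy => ?_
      have := hx' y (hN₁F (Submodule.mem_sup_left hy))
      simpa [hUr y hy] using this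
    subst hn0
    have := hx' (U r) (hN₁F (Submodule.mem_sup_right (Submodule.mem_span_singleton_self _)))
    have ha : a = 0 := by simpa [hne] using this
    simp [ha]
  have hd1 : Module.finrank ℂ N₁ = Module.finrank ℂ N + 1 := by
    have h0 : U r ≠ 0 := by rintro h0; simp [h0] at hne
    have : N ⊓ ℂ ∙ (U r) = ⊥ := by
      rw [eq_bot_iff]
      rintro x ⟨hx, hx'⟩
      obtain ⟨a, rfl⟩ := Submodule.mem_span_singleton.1 hx'
      have := hUr _ hx
      have ha : a = 0 := by simpa [hne] using this
      simp [ha]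
    have h2 := Submodule.finrank_sup_add_finrank_inf_eq N (ℂ ∙ (U r))
    rw [this, finrank_bot, finrank_span_singleton h0] at h2
    simpa using h2
  have hd2 := Submodule.finrank_sup_add_finrank_inf_eq N (radical h F)
  rw [hNF, hsup, finrank_bot] at hd2
  have hd3 := Submodule.finrank_sup_add_finrank_inf_eq N₁ (radical h (F.map U))
  rw [hinf, finrank_bot] at hd3
  have hd4 : N₁ ⊔ radical h (F.map U) ≤ F.map U := sup_le hN₁F fun x hx => hx.1
  have hd5 := Submodule.finrank_mono hd4
  have hd6 : Module.finrank ℂ (F.map U) = Module.finrank ℂ F :=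
    (Submodule.equivMapOfInjective U hU F).finrank_eq.symm
  omega


/-- A one-parameter family of transformations `1 + t a₁ + t² a₂`. -/
def quadFamily (a₁ a₂ : Module.End ℂ W) (t : ℂ) : Module.End ℂ W := 1 + t • a₁ + t ^ 2 • a₂

/-- There is a quadratic family of injective transformations preserving `b`, fixing `N`, that moves `r`
to vectors orthogonal to `N` that are anisotropic for arbitrarily small parameters. -/
def HasDeformation (h : W →ₗ[ℂ] W →ₛₗ[starRingEnd ℂ] ℂ) (b : W →ₗ[ℂ] W →ₗ[ℂ] ℂ)
    (N : Submodule ℂ W) (r : W) : Prop :=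
  ∃ a₁ a₂ : Module.End ℂ W,
    (∀ t, Function.Injective (quadFamily a₁ a₂ t)) ∧
    (∀ t x y, b (quadFamily a₁ a₂ t x) (quadFamily a₁ a₂ t y) = b x y) ∧
    (∀ t, ∀ n ∈ N, quadFamily a₁ a₂ t n = n) ∧
    (∀ t, ∀ n ∈ N, h (quadFamily a₁ a₂ t r) n = 0) ∧
    ∀ δ : ℝ, 0 < δ → ∃ t : ℂ, ‖t‖ < δ ∧
      h (quadFamily a₁ a₂ t r) (quadFamily a₁ a₂ t r) ≠ 0

/-- The family is the transvection `x ↦ x + t * h x y • z`, with `z` orthogonal to `N` and not to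
`r`. The linear term of the square of the moved `r` is then `2 |h r z|²`. -/
theorem hasDeformation_of_bilin_eq_zero [FiniteDimensional ℂ W]
    (hherm : ∀ x y, h y x = conj (h x y)) (hnd : ∀ x, (∀ y, h x y = 0) → x = 0)
    (hb : ∀ x y, b x y = 0) (N : Submodule ℂ W) (hN : ∀ x ∈ N, (∀ y ∈ N, h x y = 0) → x = 0)
    (r : W) (hr0 : r ≠ 0) (hrN : ∀ n ∈ N, h r n = 0) (hrr : h r r = 0) :
    HasDeformation h b N r := by
  obtain ⟨y₀, hy₀⟩ : ∃ y, h r y ≠ 0 := by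
    by_contra hcon
    push Not at hcon
    exact hr0 (hnd r hcon)
  obtain ⟨n, hn, hz⟩ := exists_orthogonal_projection N hN y₀
  set z := y₀ - n with hzdef
  have hrz : h r z ≠ 0 := by rwa [hzdef, map_sub, hrN n hn, sub_zero]
  have hzr : h z r ≠ 0 := by
    rw [hherm r z]
    simpa using hrz
  -- The multiple of `r` is chosen to get `h z y = 0`, which makes `a` square to zero and the family
  -- injective. Since `h r r = 0`, it leaves `h r y = h r z`.
  set y := z - (conj (h z z) / conj (h z r)) • r with hydef
  have hry : h r y = h r z := by simp [hydef, hrr]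
  have hzy : h z y = 0 := by
    simp only [hydef, map_sub, map_smulₛₗ, map_div₀, Complex.conj_conj, smul_eq_mul]
    field_simp
    simp
  have hny : ∀ n ∈ N, h n y = 0 := by
    intro m hm
    have h1 : h m r = 0 := by rw [hherm r m, hrN m hm]; simp
    have h2 : h m z = 0 := by rw [hherm z m, hz m hm]; simp
    simp [hydef, h1, h2]
  let a : Module.End ℂ W := (h.flip y).smulRight z
  have ha : ∀ x, a x = h x y • z := fun x => rfl
  have hU : ∀ t x, quadFamily a 0 t x = x + (t * h x y) • z := by
    intro t x
    simp [quadFamily, ha, smul_smul]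
  refine ⟨a, 0, ?_, ?_, ?_, ?_, ?_⟩
  · intro t x x' hxx
    rw [hU, hU] at hxx
    have := congrArg (fun w => h w y) hxx
    simp only [map_add, map_smul, LinearMap.add_apply, LinearMap.smul_apply, hzy, smul_zero,
      add_zero] at this
    rw [this] at hxx
    exact add_right_cancel hxx
  · intro t x x'
    rw [hb, hb]
  · intro t n hn
    rw [hU, hny n hn]
    simp
  · intro t n hn
    rw [hU]
    simp [hrN n hn, hz n hn]
  · intro δ hδ
    obtain ⟨e, he, heδ, hne⟩ := exists_small_ne_zero
      (fun e : ℝ => h (quadFamily a 0 e r) (quadFamily a 0 e r))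
      (2 * (h r z * h z r)) (h r z * h z r * h z z) 0 0 (by
        intro e
        rw [hU, hry]
        simp only [map_add, map_smul, LinearMap.add_apply, LinearMap.smul_apply, hrr,
          map_smulₛₗ, smul_eq_mul, map_mul, Complex.conj_ofReal, ← hherm r z]
        ring) (Or.inl (by simp [hrz, hzr])) δ hδ
    exact ⟨e, by simpa [abs_of_pos he] using heδ, hne⟩

/-- The properties of a hermitian form `h` and a bilinear form `b` that are related by an antilinear
map `τ`. -/
structure FormTriple (h : W →ₗ[ℂ] W →ₛₗ[starRingEnd ℂ] ℂ) (b : W →ₗ[ℂ] W →ₗ[ℂ] ℂ)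
    (τ : W →ₛₗ[starRingEnd ℂ] W) (σ η : ℂ) : Prop where
  herm : ∀ x y, h y x = conj (h x y)
  nondeg : ∀ x, (∀ y, h x y = 0) → x = 0
  h_eq : ∀ x y, h x y = b x (τ y)
  b_symm : ∀ x y, b y x = σ * b x y
  h_conj : ∀ x y, h (τ x) (τ y) = η * conj (h x y)
  tau_tau : ∀ x, τ (τ x) = (η * σ) • x
  sq_sigma : σ = 1 ∨ σ = -1
  sq_eta : η = 1 ∨ η = -1

namespace FormTriple

variable (H : FormTriple h b τ σ η)

include H

theorem sign_ne : η * σ ≠ 0 := by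
  rcases H.sq_sigma with h1 | h1 <;> rcases H.sq_eta with h2 | h2 <;> simp [h1, h2]

theorem sign_sq : (η * σ) * (η * σ) = 1 := by
  rcases H.sq_sigma with h1 | h1 <;> rcases H.sq_eta with h2 | h2 <;> simp [h1, h2]

theorem sign_conj : conj (η * σ) = η * σ := by
  rcases H.sq_sigma with h1 | h1 <;> rcases H.sq_eta with h2 | h2 <;> simp [h1, h2]

theorem h_tau (x y : W) : h x (τ y) = (η * σ) * b x y := by
  rw [H.h_eq, H.tau_tau, map_smul, smul_eq_mul]

theorem tau_h (x y : W) : h (τ x) y = (η * σ) * conj (b y x) := by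
  rw [H.herm y (τ x), H.h_tau, map_mul, H.sign_conj]

theorem h_eq_zero_comm {x y : W} : h x y = 0 ↔ h y x = 0 := by
  rw [H.herm y x, map_eq_zero]

theorem b_eq_zero_comm {x y : W} : b x y = 0 ↔ b y x = 0 := by
  rw [H.b_symm y x]
  rcases H.sq_sigma with h1 | h1 <;> simp [h1]

/-- The vectors orthogonal to `N` for both forms. -/
def biorthogonal (_ : FormTriple h b τ σ η) (N : Submodule ℂ W) : Submodule ℂ W where
  carrier := {x | ∀ n ∈ N, h x n = 0 ∧ b x n = 0}
  zero_mem' := by simp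
  add_mem' := by
    intro x y hx hy n hn
    simp [hx n hn, hy n hn]
  smul_mem' := by
    intro a x hx n hn
    simp [hx n hn]

variable {N : Submodule ℂ W} 

/-- Since `b` vanishes on `N`, the spaces `N` and `τ N` are `h`-orthogonal, and both are
nondegenerate. Projecting to them leaves a vector that is `h`-orthogonal to both, which is the same
as being orthogonal to `N` for `h` and `b`. -/
theorem exists_decomposition [FiniteDimensional ℂ N] (hN : ∀ x ∈ N, (∀ y ∈ N, h x y = 0) → x = 0)
    (hNb : ∀ x ∈ N, ∀ y ∈ N, b x y = 0) (x : W) :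
    ∃ n ∈ N, ∃ n' ∈ N, ∃ m ∈ H.biorthogonal N, x = n + τ n' + m := by
  obtain ⟨n, hn, hxn⟩ := exists_orthogonal_projection N hN x
  obtain ⟨n', hn', hxn'⟩ := exists_orthogonal_projection N hN (τ x)
  -- The component in `τ N` is found by projecting `τ x` to `N` and going back; the factor is the
  -- inverse of the scalar `τ² = η * σ`.
  refine ⟨n, hn, (η * σ) • n', N.smul_mem _ hn', x - n - τ ((η * σ) • n'), ?_, by abel⟩
  intro y hy
  constructor
  · rw [map_sub, LinearMap.sub_apply, hxn y hy, H.tau_h, map_smul, hNb y hy n' hn']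
    simp
  · have h1 : b n y = 0 := hNb n hn y hy
    have h2 := H.h_conj (τ x - n') y
    rw [hxn' y hy, map_sub, H.tau_tau, H.h_tau] at h2
    have h3 : b (x - τ ((η * σ) • n')) y = 0 := by
      have h4 : b ((η * σ) • x - τ n') y = 0 := by
        simpa [H.sign_ne] using h2
      have h5 : x - τ ((η * σ) • n') = (η * σ) • ((η * σ) • x - τ n') := by
        rw [smul_sub, smul_smul, H.sign_sq, one_smul, map_smulₛₗ, H.sign_conj]
      rw [h5, map_smul, LinearMap.smul_apply, h4, smul_zero]
    have h6 : x - n - τ ((η * σ) • n') = (x - τ ((η * σ) • n')) - n := by abel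
    rw [h6, map_sub, LinearMap.sub_apply, h3, h1, sub_zero]

theorem h_biorthogonal {m n n' : W} (hm : m ∈ H.biorthogonal N) (hn : n ∈ N) (hn' : n' ∈ N) :
    h m (n + τ n') = 0 := by
  rw [map_add, (hm n hn).1, H.h_tau, (hm n' hn').2]
  simp

theorem b_biorthogonal {m n n' : W} (hm : m ∈ H.biorthogonal N) (hn : n ∈ N) (hn' : n' ∈ N) :
    b m (n + τ n') = 0 := by
  rw [map_add, (hm n hn).2, ← H.h_eq, (hm n' hn').1]
  simp

/-- A vector orthogonal to the biorthogonal space is also orthogonal to `N + τ N`, hence to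
everything. The analogue for `b` follows in the same way. -/
theorem exists_h_ne_zero [FiniteDimensional ℂ N] (hN : ∀ x ∈ N, (∀ y ∈ N, h x y = 0) → x = 0)
    (hNb : ∀ x ∈ N, ∀ y ∈ N, b x y = 0) {r : W} (hr : r ∈ H.biorthogonal N) (hr0 : r ≠ 0) :
    ∃ m ∈ H.biorthogonal N, h m r ≠ 0 := by
  by_contra hcon
  push Not at hcon
  refine hr0 (H.nondeg r fun y => ?_)
  obtain ⟨n, hn, n', hn', m, hm, rfl⟩ := H.exists_decomposition hN hNb y
  rw [map_add, H.h_biorthogonal hr hn hn', H.h_eq_zero_comm.1 (hcon m hm), add_zero]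

theorem exists_b_ne_zero [FiniteDimensional ℂ N] (hN : ∀ x ∈ N, (∀ y ∈ N, h x y = 0) → x = 0)
    (hNb : ∀ x ∈ N, ∀ y ∈ N, b x y = 0) {r : W} (hr : r ∈ H.biorthogonal N) (hr0 : r ≠ 0) :
    ∃ m ∈ H.biorthogonal N, b r m ≠ 0 := by
  by_contra hcon
  push Not at hcon
  refine hr0 (H.nondeg r fun y => ?_)
  rw [H.h_eq]
  obtain ⟨n, hn, n', hn', m, hm, h1⟩ := H.exists_decomposition hN hNb (τ y)
  rw [h1, map_add, H.b_biorthogonal hr hn hn', hcon m hm, add_zero]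

theorem injective_of_preserves (U : Module.End ℂ W) (hU : ∀ x y, b (U x) (U y) = b x y) :
    Function.Injective U := by
  rw [← LinearMap.ker_eq_bot, LinearMap.ker_eq_bot']
  intro x hx
  refine H.nondeg x fun y => ?_
  rw [H.h_eq, ← hU, hx]
  simp

/-- A symplectic transvection in the direction `p`, scaled by `h r p / b r p` so that `r` moves to
`r + t * h r p • p`. The linear term is then `2 |h r p|² > 0`. -/
theorem hasDeformation_of_antisymm [FiniteDimensional ℂ N] (hσ : σ = -1)
    (hN : ∀ x ∈ N, (∀ y ∈ N, h x y = 0) → x = 0) (hNb : ∀ x ∈ N, ∀ y ∈ N, b x y = 0)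
    (r : W) (hr0 : r ≠ 0) (hr : r ∈ H.biorthogonal N) (hrr : h r r = 0) :
    HasDeformation h b N r := by
  -- One vector witnesses both inequalities: if the witnesses `p` for `h` and `p'` for `b` each fail
  -- the other condition, their sum satisfies both.
  obtain ⟨p, hp, hhp, hbp⟩ : ∃ p ∈ H.biorthogonal N, h p r ≠ 0 ∧ b r p ≠ 0 := by
    obtain ⟨p, hp, h1⟩ := H.exists_h_ne_zero hN hNb hr hr0
    obtain ⟨p', hp', h2⟩ := H.exists_b_ne_zero hN hNb hr hr0
    by_cases h3 : b r p = 0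
    · by_cases h4 : h p' r = 0
      · exact ⟨p + p', Submodule.add_mem _ hp hp', by simpa [h4] using h1, by simpa [h3] using h2⟩
      · exact ⟨p', hp', h4, h2⟩
    · exact ⟨p, hp, h1, h3⟩
  have hrp : h r p ≠ 0 := fun h0 => hhp (H.h_eq_zero_comm.1 h0)
  have hpp : b p p = 0 := by
    have := H.b_symm p p
    rw [hσ] at this
    linear_combination this / 2
  let a : Module.End ℂ W := (b.flip p).smulRight ((h r p / b r p) • p)
  have hU : ∀ t x, quadFamily a 0 t x = x + (t * (h r p / b r p) * b x p) • p := by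
    intro t x
    simp only [quadFamily, a, LinearMap.add_apply, Module.End.one_apply, LinearMap.smul_apply,
      LinearMap.smulRight_apply, LinearMap.flip_apply, smul_smul, smul_zero, add_zero]
    congr 2
    ring
  have hpres : ∀ t x y, b (quadFamily a 0 t x) (quadFamily a 0 t y) = b x y := by
    intro t x y
    rw [hU, hU]
    simp only [map_add, map_smul, LinearMap.add_apply, LinearMap.smul_apply, smul_eq_mul, hpp,
      H.b_symm y p, hσ]
    ring
  refine ⟨a, 0, fun t => H.injective_of_preserves _ (hpres t), hpres, ?_, ?_, ?_⟩
  · intro t n hn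
    rw [hU, H.b_eq_zero_comm.1 (hp n hn).2]
    simp
  · intro t n hn
    rw [hU]
    simp [(hr n hn).1, (hp n hn).1]
  · intro δ hδ
    obtain ⟨e, he, heδ, hne⟩ := exists_small_ne_zero
      (fun e : ℝ => h (quadFamily a 0 e r) (quadFamily a 0 e r))
      (2 * (h r p * h p r)) (h r p * h p r * h p p) 0 0 (by
        intro e
        have h1 : (e : ℂ) * (h r p / b r p) * b r p = e * h r p := by field_simp
        rw [hU, h1]
        simp only [map_add, map_smul, LinearMap.add_apply, LinearMap.smul_apply, hrr,
          map_smulₛₗ, smul_eq_mul, map_mul, Complex.conj_ofReal, ← H.herm r p]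
        ring) (Or.inl (by simp [hrp, hhp])) δ hδ
    exact ⟨e, by simpa [abs_of_pos he] using heδ, hne⟩

/-- A Siegel transformation built from a hyperbolic partner `p` of `r` and a vector `q` that is
`b`-orthogonal to both. It moves `r` to `r + t c q - (t c)² / 2 * b q q • p`, and `c` is chosen so
that the square of this vector has a nonzero term of order one or two. The hypothesis `hbig` says
that the biorthogonal space is larger than the hyperbolic plane. -/
theorem hasDeformation_of_symm [FiniteDimensional ℂ N] (hσ : σ = 1)
    (hN : ∀ x ∈ N, (∀ y ∈ N, h x y = 0) → x = 0) (hNb : ∀ x ∈ N, ∀ y ∈ N, b x y = 0)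
    (r : W) (hr0 : r ≠ 0) (hr : r ∈ H.biorthogonal N) (hrr : h r r = 0) (hbr : b r r = 0)
    (hbig : ∀ p ∈ H.biorthogonal N, b r p = 1 → b p p = 0 →
      ∃ q ∈ H.biorthogonal N, q ≠ 0 ∧ b q r = 0 ∧ b q p = 0) :
    HasDeformation h b N r := by
  have hsymm : ∀ x y, b y x = b x y := fun x y => by rw [H.b_symm x y, hσ, one_mul]
  -- Scaling gives `b r p = 1`; subtracting a multiple of the `b`-isotropic `r` then makes `p`
  -- isotropic.
  obtain ⟨p, hp, hrp, hpp⟩ : ∃ p ∈ H.biorthogonal N, b r p = 1 ∧ b p p = 0 := by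
    obtain ⟨p, hp, h1⟩ := H.exists_b_ne_zero hN hNb hr hr0
    refine ⟨(b r p)⁻¹ • p - ((b r p)⁻¹ ^ 2 * b p p / 2) • r,
      Submodule.sub_mem _ (Submodule.smul_mem _ _ hp) (Submodule.smul_mem _ _ hr), ?_, ?_⟩
    · simp [hbr, h1]
    · simp only [map_sub, map_smul, LinearMap.sub_apply, LinearMap.smul_apply, smul_eq_mul, hbr,
        hsymm r p]
      field_simp
      ring
  -- If no such `q` existed, the `b`-complement of `r`, `p` would be totally `h`-isotropic by
  -- polarization and `h`-orthogonal to `r`. This leaves too few directions for `h` to be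
  -- nondegenerate.
  obtain ⟨q, hq, hqr, hqp, hne⟩ : ∃ q ∈ H.biorthogonal N, b q r = 0 ∧ b q p = 0 ∧
      (h q r ≠ 0 ∨ h q q ≠ 0) := by
    obtain ⟨q, hq, hq0, hqr, hqp⟩ := hbig p hp hrp hpp
    by_contra hcon
    push Not at hcon
    have hvan : ∀ y ∈ H.biorthogonal N, b y r = 0 → b y p = 0 → h y r = 0 ∧ h q y = 0 := by
      intro y hy hyr hyp
      obtain ⟨h1, h2⟩ := hcon y hy hyr hyp
      obtain ⟨h3, h4⟩ := hcon q hq hqr hqp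
      refine ⟨h1, ?_⟩
      have h5 := (hcon (q + y) (Submodule.add_mem _ hq hy) (by simp [hqr, hyr])
        (by simp [hqp, hyp])).2
      have h6 := (hcon (q + Complex.I • y)
        (Submodule.add_mem _ hq (Submodule.smul_mem _ _ hy)) (by simp [hqr, hyr])
        (by simp [hqp, hyp])).2
      simp only [map_add, LinearMap.add_apply, map_smul, map_smulₛₗ, LinearMap.smul_apply, h2, h4,
        smul_eq_mul, Complex.conj_I] at h5 h6
      have h7 := Complex.I_mul_I
      linear_combination h5 / 2 + Complex.I / 2 * h6 + (h q y / 2 - h y q / 2) * h7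
    have hspan : ∀ m ∈ H.biorthogonal N, ∃ y ∈ H.biorthogonal N, b y r = 0 ∧ b y p = 0 ∧
        m = y + b m p • r + b m r • p := by
      intro m hm
      refine ⟨m - b m p • r - b m r • p, Submodule.sub_mem _ (Submodule.sub_mem _ hm
        (Submodule.smul_mem _ _ hr)) (Submodule.smul_mem _ _ hp), ?_, ?_, by abel⟩
      · simp [hbr, hsymm r p, hrp]
      · simp [hpp, hrp]
    have hrp' : h p r ≠ 0 := by
      obtain ⟨m, hm, h1⟩ := H.exists_h_ne_zero hN hNb hr hr0
      obtain ⟨y, hy, hyr, hyp, h2⟩ := hspan m hm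
      rw [h2] at h1
      simp only [map_add, LinearMap.add_apply, map_smul, LinearMap.smul_apply, hrr,
        (hvan y hy hyr hyp).1] at h1
      intro h0
      simp [h0] at h1
    have h4 := (hcon q hq hqr hqp).1
    -- The multiple of `r` makes `x` orthogonal to `p` as well, so `x = 0` and `q` is a multiple of
    -- `r`. Pairing with `p` under `b` then forces `q = 0`.
    set x := q - (h q p / h r p) • r with hx
    have hrp2 : h r p ≠ 0 := fun h0 => hrp' (H.h_eq_zero_comm.1 h0)
    have hx0 : x = 0 := by
      by_contra hx0
      obtain ⟨m, hm, h1⟩ := H.exists_h_ne_zero hN hNb (r := x)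
        (Submodule.sub_mem _ hq (Submodule.smul_mem _ _ hr)) hx0
      apply h1
      rw [← H.h_eq_zero_comm]
      obtain ⟨y, hy, hyr, hyp, h2⟩ := hspan m hm
      rw [h2]
      have h5 : h r y = 0 := H.h_eq_zero_comm.1 (hvan y hy hyr hyp).1
      simp only [hx, map_add, LinearMap.sub_apply, map_smul, LinearMap.smul_apply, hrr,
        (hvan y hy hyr hyp).2, map_smulₛₗ, map_sub, h4, h5, smul_eq_mul]
      field_simp
      simp
    have h6 : b x p = 0 := by rw [hx0]; simp
    simp only [hx, map_sub, LinearMap.sub_apply, hqp, map_smul, LinearMap.smul_apply, hrp,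
      smul_eq_mul] at h6
    have h7 : h q p / h r p = 0 := by linear_combination -h6
    rw [hx, h7, zero_smul, sub_zero] at hx0
    exact hq0 hx0
  have hrq : b r q = 0 := by rw [hsymm q r, hqr]
  have hpq : b p q = 0 := by rw [hsymm q p, hqp]
  have hfam : ∀ c : ℂ, ∃ a₁ a₂ : Module.End ℂ W, ∀ t x, quadFamily a₁ a₂ t x =
      x + (t * c) • (b x p • q - b x q • p) - ((t * c) ^ 2 / 2 * b q q * b x p) • p := by
    intro c
    refine ⟨c • ((b.flip p).smulRight q - (b.flip q).smulRight p),
      (- (c ^ 2 / 2 * b q q)) • (b.flip p).smulRight p, ?_⟩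
    intro t x
    simp only [quadFamily, LinearMap.add_apply, LinearMap.sub_apply, Module.End.one_apply,
      LinearMap.smul_apply, LinearMap.smulRight_apply, LinearMap.flip_apply]
    module
  have hmain : ∀ c : ℂ, (∀ δ : ℝ, 0 < δ → ∃ e : ℝ, 0 < e ∧ e < δ ∧
      h (r + (e * c) • q - ((e * c) ^ 2 / 2 * b q q) • p)
        (r + (e * c) • q - ((e * c) ^ 2 / 2 * b q q) • p) ≠ 0) → HasDeformation h b N r := by
    intro c hc
    obtain ⟨a₁, a₂, hU⟩ := hfam c
    have hpres : ∀ t x y, b (quadFamily a₁ a₂ t x) (quadFamily a₁ a₂ t y) = b x y := by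
      intro t x y
      rw [hU, hU]
      simp only [map_add, map_sub, map_smul, LinearMap.add_apply, LinearMap.sub_apply,
        LinearMap.smul_apply, smul_eq_mul, hpp, hqp, hpq, hsymm y p, hsymm y q]
      ring
    refine ⟨a₁, a₂, fun t => H.injective_of_preserves _ (hpres t), hpres, ?_, ?_, ?_⟩
    · intro t n hn
      rw [hU, H.b_eq_zero_comm.1 (hp n hn).2, H.b_eq_zero_comm.1 (hq n hn).2]
      simp
    · intro t n hn
      rw [hU]
      simp [(hr n hn).1, (hp n hn).1, (hq n hn).1]
    · intro δ hδ
      obtain ⟨e, he, heδ, hne⟩ := hc δ hδ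
      refine ⟨e, by simpa [abs_of_pos he] using heδ, ?_⟩
      rw [hU, hrp, hrq]
      simpa using hne
  have hexp : ∀ (c : ℂ) (e : ℝ), h (r + (e * c) • q - ((e * c) ^ 2 / 2 * b q q) • p)
        (r + (e * c) • q - ((e * c) ^ 2 / 2 * b q q) • p) =
      (c * h q r + conj (c * h q r)) * e
      + (c * conj c * h q q - (c ^ 2 / 2 * b q q * h p r + conj (c ^ 2 / 2 * b q q * h p r)))
        * e ^ 2
      + (- c * conj (c ^ 2 / 2 * b q q) * h q p - conj c * (c ^ 2 / 2 * b q q) * h p q) * e ^ 3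
      + (c ^ 2 / 2 * b q q * conj (c ^ 2 / 2 * b q q) * h p p) * e ^ 4 := by
    intro c e
    simp only [map_add, map_sub, map_smul, LinearMap.add_apply, LinearMap.sub_apply,
      LinearMap.smul_apply, map_smulₛₗ, smul_eq_mul, map_mul, map_pow, map_div₀,
      Complex.conj_ofReal, hrr, ← H.herm q r, ← H.herm p r]
    ring
  -- If `h q r ≠ 0`, the choice `c = conj (h q r)` gives a positive linear term. Otherwise the
  -- quadratic coefficients for `c = 1` and `c = I` add up to `2 * h q q ≠ 0`, because `c²` changes
  -- sign and `|c|²` does not; so one of them is nonzero.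
  by_cases hqr0 : h q r = 0
  · have hqq : h q q ≠ 0 := hne.resolve_left (not_not.2 hqr0)
    set ρ := b q q * h p r with hρ
    by_cases h1 : h q q - (1 / 2 * ρ + conj (1 / 2 * ρ)) = 0
    · refine hmain Complex.I fun δ hδ => exists_small_ne_zero _ _ _ _ _ (hexp _)
        (Or.inr ?_) δ hδ
      intro h2
      apply hqq
      simp only [hρ, map_mul, Complex.conj_I, Complex.I_sq, map_div₀, map_neg, map_one] at h1 h2
      have h7 := Complex.I_mul_I
      linear_combination h1 / 2 + h2 / 2 + (h q q / 2) * h7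
    · refine hmain 1 fun δ hδ => exists_small_ne_zero _ _ _ _ _ (hexp _)
        (Or.inr ?_) δ hδ
      intro h2
      apply h1
      simp only [hρ, map_mul, map_div₀, map_one, map_pow] at h2 ⊢
      linear_combination h2
  · refine hmain (conj (h q r)) fun δ hδ => exists_small_ne_zero _ _ _ _ _ (hexp _)
      (Or.inl ?_) δ hδ
    have : conj (h q r) * h q r ≠ 0 := by simp [hqr0]
    simp only [map_mul, Complex.conj_conj]
    intro h0
    apply this
    linear_combination h0 / 2

end FormTriple

end Deformation

/-! ### Square roots, intertwiners, polar decomposition and Cayley paths in finite dimensional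
algebras -/

section NormedRings

variable {A : Type*} [NormedRing A] [NormedAlgebra ℝ A]

/-- Square roots near `1` can be chosen in any subspace that is closed under squaring. -/
theorem eventually_exists_sq [FiniteDimensional ℝ A] (S : Submodule ℝ A) (h1 : (1 : A) ∈ S)
    (hS : ∀ x ∈ S, x * x ∈ S) {O : Set A} (hO : O ∈ 𝓝 (1 : A)) :
    ∀ᶠ y in 𝓝 (1 : A), y ∈ S → ∃ x ∈ O, x ∈ S ∧ x * x = y := by
  let e : S := ⟨1, h1⟩
  let f : S → S := fun x => ⟨x * x, hS x x.2⟩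
  have : CompleteSpace S := FiniteDimensional.complete ℝ S
  let L : S ≃L[ℝ] S := ContinuousLinearEquiv.smulLeft (Units.mk0 (2 : ℝ) two_ne_zero)
  -- The derivative of squaring at `1` is multiplication by two: `x² - y² - 2 (x - y) = (x - 1)(x -
  -- y) + (x - y)(y - 1)`. The inverse function theorem inside `S` then gives the square roots.
  have hf : HasStrictFDerivAt f (L : S →L[ℝ] S) e := by
    refine .of_isLittleO ?_
    rw [Asymptotics.isLittleO_iff]
    intro c hc
    have : ∀ᶠ p : S × S in 𝓝 (e, e), ‖(p.1 : A) - 1‖ < c / 2 ∧ ‖(p.2 : A) - 1‖ < c / 2 := by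
      refine Filter.Eventually.and ?_ ?_
      · have : Tendsto (fun p : S × S => ‖(p.1 : A) - 1‖) (𝓝 (e, e)) (𝓝 ‖(e : A) - 1‖) :=
          Continuous.tendsto (by fun_prop) (e, e)
        exact this.eventually_lt_const (by simpa [e] using by positivity)
      · have : Tendsto (fun p : S × S => ‖(p.2 : A) - 1‖) (𝓝 (e, e)) (𝓝 ‖(e : A) - 1‖) :=
          Continuous.tendsto (by fun_prop) (e, e)
        exact this.eventually_lt_const (by simpa [e] using by positivity)
    filter_upwards [this] with p hp
    have key : ((f p.1 - f p.2 - L (p.1 - p.2) : S) : A) =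
        ((p.1 : A) - 1) * ((p.1 : A) - p.2) + ((p.1 : A) - p.2) * ((p.2 : A) - 1) := by
      have : ((L (p.1 - p.2) : S) : A) = (2 : ℝ) • ((p.1 : A) - p.2) := rfl
      rw [Submodule.coe_sub, Submodule.coe_sub, this, two_smul]
      simp only [f]
      noncomm_ring
    calc ‖f p.1 - f p.2 - L (p.1 - p.2)‖
        = ‖((p.1 : A) - 1) * ((p.1 : A) - p.2) + ((p.1 : A) - p.2) * ((p.2 : A) - 1)‖ := by
          rw [← key]; rfl
      _ ≤ ‖(p.1 : A) - 1‖ * ‖(p.1 : A) - p.2‖ + ‖(p.1 : A) - p.2‖ * ‖(p.2 : A) - 1‖ :=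
          (norm_add_le _ _).trans (add_le_add (norm_mul_le _ _) (norm_mul_le _ _))
      _ ≤ c / 2 * ‖(p.1 : A) - p.2‖ + ‖(p.1 : A) - p.2‖ * (c / 2) := by
          gcongr
          · exact hp.1.le
          · exact hp.2.le
      _ = c * ‖(p.1 : A) - p.2‖ := by ring
      _ = c * ‖p.1 - p.2‖ := rfl
  have hmap := hf.map_nhds_eq_of_equiv
  have hfe : f e = e := Subtype.ext (mul_one 1)
  rw [hfe] at hmap
  have hO' : (Subtype.val : S → A) ⁻¹' O ∈ 𝓝 e := continuous_subtype_val.continuousAt hO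
  have h2 : f '' ((Subtype.val : S → A) ⁻¹' O) ∈ 𝓝 e := hmap ▸ image_mem_map hO'
  rw [nhds_subtype_eq_comap, mem_comap] at h2
  obtain ⟨t, ht, hsub⟩ := h2
  filter_upwards [ht] with y hy hyS
  obtain ⟨x, hx, hxy⟩ := hsub (show (⟨y, hyS⟩ : S) ∈ _ from hy)
  exact ⟨x, hx, x.2, congrArg Subtype.val hxy⟩

/-- For increasing sequences of projections `p` and `q`, the sum of the products of corresponding
projections of the two gradings, up to step `n`. -/
def transporter {A : Type*} [Ring A] (p q : ℕ → A) : ℕ → A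
  | 0 => 1
  | n + 1 => q n * transporter p q n * p n + (1 - q n) * (1 - p n)

/-- The summand `(1 - q n) * (1 - p n)` is killed by `p i` on the right and by `q i` on the left for
`i ≤ n`. What remains is the relation one step earlier, or, for `i = n`, the same element `q n *
transporter p q n * p n` on both sides. -/
theorem transporter_mul {A : Type*} [Ring A] {p q : ℕ → A}
    (hp : ∀ i j, i ≤ j → p i * p j = p i ∧ p j * p i = p i)
    (hq : ∀ i j, i ≤ j → q i * q j = q i ∧ q j * q i = q i) (n i : ℕ) (hi : i < n) :
    transporter p q n * p i = q i * transporter p q n := by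
  induction n with
  | zero => omega
  | succ n ih =>
    have hin : i ≤ n := Nat.lt_succ_iff.1 hi
    obtain ⟨hp1, hp2⟩ := hp i n hin
    obtain ⟨hq1, hq2⟩ := hq i n hin
    have e1 : transporter p q (n + 1) * p i = q n * (transporter p q n * p i) := by
      simp only [transporter]
      rw [add_mul, mul_assoc _ (p n), hp2, mul_assoc (1 - q n), sub_mul 1 (p n), hp2, one_mul,
        sub_self, mul_zero, add_zero, mul_assoc]
    have e2 : q i * transporter p q (n + 1) = (q i * transporter p q n) * p n := by
      simp only [transporter]
      rw [mul_add, ← mul_assoc, ← mul_assoc, hq1, ← mul_assoc (q i) (1 - q n), mul_sub (q i) 1, hq1,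
        mul_one, sub_self, zero_mul, add_zero]
    rw [e1, e2]
    rcases hin.lt_or_eq with h | h
    · rw [ih h, ← mul_assoc, hq2, ← ih h, mul_assoc, hp1]
    · subst h
      rw [mul_assoc]

theorem transporter_self {A : Type*} [Ring A] {p : ℕ → A} (hp : ∀ i, p i * p i = p i) (n : ℕ) :
    transporter p p n = 1 := by
  induction n with
  | zero => rfl
  | succ n ih =>
    simp only [transporter, ih, mul_one, hp, mul_sub, sub_mul, one_mul]
    abel

theorem tendsto_transporter {A : Type*} [NormedRing A] {X : Type*} {l : Filter X} {p : ℕ → A} {q : X → ℕ → A}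
    (hp : ∀ i, p i * p i = p i) (hq : ∀ i, Tendsto (fun x => q x i) l (𝓝 (p i))) (n : ℕ) :
    Tendsto (fun x => transporter p (q x) n) l (𝓝 1) := by
  rw [← transporter_self hp n]
  induction n with
  | zero => exact tendsto_const_nhds
  | succ n ih =>
    simp only [transporter]
    exact (((hq n).mul ih).mul tendsto_const_nhds).add
      ((tendsto_const_nhds.sub (hq n)).mul tendsto_const_nhds)

/-- An anti-involution `st` and a commuting automorphism `θ` of order two. -/
structure InvolutionPair {A : Type*} [Ring A] (st θ : A →+ A) : Prop where
  st_mul : ∀ x y, st (x * y) = st y * st x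
  st_st : ∀ x, st (st x) = x
  th_mul : ∀ x y, θ (x * y) = θ x * θ y
  th_th : ∀ x, θ (θ x) = x
  comm : ∀ x, θ (st x) = st (θ x)

namespace InvolutionPair

variable {st θ : A →+ A} 

theorem st_one {A : Type*} [Ring A] {st θ : A →+ A} (H : InvolutionPair st θ) : st 1 = 1 := by
  have := H.st_mul (st 1) 1
  rw [mul_one, H.st_st, mul_one] at this
  exact this.symm

theorem th_one {A : Type*} [Ring A] {st θ : A →+ A} (H : InvolutionPair st θ) : θ 1 = 1 := by
  have := H.th_mul (θ 1) 1
  rw [mul_one, H.th_th, one_mul] at this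
  exact this.symm

variable [FiniteDimensional ℝ A] (H : InvolutionPair st θ) (hst : Continuous st) (hθ : Continuous θ)

include H hst hθ

/-- Near the identity, elements intertwining two families of self-adjoint projections can be made
unitary by polar decomposition. -/
theorem eventually_exists_unitary {X ι : Type*} {l : Filter X} {T : X → A}
    (hT : Tendsto T l (𝓝 1)) {good : X → Prop} {P : ι → A} {Q : X → ι → A}
    (hTP : ∀ᶠ x in l, good x → ∀ i, T x * P i = Q x i * T x)
    (hTθ : ∀ᶠ x in l, good x → ∀ i, θ (T x) * P i = Q x i * θ (T x))
    (hP : ∀ i, st (P i) = P i) (hQ : ∀ᶠ x in l, good x → ∀ i, st (Q x i) = Q x i)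
    {O : Set A} (hO : O ∈ 𝓝 (1 : A)) :
    ∀ᶠ x in l, good x → ∃ w ∈ O, st w * w = 1 ∧ θ w = w ∧ ∀ i, w * P i = Q x i * w := by
  have : CompleteSpace A := FiniteDimensional.complete ℝ A
  let stL := st.toRealLinearMap hst
  let θL := θ.toRealLinearMap hθ
  have hstL : ∀ x, stL x = st x := fun _ => rfl
  have hθL : ∀ x, θL x = θ x := fun _ => rfl
  -- Square roots are taken within the self-adjoint, `θ`-invariant elements that commute with all `P
  -- i`, so that dividing by them spoils neither `θ`-invariance nor the intertwining relation.
  let S : Submodule ℝ A :=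
    { carrier := {x | st x = x ∧ θ x = x ∧ ∀ i, x * P i = P i * x}
      zero_mem' := by simp
      add_mem' := by
        rintro x y ⟨h1, h2, h3⟩ ⟨h4, h5, h6⟩
        exact ⟨by rw [map_add, h1, h4], by rw [map_add, h2, h5],
          fun i => by rw [add_mul, mul_add, h3, h6]⟩
      smul_mem' := by
        rintro a x ⟨h1, h2, h3⟩
        refine ⟨?_, ?_, fun i => by rw [smul_mul_assoc, mul_smul_comm, h3]⟩
        · rw [← hstL, map_smul, hstL, h1]
        · rw [← hθL, map_smul, hθL, h2] }
  have hS1 : (1 : A) ∈ S := ⟨H.st_one, H.th_one, fun i => by rw [one_mul, mul_one]⟩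
  have hSsq : ∀ x ∈ S, x * x ∈ S := by
    rintro x ⟨h1, h2, h3⟩
    exact ⟨by rw [H.st_mul, h1], by rw [H.th_mul, h2],
      fun i => by rw [mul_assoc, h3, ← mul_assoc, h3, mul_assoc]⟩
  -- Averaging makes the intertwiner `θ`-invariant; by `hTθ` the average still intertwines.
  let T' : X → A := fun x => (2⁻¹ : ℝ) • (T x + θ (T x))
  have hT' : Tendsto T' l (𝓝 1) := by
    have h1 : Tendsto (fun x => θ (T x)) l (𝓝 1) := by
      have := (hθ.tendsto 1).comp hT
      rwa [H.th_one] at this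
    have h2 := (hT.add h1).const_smul (2⁻¹ : ℝ)
    have h3 : (2⁻¹ : ℝ) • ((1 : A) + 1) = 1 := by
      rw [← two_smul ℝ (1 : A), smul_smul]
      norm_num
    rwa [h3] at h2
  have hY : Tendsto (fun x => st (T' x) * T' x) l (𝓝 1) := by
    have h1 : Tendsto (fun x => st (T' x)) l (𝓝 1) := by
      have := (hst.tendsto 1).comp hT'
      rwa [H.st_one] at this
    have := h1.mul hT'
    rwa [one_mul] at this
  have hcont : Tendsto (fun p : A × A => p.1 * Ring.inverse p.2) (𝓝 1 ×ˢ 𝓝 1) (𝓝 1) := by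
    have h1 : ContinuousAt (Ring.inverse : A → A) 1 := NormedRing.inverse_continuousAt 1
    have h2 : Tendsto (fun p : A × A => Ring.inverse p.2) (𝓝 1 ×ˢ 𝓝 1) (𝓝 1) := by
      have := h1.tendsto.comp (tendsto_snd (f := 𝓝 (1 : A)) (g := 𝓝 (1 : A)))
      rwa [Ring.inverse_one] at this
    have := (tendsto_fst (f := 𝓝 (1 : A)) (g := 𝓝 (1 : A))).mul h2
    rwa [one_mul] at this
  obtain ⟨O₁, hO₁, O₂, hO₂, hsub⟩ := mem_prod_iff.1 (hcont hO)
  have hunit : {x : A | IsUnit x} ∈ 𝓝 (1 : A) := Units.isOpen.mem_nhds isUnit_one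
  have hsq := hY.eventually (eventually_exists_sq S hS1 hSsq (Filter.inter_mem hO₂ hunit))
  filter_upwards [hTP, hTθ, hQ, hsq, hT' hO₁] with x h1 h2 h3 h4 h5 hg
  specialize h1 hg
  specialize h2 hg
  specialize h3 hg
  have hTP' : ∀ i, T' x * P i = Q x i * T' x := by
    intro i
    simp only [T', smul_mul_assoc, mul_smul_comm, add_mul, mul_add, h1, h2]
  have hθT' : θ (T' x) = T' x := by
    simp only [T']
    rw [← hθL, map_smul, map_add, hθL, hθL, H.th_th, add_comm]
  have hPT' : ∀ i, P i * st (T' x) = st (T' x) * Q x i := by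
    intro i
    have := congrArg st (hTP' i)
    rwa [H.st_mul, H.st_mul, hP, h3] at this
  -- Polar decomposition: `z` is the square root of `st (T' x) * T' x`, and `T' x * z⁻¹` is the
  -- unitary factor.
  obtain ⟨z, ⟨hz2, hzu⟩, ⟨hzst, hzθ, hzP⟩, hzz⟩ := h4 (by
    refine ⟨by rw [H.st_mul, H.st_st], by rw [H.th_mul, H.comm, hθT'], fun i => ?_⟩
    rw [mul_assoc, hTP', ← mul_assoc, ← hPT', mul_assoc])
  obtain ⟨v, hv⟩ := id hzu
  have hzi : Ring.inverse z = (↑v⁻¹ : A) := by rw [← hv, Ring.inverse_unit]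
  refine ⟨T' x * Ring.inverse z, hsub (Set.mk_mem_prod h5 hz2), ?_⟩
  rw [hzi]
  have hvz : (↑v⁻¹ : A) * z = 1 := by rw [← hv]; simp
  have hzv : z * (↑v⁻¹ : A) = 1 := by rw [← hv]; simp
  have hsti : st (↑v⁻¹ : A) = ↑v⁻¹ := by
    have h7 := congrArg st hzv
    rw [H.st_mul, H.st_one, hzst] at h7
    calc st (↑v⁻¹ : A) = st (↑v⁻¹ : A) * (z * ↑v⁻¹) := by rw [hzv, mul_one]
      _ = ↑v⁻¹ := by rw [← mul_assoc, h7, one_mul]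
  have hθi : θ (↑v⁻¹ : A) = ↑v⁻¹ := by
    have h7 := congrArg θ hvz
    rw [H.th_mul, H.th_one, hzθ] at h7
    calc θ (↑v⁻¹ : A) = θ (↑v⁻¹ : A) * (z * ↑v⁻¹) := by rw [hzv, mul_one]
      _ = ↑v⁻¹ := by rw [← mul_assoc, h7, one_mul]
  refine ⟨?_, by rw [H.th_mul, hθi, hθT'], fun i => ?_⟩
  · rw [H.st_mul, hsti]
    calc ↑v⁻¹ * st (T' x) * (T' x * ↑v⁻¹) = ↑v⁻¹ * (st (T' x) * T' x) * ↑v⁻¹ := by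
          simp only [mul_assoc]
      _ = 1 := by rw [← hzz, ← mul_assoc, hvz, one_mul, hzv]
  · have h8 : (↑v⁻¹ : A) * P i = P i * ↑v⁻¹ := by
      calc (↑v⁻¹ : A) * P i = ↑v⁻¹ * (P i * z) * ↑v⁻¹ := by
            rw [mul_assoc, mul_assoc, hzv, mul_one]
        _ = P i * ↑v⁻¹ := by rw [← hzP, ← mul_assoc, hvz, one_mul]
    rw [mul_assoc, h8, ← mul_assoc, hTP', mul_assoc]

/-- Unitary elements near the identity are joined to it by a path of unitary elements (the Cayley
transform of a segment). -/
theorem eventually_exists_path : ∀ᶠ w in 𝓝 (1 : A), st w * w = 1 → θ w = w →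
    ∃ c : unitInterval → A, Continuous c ∧ c 0 = 1 ∧ c 1 = w ∧
      ∀ t, st (c t) * c t = 1 ∧ c t * st (c t) = 1 ∧ θ (c t) = c t := by
  have : CompleteSpace A := FiniteDimensional.complete ℝ A
  let stL := st.toRealLinearMap hst
  let θL := θ.toRealLinearMap hθ
  have hstL : ∀ x, stL x = st x := fun _ => rfl
  have hθL : ∀ x, θL x = θ x := fun _ => rfl
  have h2u : IsUnit ((1 : A) + 1) := by
    have : (1 : A) + 1 = algebraMap ℝ A 2 := by
      rw [map_ofNat, one_add_one_eq_two]
    rw [this]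
    exact (IsUnit.mk0 (2 : ℝ) two_ne_zero).map (algebraMap ℝ A)
  obtain ⟨u₂, hu₂⟩ := id h2u
  have hX : Tendsto (fun w : A => (w - 1) * Ring.inverse (w + 1)) (𝓝 1) (𝓝 0) := by
    have h1 : ContinuousAt (Ring.inverse : A → A) (1 + 1) := hu₂ ▸ NormedRing.inverse_continuousAt u₂
    have h2 : Tendsto (fun w : A => Ring.inverse (w + 1)) (𝓝 1) (𝓝 (Ring.inverse (1 + 1))) :=
      h1.tendsto.comp ((continuous_id.add continuous_const).tendsto 1)
    have h3 : Tendsto (fun w : A => w - 1) (𝓝 1) (𝓝 0) := by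
      have : Tendsto (fun w : A => w - 1) (𝓝 1) (𝓝 (1 - 1)) := tendsto_id.sub tendsto_const_nhds
      rwa [sub_self] at this
    simpa using h3.mul h2
  have hsmall : ∀ᶠ w : A in 𝓝 1, ‖(w - 1) * Ring.inverse (w + 1)‖ < 1 := by
    have := hX.norm
    rw [norm_zero] at this
    exact this.eventually_lt_const one_pos
  have hunit : ∀ᶠ w : A in 𝓝 1, IsUnit w := Units.isOpen.mem_nhds isUnit_one
  have hunit2 : ∀ᶠ w : A in 𝓝 1, IsUnit (w + 1) :=
    ((continuous_id.add continuous_const).tendsto (1 : A)).eventually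
      (Units.isOpen.mem_nhds h2u)
  filter_upwards [hsmall, hunit, hunit2] with w hw1 hw2 hw3 hstw hθw
  -- The Cayley transform `x` of `w` is skew for `st` and fixed by `θ`. These are linear conditions,
  -- so they hold along `t • x`, and `(1 + t x)(1 - t x)⁻¹` joins `1` to `w`. The bound `‖x‖ < 1`
  -- keeps `1 - t x` invertible.
  set x := (w - 1) * Ring.inverse (w + 1) with hx
  obtain ⟨v, hv⟩ := id hw3
  have hx1 : x * (w + 1) = w - 1 := by
    rw [hx, mul_assoc, Ring.inverse_mul_cancel _ hw3, mul_one]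
  have hx2 : (w + 1) * x = w - 1 := by
    have hc : (w + 1) * (w - 1) = (w - 1) * (w + 1) := by noncomm_ring
    rw [hx, ← mul_assoc, hc, mul_assoc, Ring.mul_inverse_cancel _ hw3, mul_one]
  have hwst : w * st w = 1 := by
    obtain ⟨w', rfl⟩ := hw2
    rw [(Units.mul_eq_one_iff_eq_inv).1 hstw]
    simp
  have hstx : st x = -x := by
    have h1 := congrArg st hx1
    rw [H.st_mul, map_add, map_sub, H.st_one] at h1
    have h2 : (w + 1) * st x = (w + 1) * (-x) := by
      calc (w + 1) * st x = w * ((st w + 1) * st x) := by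
            rw [← mul_assoc, mul_add, hwst, mul_one, add_comm]
        _ = (w + 1) * (-x) := by
            rw [h1, mul_neg, hx2, mul_sub, hwst, mul_one, neg_sub]
    exact hw3.mul_left_cancel h2
  have hθx : θ x = x := by
    have h1 := congrArg θ hx1
    rw [H.th_mul, map_add, map_sub, H.th_one, hθw, ← hx1] at h1
    exact hw3.mul_right_cancel h1
  have hun : ∀ t : unitInterval, IsUnit (1 - (t : ℝ) • x) := by
    intro t
    refine isUnit_one_sub_of_norm_lt_one ?_
    rw [norm_smul, Real.norm_eq_abs, abs_of_nonneg t.2.1]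
    calc (t : ℝ) * ‖x‖ ≤ 1 * ‖x‖ := by gcongr; exact t.2.2
      _ < 1 := by rwa [one_mul]
  have hstt : ∀ t : ℝ, st (t • x) = -(t • x) := by
    intro t
    rw [← hstL, map_smul, hstL, hstx, smul_neg]
  have hθt : ∀ t : ℝ, θ (t • x) = t • x := by
    intro t
    rw [← hθL, map_smul, hθL, hθx]
  refine ⟨fun t => (1 + (t : ℝ) • x) * Ring.inverse (1 - (t : ℝ) • x), ?_, ?_, ?_, ?_⟩
  · rw [continuous_iff_continuousAt]
    intro t
    refine ContinuousAt.mul (by fun_prop) ?_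
    obtain ⟨u, hu⟩ := hun t
    have h1 : ContinuousAt (Ring.inverse : A → A) (1 - (t : ℝ) • x) :=
      hu ▸ NormedRing.inverse_continuousAt u
    exact ContinuousAt.comp (f := fun t : unitInterval => 1 - (t : ℝ) • x) h1 (by fun_prop)
  · simp
  · have h1 : w * (1 - x) = 1 + x := by
      have : w * (1 - x) = w + x - (w + 1) * x := by noncomm_ring
      rw [this, hx2]
      abel
    have h2 := hun 1
    simp only [Set.Icc.coe_one, one_smul] at h2 ⊢
    rw [← h1, mul_assoc, Ring.mul_inverse_cancel _ h2, mul_one]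
  · intro t
    set y := (t : ℝ) • x with hy
    set c := (1 + y) * Ring.inverse (1 - y) with hc
    have hu := hun t
    rw [← hy] at hu
    have h1 : c * (1 - y) = 1 + y := by
      rw [hc, mul_assoc, Ring.inverse_mul_cancel _ hu, mul_one]
    have h2 : (1 - y) * c = 1 + y := by
      have hcm : (1 - y) * (1 + y) = (1 + y) * (1 - y) := by noncomm_ring
      rw [hc, ← mul_assoc, hcm, mul_assoc, Ring.mul_inverse_cancel _ hu, mul_one]
    have h3 : (1 + y) * st c = 1 - y := by
      have := congrArg st h1
      rwa [H.st_mul, map_add, map_sub, H.st_one, hstt, sub_neg_eq_add, ← sub_eq_add_neg] at this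
    have h4 : st c * (1 + y) = 1 - y := by
      have := congrArg st h2
      rwa [H.st_mul, map_add, map_sub, H.st_one, hstt, sub_neg_eq_add, ← sub_eq_add_neg] at this
    refine ⟨?_, ?_, ?_⟩
    · apply hu.mul_right_cancel
      rw [mul_assoc, h1, h4, one_mul]
    · apply hu.mul_left_cancel
      rw [← mul_assoc, h2, h3, mul_one]
    · apply hu.mul_right_cancel
      have := congrArg θ h1
      rw [H.th_mul, map_sub, map_add, H.th_one, hθt] at this
      rw [this, h1]

end InvolutionPair

end NormedRings

/-! ### Diagonal hermitian and monomial bilinear forms on a coordinate space -/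

section FiniteLevel

variable {κ : Type*} [Fintype κ]

/-- The diagonal hermitian form with coefficients `s`. -/
def diagForm (s : κ → ℂ) : (κ → ℂ) →ₗ[ℂ] (κ → ℂ) →ₛₗ[starRingEnd ℂ] ℂ :=
  LinearMap.mk₂'ₛₗ (RingHom.id ℂ) (starRingEnd ℂ) (fun x y => ∑ i, s i * x i * conj (y i))
    (by intro x x' y; simp [mul_add, add_mul, Finset.sum_add_distrib])
    (by intro a x y; simp only [Pi.smul_apply, smul_eq_mul, RingHom.id_apply, Finset.mul_sum]
        exact Finset.sum_congr rfl fun i _ => by ring)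
    (by intro x y y'; simp [mul_add, Finset.sum_add_distrib])
    (by intro a x y; simp only [Pi.smul_apply, smul_eq_mul, map_mul, Finset.mul_sum]
        exact Finset.sum_congr rfl fun i _ => by ring)

theorem diagForm_apply (s : κ → ℂ) (x y : κ → ℂ) :
    diagForm s x y = ∑ i, s i * x i * conj (y i) := rfl

/-- The bilinear form that pairs the index `i` with `ι i`, with coefficient `β i`. -/
def monomialForm (ι : κ → κ) (β : κ → ℂ) : (κ → ℂ) →ₗ[ℂ] (κ → ℂ) →ₗ[ℂ] ℂ :=
  LinearMap.mk₂ ℂ (fun x y => ∑ i, β i * x i * y (ι i))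
    (by intro x x' y; simp [mul_add, add_mul, Finset.sum_add_distrib])
    (by intro a x y; simp only [Pi.smul_apply, smul_eq_mul, Finset.mul_sum]
        exact Finset.sum_congr rfl fun i _ => by ring)
    (by intro x y y'; simp [mul_add, Finset.sum_add_distrib])
    (by intro a x y; simp only [Pi.smul_apply, smul_eq_mul, Finset.mul_sum]
        exact Finset.sum_congr rfl fun i _ => by ring)

theorem monomialForm_apply (ι : κ → κ) (β : κ → ℂ) (x y : κ → ℂ) :
    monomialForm ι β x y = ∑ i, β i * x i * y (ι i) := rfl

/-- The antilinear map relating `diagForm` and `monomialForm`. -/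
def monomialTau (s : κ → ℂ) (ι : κ → κ) (β : κ → ℂ) : (κ → ℂ) →ₛₗ[starRingEnd ℂ] (κ → ℂ) where
  toFun y i := s (ι i) * (β (ι i))⁻¹ * conj (y (ι i))
  map_add' := by intro x y; ext i; simp [mul_add]
  map_smul' := by intro a x; ext i; simp; ring

omit [Fintype κ] in
theorem monomialTau_apply (s : κ → ℂ) (ι : κ → κ) (β : κ → ℂ) (y : κ → ℂ) (i : κ) :
    monomialTau s ι β y i = s (ι i) * (β (ι i))⁻¹ * conj (y (ι i)) := rfl

/-- Compatible coefficients for a diagonal hermitian and a monomial bilinear form. -/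
structure MonomialData {κ : Type*} (s : κ → ℂ) (ι : κ → κ) (β : κ → ℂ) (σ η : ℂ) : Prop where
  sq_s : ∀ i, s i = 1 ∨ s i = -1
  inv : ∀ i, ι (ι i) = i
  s_iota : ∀ i, s (ι i) = η * s i
  norm_beta : ∀ i, β i * conj (β i) = 1
  beta_iota : ∀ i, β (ι i) = σ * β i
  sq_sigma : σ = 1 ∨ σ = -1
  sq_eta : η = 1 ∨ η = -1

section Signs

variable {s : κ → ℂ} (hs : ∀ i, s i = 1 ∨ s i = -1)

include hs

omit [Fintype κ] in
theorem sign_mul_self (i : κ) : s i * s i = 1 := by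
  rcases hs i with h | h <;> simp [h]

omit [Fintype κ] in
theorem conj_sign (i : κ) : conj (s i) = s i := by
  rcases hs i with h | h <;> simp [h]

omit [Fintype κ] in
theorem sign_ne_zero (i : κ) : s i ≠ 0 := by
  rcases hs i with h | h <;> simp [h]

theorem diagForm_herm (x y : κ → ℂ) : diagForm s y x = conj (diagForm s x y) := by
  simp only [diagForm_apply, map_sum, map_mul, Complex.conj_conj, conj_sign hs]
  exact Finset.sum_congr rfl fun i _ => by ring

theorem diagForm_nondeg (x : κ → ℂ) (hx : ∀ y, diagForm s x y = 0) : x = 0 := by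
  classical
  ext i
  have := hx (Pi.single i 1)
  simpa [diagForm_apply, Pi.single_apply, sign_ne_zero hs] using this

end Signs

namespace MonomialData

variable {s : κ → ℂ} {ι : κ → κ} {β : κ → ℂ} {σ η : ℂ}

omit [Fintype κ] in
theorem beta_ne (D : MonomialData s ι β σ η) (i : κ) : β i ≠ 0 := by
  intro h0
  have := D.norm_beta i
  simp [h0] at this

omit [Fintype κ] in
theorem conj_beta (D : MonomialData s ι β σ η) (i : κ) : conj (β i) = (β i)⁻¹ :=
  eq_inv_of_mul_eq_one_right (D.norm_beta i)

/-- The involution `ι` as a permutation. -/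
def perm {κ : Type*} {s : κ → ℂ} {ι : κ → κ} {β : κ → ℂ} (D : MonomialData s ι β σ η) : κ ≃ κ :=
  ⟨ι, ι, D.inv, D.inv⟩

theorem sum_iota {κ : Type*} [Fintype κ] {s : κ → ℂ} {ι : κ → κ} {β : κ → ℂ}
    (D : MonomialData s ι β σ η) (f : κ → ℂ) :
    ∑ i, f (ι i) = ∑ i, f i := D.perm.sum_comp f

theorem formTriple (D : MonomialData s ι β σ η) :
    FormTriple (diagForm s) (monomialForm ι β) (monomialTau s ι β) σ η where
  herm := diagForm_herm D.sq_s
  nondeg := diagForm_nondeg D.sq_s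
  h_eq x y := by
    simp only [diagForm_apply, monomialForm_apply, monomialTau_apply, D.inv]
    refine Finset.sum_congr rfl fun i _ => ?_
    have := D.beta_ne i
    field_simp
  b_symm x y := by
    simp only [monomialForm_apply]
    rw [← D.sum_iota, Finset.mul_sum]
    refine Finset.sum_congr rfl fun i _ => ?_
    rw [D.inv, D.beta_iota]
    ring
  h_conj x y := by
    simp only [diagForm_apply, monomialTau_apply]
    rw [← D.sum_iota, map_sum, Finset.mul_sum]
    refine Finset.sum_congr rfl fun i _ => ?_
    simp only [D.inv, map_mul, map_inv₀, Complex.conj_conj, conj_sign D.sq_s, D.s_iota]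
    have := D.norm_beta i
    have h2 := sign_mul_self D.sq_s i
    have h3 : (β i)⁻¹ * (conj (β i))⁻¹ = 1 := by rw [← mul_inv, this, inv_one]
    linear_combination (η * s i * s i * s i * conj (x i) * y i) * h3
      + (η * s i * conj (x i) * y i) * h2
  tau_tau x := by
    ext i
    simp only [monomialTau_apply, Pi.smul_apply, smul_eq_mul, D.inv, map_mul, map_inv₀,
      Complex.conj_conj, conj_sign D.sq_s, D.s_iota, D.beta_iota]
    have := D.norm_beta i
    have h2 := sign_mul_self D.sq_s i
    have h3 : (β i)⁻¹ * (conj (β i))⁻¹ = 1 := by rw [← mul_inv, this, inv_one]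
    have h4 : σ⁻¹ = σ := by rcases D.sq_sigma with h | h <;> simp [h, inv_neg]
    rw [mul_inv, h4]
    linear_combination (η * s i * s i * σ * x i) * h3 + (η * σ * x i) * h2
  sq_sigma := D.sq_sigma
  sq_eta := D.sq_eta

end MonomialData

variable [DecidableEq κ]

/-- The adjoint for the hermitian form `diagForm s`. -/
def stMap {κ : Type*} (s : κ → ℂ) : Matrix κ κ ℂ →+ Matrix κ κ ℂ where
  toFun A := Matrix.of fun i j => s i * conj (A j i) * s j
  map_zero' := by ext; simp
  map_add' A B := by ext; simp; ring

/-- Conjugation by `monomialTau s ι β`. -/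
def thMap {κ : Type*} (s : κ → ℂ) (ι : κ → κ) (β : κ → ℂ) : Matrix κ κ ℂ →+ Matrix κ κ ℂ where
  toFun A := Matrix.of fun i j => (s (ι i) * (β (ι i))⁻¹) * conj (A (ι i) (ι j)) *
    (s (ι j) * β (ι j))
  map_zero' := by ext; simp
  map_add' A B := by ext; simp; ring

theorem stMap_apply {κ : Type*} (s : κ → ℂ) (A : Matrix κ κ ℂ) (i j : κ) :
    stMap s A i j = s i * conj (A j i) * s j := rfl

theorem thMap_apply {κ : Type*} (s : κ → ℂ) (ι : κ → κ) (β : κ → ℂ) (A : Matrix κ κ ℂ) (i j : κ) :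
    thMap s ι β A i j = (s (ι i) * (β (ι i))⁻¹) * conj (A (ι i) (ι j)) *
      (s (ι j) * β (ι j)) := rfl

theorem continuous_stMap {κ : Type*} (s : κ → ℂ) : Continuous (stMap s) := by
  refine continuous_pi fun i => continuous_pi fun j => ?_
  simp only [stMap_apply]
  exact (continuous_const.mul (Complex.continuous_conj.comp
    ((continuous_apply i).comp (continuous_apply j)))).mul continuous_const

theorem continuous_thMap {κ : Type*} (s : κ → ℂ) (ι : κ → κ) (β : κ → ℂ) :
    Continuous (thMap s ι β) := by
  refine continuous_pi fun i => continuous_pi fun j => ?_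
  simp only [thMap_apply]
  exact (continuous_const.mul (Complex.continuous_conj.comp
    ((continuous_apply (ι j)).comp (continuous_apply (ι i))))).mul continuous_const

omit [DecidableEq κ] in
theorem stMap_mul {s : κ → ℂ} (hs : ∀ i, s i = 1 ∨ s i = -1) (A B : Matrix κ κ ℂ) :
    stMap s (A * B) = stMap s B * stMap s A := by
  ext i j
  simp only [stMap_apply, Matrix.mul_apply, map_sum, map_mul, Finset.mul_sum, Finset.sum_mul]
  refine Finset.sum_congr rfl fun k _ => ?_
  linear_combination (-(s i * conj (B k i) * conj (A j k) * s j)) * sign_mul_self hs k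

theorem stMap_stMap {κ : Type*} {s : κ → ℂ} (hs : ∀ i, s i = 1 ∨ s i = -1) (A : Matrix κ κ ℂ) :
    stMap s (stMap s A) = A := by
  ext i j
  simp only [stMap_apply, map_mul, Complex.conj_conj, conj_sign hs]
  linear_combination (A i j * s j * s j) * sign_mul_self hs i + (A i j) * sign_mul_self hs j

-- The trivial choice `θ = id` lets the case without bilinear form use the same polar decomposition.
omit [DecidableEq κ] in
theorem involutionPair_id {s : κ → ℂ} (hs : ∀ i, s i = 1 ∨ s i = -1) [DecidableEq κ] :
    InvolutionPair (stMap s) (AddMonoidHom.id (Matrix κ κ ℂ)) where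
  st_mul := stMap_mul hs
  st_st := stMap_stMap hs
  th_mul _ _ := rfl
  th_th _ := rfl
  comm _ := rfl

/-- Conjugation by `τ` has order two since `τ²` is a scalar, and it commutes with the adjoint since
`τ` respects `h` up to sign and complex conjugation. In coordinates everything is a reindexing by
`ι` and a cancellation of signs. -/
theorem MonomialData.involutionPair {s : κ → ℂ} {ι : κ → κ} {β : κ → ℂ} {σ η : ℂ}
    (D : MonomialData s ι β σ η) : InvolutionPair (stMap s) (thMap s ι β) where
  st_mul := stMap_mul D.sq_s
  st_st := stMap_stMap D.sq_s
  th_mul A B := by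
    ext i j
    simp only [thMap_apply, Matrix.mul_apply, map_sum, map_mul, Finset.mul_sum, Finset.sum_mul]
    rw [← D.sum_iota]
    refine Finset.sum_congr rfl fun k _ => ?_
    have h1 := sign_mul_self D.sq_s (ι k)
    have h2 := inv_mul_cancel₀ (D.beta_ne (ι k))
    linear_combination (-(s (ι i) * (β (ι i))⁻¹ * conj (A (ι i) (ι k)) * conj (B (ι k) (ι j)) *
      (s (ι j) * β (ι j)))) * h2 - (s (ι i) * (β (ι i))⁻¹ * conj (A (ι i) (ι k)) *
      conj (B (ι k) (ι j)) * (s (ι j) * β (ι j)) * (β (ι k))⁻¹ * β (ι k)) * h1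
  th_th A := by
    ext i j
    have h4 : σ⁻¹ = σ := by rcases D.sq_sigma with h | h <;> simp [h, inv_neg]
    have h5 : σ * σ = 1 := by rcases D.sq_sigma with h | h <;> simp [h]
    have h6 : η * η = 1 := by rcases D.sq_eta with h | h <;> simp [h]
    simp only [thMap_apply, map_mul, map_inv₀, Complex.conj_conj, conj_sign D.sq_s, D.inv,
      D.s_iota, D.beta_iota, D.conj_beta, mul_inv, h4, inv_inv]
    have h1 := sign_mul_self D.sq_s i
    have h2 := sign_mul_self D.sq_s j
    have h3 := inv_mul_cancel₀ (D.beta_ne i)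
    have h7 := inv_mul_cancel₀ (D.beta_ne j)
    calc _ = A i j * (η * η) * (σ * σ) * (s i * s i) * (s j * s j) * ((β i)⁻¹ * β i)
          * ((β j)⁻¹ * β j) := by ring
      _ = A i j := by rw [h1, h2, h3, h5, h6, h7]; ring
  comm A := by
    ext i j
    have h6 : η * η = 1 := by rcases D.sq_eta with h | h <;> simp [h]
    simp only [thMap_apply, stMap_apply, map_mul, map_inv₀, Complex.conj_conj, conj_sign D.sq_s,
      D.conj_beta, inv_inv]
    simp only [D.s_iota]
    linear_combination (η * η * s i ^ 2 * s j ^ 2 * (β (ι i))⁻¹ * A (ι j) (ι i) * β (ι j)) * h6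

omit [DecidableEq κ] in
theorem diagForm_mulVec {s : κ → ℂ} (hs : ∀ i, s i = 1 ∨ s i = -1) (A : Matrix κ κ ℂ)
    (x y : κ → ℂ) : diagForm s (A.mulVec x) y = diagForm s x ((stMap s A).mulVec y) := by
  simp only [diagForm_apply, Matrix.mulVec, dotProduct, stMap_apply, map_sum, map_mul,
    Complex.conj_conj, conj_sign hs, Finset.mul_sum, Finset.sum_mul]
  rw [Finset.sum_comm]
  refine Finset.sum_congr rfl fun k _ => Finset.sum_congr rfl fun i _ => ?_
  linear_combination (-(s i * A i k * x k * conj (y i))) * sign_mul_self hs k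

omit [DecidableEq κ] in
theorem MonomialData.thMap_mulVec_tau {s : κ → ℂ} {ι : κ → κ} {β : κ → ℂ} {σ η : ℂ}
    (D : MonomialData s ι β σ η) (A : Matrix κ κ ℂ) (y : κ → ℂ) :
    (thMap s ι β A).mulVec (monomialTau s ι β y) = monomialTau s ι β (A.mulVec y) := by
  ext i
  simp only [Matrix.mulVec, dotProduct, thMap_apply, monomialTau_apply, map_sum, map_mul,
    Finset.mul_sum]
  refine (Finset.sum_congr rfl fun k _ => ?_).trans (D.sum_iota fun k =>
    s (ι i) * (β (ι i))⁻¹ * (conj (A (ι i) k) * conj (y k)))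
  have h1 := sign_mul_self D.sq_s (ι k)
  have h2 := inv_mul_cancel₀ (D.beta_ne (ι k))
  linear_combination (s (ι i) * (β (ι i))⁻¹ * (conj (A (ι i) (ι k)) * conj (y (ι k)))) * h1
    + (s (ι i) * (β (ι i))⁻¹ * (conj (A (ι i) (ι k)) * conj (y (ι k))) * s (ι k) * s (ι k)) * h2

end FiniteLevel

/-! ### Orthogonal projections and chains indexed by dimension -/

section Projections

variable {κ : Type*} [Fintype κ]

/-- `P` is the orthogonal projection onto `F` for the form `diagForm s`. -/
structure IsOrthProj (s : κ → ℂ) (P : Matrix κ κ ℂ) (F : Submodule ℂ (κ → ℂ)) : Prop where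
  mem : ∀ x, P.mulVec x ∈ F
  fix : ∀ x ∈ F, P.mulVec x = x
  orth : ∀ x, ∀ y ∈ F, diagForm s (x - P.mulVec x) y = 0

variable {s : κ → ℂ}

theorem exists_isOrthProj [DecidableEq κ] (F : Submodule ℂ (κ → ℂ))
    (hF : ∀ x ∈ F, (∀ y ∈ F, diagForm s x y = 0) → x = 0) : ∃ P, IsOrthProj s P F := by
  choose f hfF hf using exists_orthogonal_projection (h := diagForm s) F hF
  have huniq : ∀ x n, n ∈ F → (∀ y ∈ F, diagForm s (x - n) y = 0) → f x = n := by
    intro x n hn hxn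
    rw [← sub_eq_zero]
    refine hF _ (F.sub_mem (hfF x) hn) fun y hy => ?_
    have h1 := hf x y hy
    have h2 := hxn y hy
    simp only [map_sub, LinearMap.sub_apply] at h1 h2 ⊢
    linear_combination h2 - h1
  let P : (κ → ℂ) →ₗ[ℂ] (κ → ℂ) :=
    { toFun := f
      map_add' := by
        intro x y
        refine huniq _ _ (F.add_mem (hfF x) (hfF y)) fun z hz => ?_
        have h1 := hf x z hz
        have h2 := hf y z hz
        simp only [map_sub, LinearMap.sub_apply, map_add, LinearMap.add_apply] at h1 h2 ⊢
        linear_combination h1 + h2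
      map_smul' := by
        intro a x
        refine huniq _ _ (F.smul_mem _ (hfF x)) fun z hz => ?_
        have h1 := hf x z hz
        simp only [map_sub, LinearMap.sub_apply, map_smul, LinearMap.smul_apply, smul_eq_mul,
          RingHom.id_apply] at h1 ⊢
        linear_combination a * h1 }
  refine ⟨LinearMap.toMatrix' P, ?_, ?_, ?_⟩
  · intro x
    rw [← Matrix.toLin'_apply, Matrix.toLin'_toMatrix']
    exact hfF x
  · intro x hx
    rw [← Matrix.toLin'_apply, Matrix.toLin'_toMatrix']
    exact huniq x x hx (by simp)
  · intro x
    rw [← Matrix.toLin'_apply, Matrix.toLin'_toMatrix']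
    exact hf x

theorem matrix_ext_mulVec [DecidableEq κ] {A B : Matrix κ κ ℂ}
    (h : ∀ x, A.mulVec x = B.mulVec x) : A = B :=
  Matrix.toLin'.injective (LinearMap.ext fun x => by simpa using h x)

namespace IsOrthProj

variable (hs : ∀ i, s i = 1 ∨ s i = -1) {P Q : Matrix κ κ ℂ} {F G : Submodule ℂ (κ → ℂ)}

theorem mul_of_le [DecidableEq κ] (hP : IsOrthProj s P F) (hQ : IsOrthProj s Q G) (h : F ≤ G) :
    Q * P = P :=
  matrix_ext_mulVec fun x => by
    rw [← Matrix.mulVec_mulVec]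
    exact hQ.fix _ (h (hP.mem x))

include hs

theorem stMap_eq [DecidableEq κ] (hP : IsOrthProj s P F) : stMap s P = P := by
  refine matrix_ext_mulVec fun y => ?_
  rw [← sub_eq_zero]
  refine diagForm_nondeg hs _ fun x => ?_
  rw [diagForm_herm hs x]
  have h1 : diagForm s x ((stMap s P).mulVec y) = diagForm s (P.mulVec x) y :=
    (diagForm_mulVec hs P x y).symm
  have h2 := hP.orth x _ (hP.mem y)
  have h3 : diagForm s (P.mulVec x) (y - P.mulVec y) = 0 := by
    rw [diagForm_herm hs (y - P.mulVec y), hP.orth y _ (hP.mem x), map_zero]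
  simp only [map_sub, LinearMap.sub_apply] at h2 h3 ⊢
  rw [h1]
  have : diagForm s (P.mulVec x) y - diagForm s x (P.mulVec y) = 0 := by
    linear_combination h3 - h2
  rw [← map_sub, this, map_zero]

theorem mul_of_ge [DecidableEq κ] (hP : IsOrthProj s P F) (hQ : IsOrthProj s Q G) (h : F ≤ G) :
    P * Q = P := by
  have := congrArg (stMap s) (hP.mul_of_le hQ h)
  rwa [stMap_mul hs, hP.stMap_eq hs, hQ.stMap_eq hs] at this

theorem unique [DecidableEq κ] (hP : IsOrthProj s P F) (hQ : IsOrthProj s Q F) : P = Q := by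
  rw [← hP.mul_of_ge hs hQ le_rfl, hQ.mul_of_le hP le_rfl]

/-- The projection onto the image of `F` under an invertible matrix `u` near the identity. -/
theorem map [DecidableEq κ] (hP : IsOrthProj s P F) {u u' a' : Matrix κ κ ℂ} (hu : u' * u = 1)
    (ha : (u * P + stMap s u' * (1 - P)) * a' = 1) :
    IsOrthProj s ((u * P + stMap s u' * (1 - P)) * P * a') (F.map (Matrix.toLin' u)) := by
  -- `u` maps `F` to its image, and the adjoint of the inverse maps the orthogonal complement of `F`
  -- into that of the image. So `a` carries the orthogonal decomposition of `F` to that of its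
  -- image, and conjugating `P` by `a` gives the new projection.
  set a := u * P + stMap s u' * (1 - P) with hadef
  have ha' : a' * a = 1 := mul_eq_one_comm.1 ha
  have hPP : P * P = P := hP.mul_of_le hP le_rfl
  have haP : a * P = u * P := by
    rw [hadef, add_mul, mul_assoc, hPP, mul_assoc (stMap s u'), sub_mul, hPP, one_mul, sub_self,
      mul_zero, add_zero]
  have haP' : a * (1 - P) = stMap s u' * (1 - P) := by
    have : a * (1 - P) = a - a * P := by rw [mul_sub, mul_one]
    rw [this, haP, hadef]
    abel
  refine ⟨?_, ?_, ?_⟩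
  · intro x
    rw [haP, ← Matrix.mulVec_mulVec, ← Matrix.mulVec_mulVec]
    exact ⟨_, hP.mem (a'.mulVec x), Matrix.toLin'_apply _ _⟩
  · rintro _ ⟨f, hf, rfl⟩
    have h1 : Matrix.toLin' u f = a.mulVec f := by
      rw [Matrix.toLin'_apply]
      nth_rw 1 [← hP.fix f hf]
      rw [Matrix.mulVec_mulVec, ← haP, ← Matrix.mulVec_mulVec, hP.fix f hf]
    rw [h1, Matrix.mulVec_mulVec, mul_assoc, ha', mul_one, ← Matrix.mulVec_mulVec, hP.fix f hf]
  · rintro x _ ⟨f, hf, rfl⟩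
    have h1 : x - (a * P * a').mulVec x = (stMap s u').mulVec ((1 - P).mulVec (a'.mulVec x)) := by
      rw [Matrix.mulVec_mulVec, Matrix.mulVec_mulVec, ← haP', mul_sub, mul_one, sub_mul,
        ha, Matrix.sub_mulVec, Matrix.one_mulVec]
    have h2 : u'.mulVec (u.mulVec f) = f := by rw [Matrix.mulVec_mulVec, hu, Matrix.one_mulVec]
    rw [h1, diagForm_mulVec hs, stMap_stMap hs, Matrix.toLin'_apply, h2, Matrix.sub_mulVec,
      Matrix.one_mulVec]
    exact hP.orth _ f hf

end IsOrthProj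

/-- The subspace orthogonal to `F` for the bilinear form `b`. -/
def perp {V : Type*} [AddCommGroup V] [Module ℂ V] (b : V →ₗ[ℂ] V →ₗ[ℂ] ℂ) (F : Submodule ℂ V) :
    Submodule ℂ V where
  carrier := {x | ∀ y ∈ F, b x y = 0}
  zero_mem' := by simp
  add_mem' := by
    intro x x' hx hx' y hy
    simp [hx y hy, hx' y hy]
  smul_mem' := by
    intro a x hx y hy
    simp [hx y hy]

theorem mem_perp {V : Type*} [AddCommGroup V] [Module ℂ V] {b : V →ₗ[ℂ] V →ₗ[ℂ] ℂ}
    {F : Submodule ℂ V} {x : V} : x ∈ perp b F ↔ ∀ y ∈ F, b x y = 0 := Iff.rfl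

/-- By `h x y = b x (τ y)`, the map `τ` carries the `h`-orthogonal complement of `F` onto the
`b`-orthogonal space of `F`. Hence conjugation by `τ` takes `1 - P` to the projection onto the
latter. -/
theorem IsOrthProj.thMap_eq [DecidableEq κ] {ι : κ → κ} {β : κ → ℂ} {σ η : ℂ}
    (D : MonomialData s ι β σ η) {P P' : Matrix κ κ ℂ} {F : Submodule ℂ (κ → ℂ)}
    (hP : IsOrthProj s P F) (hP' : IsOrthProj s P' (perp (monomialForm ι β) F)) :
    thMap s ι β P = 1 - P' := by
  have H := D.formTriple
  have hsurj : ∀ x, ∃ y, x = monomialTau s ι β y := by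
    intro x
    refine ⟨(η * σ) • monomialTau s ι β x, ?_⟩
    rw [map_smulₛₗ, H.sign_conj, H.tau_tau, smul_smul, H.sign_sq, one_smul]
  have key : IsOrthProj s (1 - thMap s ι β P) (perp (monomialForm ι β) F) := by
    have h0 : ∀ y, (1 - thMap s ι β P).mulVec (monomialTau s ι β y) =
        monomialTau s ι β (y - P.mulVec y) := by
      intro y
      rw [Matrix.sub_mulVec, Matrix.one_mulVec, D.thMap_mulVec_tau, map_sub]
    refine ⟨?_, ?_, ?_⟩
    · intro x f hf
      obtain ⟨y, rfl⟩ := hsurj x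
      rw [h0, H.b_eq_zero_comm, ← H.h_eq, H.h_eq_zero_comm]
      exact hP.orth y f hf
    · intro x hx
      obtain ⟨y, rfl⟩ := hsurj x
      rw [h0]
      have h1 : P.mulVec y = 0 := by
        refine H.nondeg _ fun z => ?_
        have h2 := hP.stMap_eq D.sq_s
        rw [diagForm_mulVec D.sq_s, h2, H.h_eq_zero_comm, H.h_eq, H.b_eq_zero_comm]
        exact hx _ (hP.mem z)
      rw [h1, sub_zero]
    · intro x z hz
      obtain ⟨y, rfl⟩ := hsurj x
      rw [h0, ← map_sub, sub_sub_cancel, H.tau_h, hz _ (hP.mem y)]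
      simp
  rw [← key.unique D.sq_s hP']
  abel

/-- The largest member of a chain of subspaces among those of dimension at most `j`. -/
def level {W : Type*} [AddCommGroup W] [Module ℂ W] (C : Set (Submodule ℂ W)) (j : ℕ) :
    Submodule ℂ W :=
  sSup {G ∈ C | Module.finrank ℂ G ≤ j}

theorem level_mono {W : Type*} [AddCommGroup W] [Module ℂ W] (C : Set (Submodule ℂ W)) :
    Monotone (level C) := fun _ _ hij => sSup_le_sSup fun _ hG => ⟨hG.1, hG.2.trans hij⟩

/-- In a chain, a member whose dimension does not exceed that of `G` lies in `G`. Dimension thus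
turns a chain into an increasing sequence over `ℕ`, as `transporter` requires. -/
theorem level_finrank {W : Type*} [AddCommGroup W] [Module ℂ W] [FiniteDimensional ℂ W]
    {C : Set (Submodule ℂ W)} (hC : IsChain (· ≤ ·) C) {G : Submodule ℂ W} (hG : G ∈ C) :
    level C (Module.finrank ℂ G) = G := by
  refine le_antisymm (sSup_le ?_) (le_sSup ⟨hG, le_rfl⟩)
  rintro G' ⟨hG', hle⟩
  rcases hC.total hG hG' with h | h
  · exact (Submodule.eq_of_le_of_finrank_le h hle).ge
  · exact h

theorem level_mem {W : Type*} [AddCommGroup W] [Module ℂ W]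
    [FiniteDimensional ℂ W] {C : Set (Submodule ℂ W)} (hC : IsChain (· ≤ ·) C) (j : ℕ) :
    level C j ∈ C ∨ level C j = ⊥ := by
  rcases Set.eq_empty_or_nonempty {G ∈ C | Module.finrank ℂ G ≤ j} with h | h
  · right
    rw [level, h, sSup_empty]
  · left
    obtain ⟨G, hG, hmax⟩ := exists_maximal_of_wellFoundedGT _ h
    have : level C j = G := by
      refine le_antisymm (sSup_le fun G' hG' => ?_) (le_sSup hG)
      rcases hC.total hG.1 hG'.1 with h | h
      · exact hmax hG' h
      · exact h
    rw [this]
    exact hG.1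

end Projections

/-! ### Replacing small transformations of a nondegenerate chain by unitary ones -/

section Transport

open scoped Matrix.Norms.L2Operator

variable {κ : Type*} [Fintype κ] [DecidableEq κ] {s : κ → ℂ}

theorem isChain_orthProj_mul (hs : ∀ i, s i = 1 ∨ s i = -1) {F : ℕ → Submodule ℂ (κ → ℂ)}
    (hF : Monotone F) {p : ℕ → Matrix κ κ ℂ} (hp : ∀ i, IsOrthProj s (p i) (F i)) (i j : ℕ)
    (hij : i ≤ j) : p i * p j = p i ∧ p j * p i = p i :=
  ⟨(hp i).mul_of_ge hs (hp j) (hF hij), (hp i).mul_of_le (hp j) (hF hij)⟩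

/-- A chain of nondegenerate subspaces is moved by transformations `u` near the identity in the same way as
by unitary transformations near the identity; the latter can be chosen `θ`-invariant if
`θ` preserves the intertwiners between the projections. -/
theorem eventually_exists_unitary_map (hs : ∀ i, s i = 1 ∨ s i = -1)
    {θ : Matrix κ κ ℂ →+ Matrix κ κ ℂ} (H : InvolutionPair (stMap s) θ) (hθ : Continuous θ)
    {C : Set (Submodule ℂ (κ → ℂ))} (hC : IsChain (· ≤ ·) C)
    (hnd : ∀ F ∈ C, ∀ x ∈ F, (∀ y ∈ F, diagForm s x y = 0) → x = 0)
    {good : Matrix κ κ ℂ → Prop}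
    (hgood : ∀ u : Matrix κ κ ℂ, IsUnit u → good u → ∀ P Q : Submodule ℂ (κ → ℂ) → Matrix κ κ ℂ,
      (∀ F ∈ C, IsOrthProj s (P F) F ∧ IsOrthProj s (Q F) (F.map (Matrix.toLin' u))) →
      ∀ T : Matrix κ κ ℂ, (∀ F ∈ C, T * P F = Q F * T) → ∀ F ∈ C, θ T * P F = Q F * θ T)
    {O : Set (Matrix κ κ ℂ)} (hO : O ∈ 𝓝 1) :
    ∀ᶠ u in 𝓝 (1 : Matrix κ κ ℂ), good u → ∃ w ∈ O, stMap s w * w = 1 ∧ θ w = w ∧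
      ∀ F ∈ C, F.map (Matrix.toLin' w) = F.map (Matrix.toLin' u) := by
  classical
  -- The default value `0` is never used: projections exist for the members of `C` and for all
  -- `level C j`, which may also be `⊥`.
  let P : Submodule ℂ (κ → ℂ) → Matrix κ κ ℂ := fun F =>
    if h : ∃ P, IsOrthProj s P F then h.choose else 0
  have hPspec : ∀ F, (∃ P, IsOrthProj s P F) → IsOrthProj s (P F) F := by
    intro F h
    simp only [P, dif_pos h]
    exact h.choose_spec
  have hP : ∀ F ∈ C, IsOrthProj s (P F) F := fun F hF =>
    hPspec F (exists_isOrthProj F (hnd F hF))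
  have hPlev : ∀ j, IsOrthProj s (P (level C j)) (level C j) := by
    intro j
    rcases level_mem hC j with h | h
    · exact hP _ h
    · refine hPspec _ (exists_isOrthProj _ ?_)
      rw [h]
      intro x hx _
      simpa using hx
  -- The explicit formula of `IsOrthProj.map` makes the projection `Q u F` onto the translate tend
  -- to `P F` as `u` tends to `1`.
  let a : Matrix κ κ ℂ → Submodule ℂ (κ → ℂ) → Matrix κ κ ℂ := fun u F =>
    u * P F + stMap s (Ring.inverse u) * (1 - P F)
  let Q : Matrix κ κ ℂ → Submodule ℂ (κ → ℂ) → Matrix κ κ ℂ := fun u F =>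
    a u F * P F * Ring.inverse (a u F)
  have hst : Continuous (stMap s) := continuous_stMap s
  have hinv : Tendsto (Ring.inverse : Matrix κ κ ℂ → Matrix κ κ ℂ) (𝓝 1) (𝓝 1) := by
    have h1 : ContinuousAt (Ring.inverse : Matrix κ κ ℂ → Matrix κ κ ℂ) 1 :=
      NormedRing.inverse_continuousAt 1
    have := h1.tendsto
    rwa [Ring.inverse_one] at this
  have ha : ∀ F, Tendsto (fun u => a u F) (𝓝 1) (𝓝 1) := by
    intro F
    have h1 : Tendsto (fun u => stMap s (Ring.inverse u)) (𝓝 1) (𝓝 1) := by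
      have := (hst.tendsto 1).comp hinv
      rwa [H.st_one] at this
    have h2 := ((tendsto_id (x := 𝓝 (1 : Matrix κ κ ℂ))).mul_const (P F)).add
      (h1.mul_const (1 - P F))
    have h3 : (1 : Matrix κ κ ℂ) * P F + 1 * (1 - P F) = 1 := by
      rw [one_mul, one_mul]
      abel
    rw [h3] at h2
    exact h2
  have hQ : ∀ F, Tendsto (fun u => Q u F) (𝓝 1) (𝓝 (P F)) := by
    intro F
    have h2 := ((ha F).mul_const (P F)).mul (hinv.comp (ha F))
    rw [one_mul, mul_one] at h2
    exact h2
  have hunits : {x : Matrix κ κ ℂ | IsUnit x} ∈ 𝓝 (1 : Matrix κ κ ℂ) :=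
    Units.isOpen.mem_nhds isUnit_one
  have hQproj : ∀ F, IsOrthProj s (P F) F → ∀ u, IsUnit u → IsUnit (a u F) →
      IsOrthProj s (Q u F) (F.map (Matrix.toLin' u)) := fun F hF u hu hau =>
    hF.map hs (Ring.inverse_mul_cancel _ hu) (Ring.mul_inverse_cancel _ hau)
  set n := Module.finrank ℂ (κ → ℂ) + 1 with hn
  have hev : ∀ᶠ u in 𝓝 (1 : Matrix κ κ ℂ), IsUnit u ∧ ∀ j ∈ Finset.range n,
      IsUnit (a u (level C j)) := by
    refine (eventually_mem_set.2 hunits).and ?_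
    rw [Filter.eventually_all_finset]
    exact fun j _ => (ha _).eventually hunits
  have hfin : ∀ F : Submodule ℂ (κ → ℂ), Module.finrank ℂ F ∈ Finset.range n := fun F => by
    rw [Finset.mem_range, hn, Nat.lt_succ_iff]
    exact Submodule.finrank_le F
  -- Truncation at the total dimension keeps the sequences monotone over all of `ℕ`, while only
  -- finitely many `a u (level C j)` must be invertible. The length `n` exceeds the dimension by one
  -- because `transporter` handles the indices below `n`.
  let cut : ℕ → ℕ := fun j => min j (Module.finrank ℂ (κ → ℂ))
  have hcut : ∀ j, cut j ∈ Finset.range n := fun j => by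
    rw [Finset.mem_range, hn, Nat.lt_succ_iff]
    exact min_le_right _ _
  have hcutm : Monotone cut := fun i j hij => min_le_min_right _ hij
  let T : Matrix κ κ ℂ → Matrix κ κ ℂ := fun u =>
    transporter (fun j => P (level C (cut j))) (fun j => Q u (level C (cut j))) n
  have hT : Tendsto T (𝓝 1) (𝓝 1) :=
    tendsto_transporter (fun j => (hPlev _).mul_of_le (hPlev _) le_rfl) (fun j => hQ _) n
  have hTP : ∀ u, (IsUnit u ∧ ∀ j ∈ Finset.range n, IsUnit (a u (level C j))) →
      ∀ F ∈ C, T u * P F = Q u F * T u := by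
    rintro u ⟨hu, hau⟩ F hF
    have hmp : Monotone fun j => level C (cut j) := (level_mono C).comp hcutm
    have h1 := transporter_mul
      (isChain_orthProj_mul hs hmp fun j => hPlev (cut j))
      (isChain_orthProj_mul hs (F := fun j => (level C (cut j)).map (Matrix.toLin' u))
        (fun i j hij => Submodule.map_mono (hmp hij))
        fun j => hQproj _ (hPlev _) u hu (hau _ (hcut j)))
      n (Module.finrank ℂ F) (Finset.mem_range.1 (hfin F))
    have h2 : level C (cut (Module.finrank ℂ F)) = F := by
      have : cut (Module.finrank ℂ F) = Module.finrank ℂ F := min_eq_left (Submodule.finrank_le F)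
      rw [this, level_finrank hC hF]
    rw [h2] at h1
    exact h1
  have hQC : ∀ u, (IsUnit u ∧ ∀ j ∈ Finset.range n, IsUnit (a u (level C j))) →
      ∀ F ∈ C, IsOrthProj s (Q u F) (F.map (Matrix.toLin' u)) := by
    rintro u ⟨hu, hau⟩ F hF
    have := hau _ (hfin F)
    rw [level_finrank hC hF] at this
    exact hQproj F (hP F hF) u hu this
  have main := H.eventually_exists_unitary hst hθ hT (good := good) (P := fun F : C => P F)
    (Q := fun u (F : C) => Q u F) (hev.mono fun u hu _ F => hTP u hu F F.2)
    (hev.mono fun u hu hg F => hgood u hu.1 hg P (Q u)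
      (fun F hF => ⟨hP F hF, hQC u hu F hF⟩) (T u) (hTP u hu) F F.2)
    (fun F => (hP F F.2).stMap_eq hs) (hev.mono fun u hu _ F => (hQC u hu F F.2).stMap_eq hs) hO
  filter_upwards [main, hev] with u hmain hu hg
  obtain ⟨w, hwO, hw1, hw2, hw3⟩ := hmain hg
  refine ⟨w, hwO, hw1, hw2, fun F hF => ?_⟩
  have hw1' : w * stMap s w = 1 := mul_eq_one_comm.1 hw1
  have hwF := hw3 ⟨F, hF⟩
  simp only at hwF
  have hPF := hP F hF
  have hQF := hQC u hu F hF
  apply le_antisymm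
  · rintro _ ⟨f, hf, rfl⟩
    have : Matrix.toLin' w f = (Q u F).mulVec (w.mulVec f) := by
      rw [Matrix.toLin'_apply, Matrix.mulVec_mulVec, ← hwF, ← Matrix.mulVec_mulVec, hPF.fix f hf]
    rw [this]
    exact hQF.mem _
  · intro x hx
    refine ⟨(P F).mulVec ((stMap s w).mulVec x), hPF.mem _, ?_⟩
    rw [Matrix.toLin'_apply, Matrix.mulVec_mulVec, Matrix.mulVec_mulVec, hwF, mul_assoc, hw1',
      mul_one]
    exact hQF.fix x hx

theorem eventually_exists_unitary_map_of_no_bilin (hs : ∀ i, s i = 1 ∨ s i = -1)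
    {C : Set (Submodule ℂ (κ → ℂ))} (hC : IsChain (· ≤ ·) C)
    (hnd : ∀ F ∈ C, ∀ x ∈ F, (∀ y ∈ F, diagForm s x y = 0) → x = 0)
    {O : Set (Matrix κ κ ℂ)} (hO : O ∈ 𝓝 1) :
    ∀ᶠ u in 𝓝 (1 : Matrix κ κ ℂ), ∃ w ∈ O, stMap s w * w = 1 ∧
      ∀ F ∈ C, F.map (Matrix.toLin' w) = F.map (Matrix.toLin' u) := by
  filter_upwards [eventually_exists_unitary_map hs (involutionPair_id hs) continuous_id hC hnd
    (good := fun _ => True) (fun _ _ _ P Q _ T hT => hT) hO] with u hu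
  obtain ⟨w, h1, h2, -, h3⟩ := hu trivial
  exact ⟨w, h1, h2, h3⟩

namespace MonomialData

variable {ι : κ → κ} {β : κ → ℂ} {σ η : ℂ} (D : MonomialData s ι β σ η)

include D

omit D in
theorem perp_map {ι : κ → κ} {β : κ → ℂ} {u : Matrix κ κ ℂ} (hu : IsUnit u)
    (hub : ∀ x y, monomialForm ι β (u.mulVec x) (u.mulVec y) = monomialForm ι β x y)
    (F : Submodule ℂ (κ → ℂ)) :
    perp (monomialForm ι β) (F.map (Matrix.toLin' u)) =
      (perp (monomialForm ι β) F).map (Matrix.toLin' u) := by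
  ext x
  constructor
  · intro hx
    refine ⟨(Ring.inverse u).mulVec x, fun y hy => ?_, ?_⟩
    · rw [← hub, Matrix.mulVec_mulVec, Ring.mul_inverse_cancel _ hu, Matrix.one_mulVec]
      exact hx _ ⟨y, hy, by simp⟩
    · rw [Matrix.toLin'_apply, Matrix.mulVec_mulVec, Ring.mul_inverse_cancel _ hu,
        Matrix.one_mulVec]
  · rintro ⟨y, hy, rfl⟩ _ ⟨z, hz, rfl⟩
    rw [Matrix.toLin'_apply, Matrix.toLin'_apply, hub]
    exact hy z hz

/-- `θ` exchanges the projection of `perp F` with one minus the projection of `F`, for the chain and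
for its translate by a `u` that preserves `b`. As `C` is closed under `perp`, applying `θ` to the
intertwining relation for `perp F` shows that `θ T` intertwines the projections for `F`. -/
theorem eventually_exists_unitary_map
    {C : Set (Submodule ℂ (κ → ℂ))} (hC : IsChain (· ≤ ·) C)
    (hnd : ∀ F ∈ C, ∀ x ∈ F, (∀ y ∈ F, diagForm s x y = 0) → x = 0)
    (hperp : ∀ F ∈ C, perp (monomialForm ι β) F ∈ C)
    {O : Set (Matrix κ κ ℂ)} (hO : O ∈ 𝓝 1) :
    ∀ᶠ u in 𝓝 (1 : Matrix κ κ ℂ),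
      (∀ x y, monomialForm ι β (u.mulVec x) (u.mulVec y) = monomialForm ι β x y) →
      ∃ w ∈ O, stMap s w * w = 1 ∧ thMap s ι β w = w ∧
      ∀ F ∈ C, F.map (Matrix.toLin' w) = F.map (Matrix.toLin' u) := by
  refine OpenOrbits.eventually_exists_unitary_map D.sq_s D.involutionPair (continuous_thMap s ι β)
    hC hnd ?_ hO
  intro u hu hub P Q hPQ T hT F hF
  have hF' := hperp F hF
  have e1 : thMap s ι β (P (perp (monomialForm ι β) F)) = 1 - P F := by
    have := congrArg (thMap s ι β) ((hPQ F hF).1.thMap_eq D (hPQ _ hF').1)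
    rw [D.involutionPair.th_th, map_sub, D.involutionPair.th_one] at this
    rw [this]
    abel
  have e2 : thMap s ι β (Q (perp (monomialForm ι β) F)) = 1 - Q F := by
    have h1 := (hPQ _ hF').2
    rw [← perp_map hu hub] at h1
    have := congrArg (thMap s ι β) ((hPQ F hF).2.thMap_eq D h1)
    rw [D.involutionPair.th_th, map_sub, D.involutionPair.th_one] at this
    rw [this]
    abel
  have h3 := congrArg (thMap s ι β) (hT _ hF')
  rw [D.involutionPair.th_mul, D.involutionPair.th_mul, e1, e2, mul_sub, mul_one, sub_mul,
    one_mul] at h3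
  exact sub_right_injective h3

/-- Unitary `θ`-invariant matrices preserve the bilinear form. -/
theorem preserves_bilin {w : Matrix κ κ ℂ} (hw : stMap s w * w = 1) (hθ : thMap s ι β w = w)
    (x y : κ → ℂ) : monomialForm ι β (w.mulVec x) (w.mulVec y) = monomialForm ι β x y := by
  have H := D.formTriple
  have h1 : y = monomialTau s ι β ((η * σ) • monomialTau s ι β y) := by
    rw [map_smulₛₗ, H.sign_conj, H.tau_tau, smul_smul, H.sign_sq, one_smul]
  rw [h1]
  nth_rw 2 [← hθ]
  rw [D.thMap_mulVec_tau, ← H.h_eq, ← H.h_eq, diagForm_mulVec D.sq_s, Matrix.mulVec_mulVec, hw,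
    Matrix.one_mulVec]

theorem eventually_exists_path : ∀ᶠ w in 𝓝 (1 : Matrix κ κ ℂ), stMap s w * w = 1 →
    thMap s ι β w = w → ∃ c : unitInterval → Matrix κ κ ℂ, Continuous c ∧ c 0 = 1 ∧ c 1 = w ∧
      ∀ t, stMap s (c t) * c t = 1 ∧ thMap s ι β (c t) = c t := by
  filter_upwards [D.involutionPair.eventually_exists_path (continuous_stMap s)
    (continuous_thMap s ι β)] with w hw h1 h2
  obtain ⟨c, hc, hc0, hc1, hc2⟩ := hw h1 h2
  exact ⟨c, hc, hc0, hc1, fun t => ⟨(hc2 t).1, (hc2 t).2.2⟩⟩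

end MonomialData

end Transport

/-! ### Lowering the dimension of the radical by small transformations -/

theorem exists_compl_radical {W : Type*} [AddCommGroup W] [Module ℂ W]
    (h : W →ₗ[ℂ] W →ₛₗ[starRingEnd ℂ] ℂ) (F : Submodule ℂ W) :
    ∃ N, N ⊓ radical h F = ⊥ ∧ N ⊔ radical h F = F := by
  obtain ⟨N', h1, h2⟩ := Submodule.exists_isCompl (radical h F)
  refine ⟨F ⊓ N', ?_, ?_⟩
  · rw [inf_assoc, inf_comm N', h1.eq_bot, inf_bot_eq]
  · have hle : radical h F ≤ F := fun x hx => hx.1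
    rw [sup_comm, inf_comm, ← sup_inf_assoc_of_le _ hle, h2.eq_top, top_inf_eq]

theorem nondeg_of_compl_radical {W : Type*} [AddCommGroup W] [Module ℂ W]
    {h : W →ₗ[ℂ] W →ₛₗ[starRingEnd ℂ] ℂ} (hherm : ∀ x y, h y x = conj (h x y))
    {F N : Submodule ℂ W} (hinf : N ⊓ radical h F = ⊥) (hsup : N ⊔ radical h F = F) :
    ∀ x ∈ N, (∀ y ∈ N, h x y = 0) → x = 0 := by
  intro x hx hxN
  have hxF : x ∈ F := hsup ▸ Submodule.mem_sup_left hx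
  have : x ∈ N ⊓ radical h F := by
    refine ⟨hx, hxF, fun y hy => ?_⟩
    rw [← hsup] at hy
    obtain ⟨n, hn, z, hz, rfl⟩ := Submodule.mem_sup.1 hy
    rw [map_add, hxN n hn, hherm, hz.2 x hxF]
    simp
  rwa [hinf, Submodule.mem_bot] at this

section FiniteLevel

variable {κ : Type*} [Fintype κ] [DecidableEq κ] {s : κ → ℂ}

theorem exists_matrix_of_hasDeformation (hs : ∀ i, s i = 1 ∨ s i = -1)
    {b : (κ → ℂ) →ₗ[ℂ] (κ → ℂ) →ₗ[ℂ] ℂ} {F N : Submodule ℂ (κ → ℂ)}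
    (hinf : N ⊓ radical (diagForm s) F = ⊥) (hsup : N ⊔ radical (diagForm s) F = F)
    {r : κ → ℂ} (hr : r ∈ radical (diagForm s) F) (hdef : HasDeformation (diagForm s) b N r)
    {O : Set (Matrix κ κ ℂ)} (hO : O ∈ 𝓝 1) :
    ∃ u ∈ O, IsUnit u ∧ (∀ x y, b (u.mulVec x) (u.mulVec y) = b x y) ∧
      Module.finrank ℂ (radical (diagForm s) (F.map (Matrix.toLin' u))) <
        Module.finrank ℂ (radical (diagForm s) F) := by
  obtain ⟨a₁, a₂, hinj, hb, hN, hrN, hsmall⟩ := hdef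
  have hcont : Tendsto (fun t : ℂ => LinearMap.toMatrix' (quadFamily a₁ a₂ t)) (𝓝 0) (𝓝 1) := by
    have h1 : (fun t : ℂ => LinearMap.toMatrix' (quadFamily a₁ a₂ t)) =
        fun t => 1 + t • LinearMap.toMatrix' a₁ + t ^ 2 • LinearMap.toMatrix' a₂ := by
      funext t
      simp only [quadFamily, map_add, map_smul]
      congr 2
      exact LinearMap.toMatrix'_one
    rw [h1]
    have h2 : Continuous fun t : ℂ => (1 : Matrix κ κ ℂ) + t • LinearMap.toMatrix' a₁
        + t ^ 2 • LinearMap.toMatrix' a₂ := by fun_prop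
    have h3 := h2.tendsto 0
    simpa using h3
  obtain ⟨δ, hδ, hball⟩ := Metric.mem_nhds_iff.1 (hcont hO)
  obtain ⟨t, ht, hne⟩ := hsmall δ hδ
  have hmul : ∀ x, (LinearMap.toMatrix' (quadFamily a₁ a₂ t)).mulVec x = quadFamily a₁ a₂ t x := by
    intro x
    rw [← Matrix.toLin'_apply, Matrix.toLin'_toMatrix']
  refine ⟨LinearMap.toMatrix' (quadFamily a₁ a₂ t), hball (by simpa using ht), ?_, ?_, ?_⟩
  · rw [← Matrix.mulVec_injective_iff_isUnit]
    intro x y hxy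
    exact hinj t (by simpa only [hmul] using hxy)
  · intro x y
    rw [hmul, hmul, hb]
  · rw [Matrix.toLin'_toMatrix']
    exact finrank_radical_map_lt (diagForm_herm hs) F N hinf hsup r hr _ (hinj t) (hN t) (hrN t) hne

omit [DecidableEq κ] in
theorem exists_ne_zero_radical {F : Submodule ℂ (κ → ℂ)}
    (hF : ¬ ∀ x ∈ F, (∀ y ∈ F, diagForm s x y = 0) → x = 0) :
    ∃ r ∈ radical (diagForm s) F, r ≠ 0 := by
  push Not at hF
  obtain ⟨x, hx, hx', hx0⟩ := hF
  exact ⟨x, ⟨hx, hx'⟩, hx0⟩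

/-- Arbitrarily near the identity there are transformations that move a degenerate subspace to a less
degenerate one. -/
theorem exists_finrank_radical_lt_of_no_bilin (hs : ∀ i, s i = 1 ∨ s i = -1)
    {F : Submodule ℂ (κ → ℂ)}
    (hF : ¬ ∀ x ∈ F, (∀ y ∈ F, diagForm s x y = 0) → x = 0)
    {O : Set (Matrix κ κ ℂ)} (hO : O ∈ 𝓝 1) :
    ∃ u ∈ O, IsUnit u ∧ Module.finrank ℂ (radical (diagForm s) (F.map (Matrix.toLin' u))) <
        Module.finrank ℂ (radical (diagForm s) F) := by
  obtain ⟨r, hr, hr0⟩ := exists_ne_zero_radical hF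
  obtain ⟨N, hinf, hsup⟩ := exists_compl_radical (diagForm s) F
  have hNF : N ≤ F := hsup ▸ le_sup_left
  obtain ⟨u, h1, h2, -, h3⟩ := exists_matrix_of_hasDeformation hs (b := 0) hinf hsup hr
    (hasDeformation_of_bilin_eq_zero (diagForm_herm hs) (diagForm_nondeg hs) (by simp) N
      (nondeg_of_compl_radical (diagForm_herm hs) hinf hsup) r hr0 (fun n hn => hr.2 n (hNF hn))
      (hr.2 r hr.1)) hO
  exact ⟨u, h1, h2, h3⟩

namespace MonomialData

variable {ι : κ → κ} {β : κ → ℂ} {σ η : ℂ} (D : MonomialData s ι β σ η)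

include D

omit [DecidableEq κ] in
theorem tau_mem_biorthogonal {N : Submodule ℂ (κ → ℂ)} {r : κ → ℂ}
    (hr : r ∈ D.formTriple.biorthogonal N) :
    monomialTau s ι β r ∈ D.formTriple.biorthogonal N := by
  have H := D.formTriple
  intro n hn
  constructor
  · rw [H.tau_h, H.b_eq_zero_comm.1 (hr n hn).2]
    simp
  · rw [H.b_eq_zero_comm, ← H.h_eq]
    exact H.h_eq_zero_comm.1 (hr n hn).1

/-- If the orthogonal complement of `N` and its conjugate is a hyperbolic plane, the discriminant of
`diagForm s` is negative. -/
theorem prod_sign_ne_one (hη : η = 1) {N : Submodule ℂ (κ → ℂ)}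
    (hN : ∀ x ∈ N, (∀ y ∈ N, diagForm s x y = 0) → x = 0)
    (hNb : ∀ x ∈ N, ∀ y ∈ N, monomialForm ι β x y = 0)
    {r p : κ → ℂ} (hr : r ∈ D.formTriple.biorthogonal N) (hp : p ∈ D.formTriple.biorthogonal N)
    (hr0 : r ≠ 0) (hrr : diagForm s r r = 0)
    (hspan : ∀ m ∈ D.formTriple.biorthogonal N, ∃ c d : ℂ, m = c • r + d • p) :
    Fintype.card κ = 2 * (Module.finrank ℂ N + 1) ∧ ∏ i, s i ≠ 1 := by
  have H := D.formTriple
  set h := diagForm s with hh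
  set τ := monomialTau s ι β with hτ
  have hpr : h p r ≠ 0 := by
    obtain ⟨m, hm, h1⟩ := H.exists_h_ne_zero hN hNb hr hr0
    obtain ⟨c, d, rfl⟩ := hspan m hm
    intro h0
    simp [hrr, h0] at h1
  have hrp : h r p ≠ 0 := fun h0 => hpr (H.h_eq_zero_comm.1 h0)
  let k := Module.finrank ℂ N
  let B := Module.finBasis ℂ N
  -- Basis vectors of `N`, their images under `τ`, and the pair `r`, `p`. Their Gram matrix has the
  -- diagonal blocks `Gn`, `conj Gn` (because `η = 1`) and a plane containing the isotropic vector
  -- `r`. Its determinant is `-|det Gn|² |h r p|²`, a negative number.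
  let v : (Fin k ⊕ Fin k) ⊕ Fin 2 → (κ → ℂ) :=
    Sum.elim (Sum.elim (fun i => (B i : κ → ℂ)) (fun i => τ (B i))) ![r, p]
  have hBsum : ∀ n (hn : n ∈ N), n = ∑ i, B.repr ⟨n, hn⟩ i • (B i : κ → ℂ) := by
    intro n hn
    have := congrArg N.subtype (B.sum_repr ⟨n, hn⟩)
    rw [map_sum] at this
    exact this.symm
  let Gn : Matrix (Fin k) (Fin k) ℂ := Matrix.of fun i j => h (B i) (B j)
  have hGn : Gn.det ≠ 0 := by
    intro h0
    obtain ⟨c, hc0, hc⟩ := Matrix.exists_vecMul_eq_zero_iff.2 h0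
    apply hc0
    have h1 : (∑ i, c i • B i : N) = 0 := by
      refine Subtype.ext (hN _ (Subtype.mem _) fun y hy => ?_)
      rw [hBsum y hy, map_sum]
      refine Finset.sum_eq_zero fun j _ => ?_
      have h2 := congrFun hc j
      simp only [Matrix.vecMul, dotProduct, Gn, Matrix.of_apply, Pi.zero_apply] at h2
      simp only [map_smulₛₗ, Submodule.coe_sum, Submodule.coe_smul, map_sum, LinearMap.sum_apply,
        RingHom.id_apply, LinearMap.smul_apply, smul_eq_mul, h2, mul_zero]
    have h2 := congrArg B.repr h1
    ext i
    have h3 := congrArg (fun f => f i) h2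
    simpa [Finsupp.single_apply] using h3
  let G₂ : Matrix (Fin 2) (Fin 2) ℂ := !![0, h r p; h p r, h p p]
  let G : Matrix ((Fin k ⊕ Fin k) ⊕ Fin 2) ((Fin k ⊕ Fin k) ⊕ Fin 2) ℂ :=
    Matrix.of fun a c => h (v a) (v c)
  have hG : G = Matrix.fromBlocks (Matrix.fromBlocks Gn 0 0 (Gn.map conj)) 0 0 G₂ := by
    have e0 : ∀ n ∈ N, ∀ n' ∈ N, h n (τ n') = 0 := by
      intro n hn n' hn'
      rw [H.h_tau, hNb n hn n' hn', mul_zero]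
    have e1 : ∀ n ∈ N, ∀ n' ∈ N, h (τ n) n' = 0 := fun n hn n' hn' =>
      H.h_eq_zero_comm.1 (e0 n' hn' n hn)
    have e2 : ∀ m ∈ D.formTriple.biorthogonal N, ∀ n ∈ N, h m (τ n) = 0 := by
      intro m hm n hn
      rw [H.h_tau, (hm n hn).2, mul_zero]
    ext (( a | a) | a) ((c | c) | c)
    · simp [G, v, Gn]
    · simpa [G, v] using e0 _ (B a).2 _ (B c).2
    · fin_cases c
      · simpa [G, v] using H.h_eq_zero_comm.1 (hr _ (B a).2).1
      · simpa [G, v] using H.h_eq_zero_comm.1 (hp _ (B a).2).1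
    · simpa [G, v] using e1 _ (B a).2 _ (B c).2
    · have := H.h_conj (B a) (B c)
      rw [hη, one_mul] at this
      simpa [G, v, Gn] using this
    · fin_cases c
      · simpa [G, v] using H.h_eq_zero_comm.1 (e2 r hr _ (B a).2)
      · simpa [G, v] using H.h_eq_zero_comm.1 (e2 p hp _ (B a).2)
    · fin_cases a
      · simpa [G, v] using (hr _ (B c).2).1
      · simpa [G, v] using (hp _ (B c).2).1
    · fin_cases a
      · simpa [G, v] using (e2 r hr _ (B c).2)
      · simpa [G, v] using (e2 p hp _ (B c).2)
    · fin_cases a <;> fin_cases c <;> simp [G, v, G₂, hrr]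
  have hdet : G.det = -((Gn.det * conj Gn.det) * (h r p * conj (h r p))) := by
    have hconj : (Gn.map conj).det = conj Gn.det := by
      rw [RingHom.map_det]; rfl
    rw [hG, Matrix.det_fromBlocks_zero₂₁, Matrix.det_fromBlocks_zero₂₁, hconj,
      Matrix.det_fin_two_of, H.herm r p]
    ring
  have hdet0 : G.det ≠ 0 := by
    rw [hdet]
    simp [hGn, hrp]
  let P : Matrix κ ((Fin k ⊕ Fin k) ⊕ Fin 2) ℂ := Matrix.of fun i a => v a i
  have hPG : G = P.transpose * (Matrix.diagonal s * P.map conj) := by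
    ext a c
    rw [Matrix.mul_apply]
    simp only [G, P, hh, Matrix.of_apply, diagForm_apply, Matrix.diagonal_mul,
      Matrix.transpose_apply, Matrix.map_apply]
    exact Finset.sum_congr rfl fun i _ => by ring
  have hPmul : ∀ c, P.mulVec c = ∑ a, c a • v a := by
    intro c
    ext i
    simp [Matrix.mulVec, dotProduct, P, mul_comm]
  have hinj : Function.Injective (Matrix.toLin' P) := by
    rw [← LinearMap.ker_eq_bot, LinearMap.ker_eq_bot']
    intro c hc
    rw [Matrix.toLin'_apply] at hc
    by_contra hc0
    apply hdet0
    rw [← Matrix.exists_vecMul_eq_zero_iff]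
    refine ⟨c, hc0, ?_⟩
    rw [hPG, ← Matrix.vecMul_vecMul, Matrix.vecMul_transpose, hc, Matrix.zero_vecMul]
  have hsurj : Function.Surjective (Matrix.toLin' P) := by
    have hrange : ∀ a, v a ∈ LinearMap.range (Matrix.toLin' P) := by
      intro a
      refine ⟨Pi.single a 1, ?_⟩
      rw [Matrix.toLin'_apply, hPmul]
      simp [Pi.single_apply]
    intro x
    obtain ⟨n, hn, n', hn', m, hm, rfl⟩ := H.exists_decomposition hN hNb x
    obtain ⟨c, d, rfl⟩ := hspan m hm
    change _ ∈ LinearMap.range (Matrix.toLin' P)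
    refine Submodule.add_mem _ (Submodule.add_mem _ ?_ ?_) (Submodule.add_mem _ ?_ ?_)
    · rw [hBsum n hn]
      exact Submodule.sum_mem _ fun i _ => Submodule.smul_mem _ _ (hrange (Sum.inl (Sum.inl i)))
    · rw [hBsum n' hn', map_sum]
      refine Submodule.sum_mem _ fun i _ => ?_
      rw [map_smulₛₗ]
      exact Submodule.smul_mem _ _ (hrange (Sum.inl (Sum.inr i)))
    · exact Submodule.smul_mem _ _ (hrange (Sum.inr 0))
    · exact Submodule.smul_mem _ _ (hrange (Sum.inr 1))
  have hcard : Fintype.card κ = Fintype.card ((Fin k ⊕ Fin k) ⊕ Fin 2) := by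
    have := (LinearEquiv.ofBijective _ ⟨hinj, hsurj⟩).finrank_eq
    simpa using this.symm
  refine ⟨by rw [hcard]; simp; omega, fun hprod => ?_⟩
  -- Making `P` square gives the Gram determinant also as `|det P'|² * ∏ s i`, which is not negative
  -- if the product of the signs is one.
  let e := Fintype.equivOfCardEq hcard
  let P' := P.submatrix id e
  have h1 : G.det = P'.det * (∏ i, s i) * conj P'.det := by
    have h2 : G.submatrix e e = P'.transpose * (Matrix.diagonal s * P'.map conj) := by
      rw [hPG]
      rfl
    have hconj : (P'.map conj).det = conj P'.det := by
      rw [RingHom.map_det]; rfl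
    rw [← Matrix.det_submatrix_equiv_self e, h2, Matrix.det_mul, Matrix.det_mul,
      Matrix.det_transpose, Matrix.det_diagonal, hconj, mul_assoc]
  rw [hprod, mul_one, Complex.mul_conj, hdet, Complex.mul_conj, Complex.mul_conj] at h1
  have h2 : -(Complex.normSq Gn.det * Complex.normSq (h r p)) = Complex.normSq P'.det := by
    exact_mod_cast h1
  have h3 := Complex.normSq_pos.2 hGn
  have h4 := Complex.normSq_pos.2 hrp
  have h5 := Complex.normSq_nonneg P'.det
  have h6 := mul_pos h3 h4
  linarith

/-- Arbitrarily near the identity there are transformations preserving the bilinear form that move a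
degenerate isotropic subspace to a less degenerate one. -/
theorem exists_finrank_radical_lt {F : Submodule ℂ (κ → ℂ)}
    (hF : ¬ ∀ x ∈ F, (∀ y ∈ F, diagForm s x y = 0) → x = 0)
    (hFb : ∀ x ∈ F, ∀ y ∈ F, monomialForm ι β x y = 0)
    (hLag : σ = 1 → η = 1 → Fintype.card κ = 2 * Module.finrank ℂ F → ∏ i, s i = 1)
    {O : Set (Matrix κ κ ℂ)} (hO : O ∈ 𝓝 1) :
    ∃ u ∈ O, IsUnit u ∧
      (∀ x y, monomialForm ι β (u.mulVec x) (u.mulVec y) = monomialForm ι β x y) ∧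
      Module.finrank ℂ (radical (diagForm s) (F.map (Matrix.toLin' u))) <
        Module.finrank ℂ (radical (diagForm s) F) := by
  have H := D.formTriple
  obtain ⟨r, hr, hr0⟩ := exists_ne_zero_radical hF
  obtain ⟨N, hinf, hsup⟩ := exists_compl_radical (diagForm s) F
  have hNF : N ≤ F := hsup ▸ le_sup_left
  have hN := nondeg_of_compl_radical (diagForm_herm D.sq_s) hinf hsup
  have hNb : ∀ x ∈ N, ∀ y ∈ N, monomialForm ι β x y = 0 := fun x hx y hy =>
    hFb x (hNF hx) y (hNF hy)
  have hrad : ∀ x ∈ radical (diagForm s) F, x ∈ D.formTriple.biorthogonal N :=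
    fun x hx n hn => ⟨hx.2 n (hNF hn), hFb x hx.1 n (hNF hn)⟩
  have hrr := hr.2 r hr.1
  refine exists_matrix_of_hasDeformation D.sq_s hinf hsup hr ?_ hO
  rcases H.sq_sigma with hσ | hσ
  swap
  · exact D.formTriple.hasDeformation_of_antisymm hσ hN hNb r hr0 (hrad r hr) hrr
  refine D.formTriple.hasDeformation_of_symm hσ hN hNb r hr0 (hrad r hr) hrr
    (hFb r hr.1 r hr.1) fun p hp hrp hpp => ?_
  -- Without a suitable `q`, subtracting the components along `r` and `p` leaves zero, so the
  -- biorthogonal space of `N` is the hyperbolic plane of `r` and `p`.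
  by_contra hcon
  push Not at hcon
  have hbr : monomialForm ι β r r = 0 := hFb r hr.1 r hr.1
  have hpr : monomialForm ι β p r = 1 := by rw [H.b_symm r p, hσ, hrp, one_mul]
  have hspan : ∀ m ∈ D.formTriple.biorthogonal N,
      m = monomialForm ι β m p • r + monomialForm ι β m r • p := by
    intro m hm
    by_contra hne
    refine hcon (m - (monomialForm ι β m p • r + monomialForm ι β m r • p))
      (Submodule.sub_mem _ hm (Submodule.add_mem _ (Submodule.smul_mem _ _ (hrad r hr))
        (Submodule.smul_mem _ _ hp))) (sub_ne_zero.2 hne) ?_ ?_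
    · simp [hbr, hpr]
    · simp [hrp, hpp]
  rcases H.sq_eta with hη | hη
  · obtain ⟨hcard, hprod⟩ := D.prod_sign_ne_one hη hN hNb (hrad r hr) hp hr0 hrr
      fun m hm => ⟨_, _, hspan m hm⟩
    refine hprod (hLag hσ hη ?_)
    -- Vectors of the radical are `b`-orthogonal to `r`, so they have no component along `p`. Thus
    -- `F` is one dimension larger than `N`, that is, half of the total dimension.
    have h1 : radical (diagForm s) F = ℂ ∙ r := by
      apply le_antisymm
      · intro x hx
        have h2 := hspan x (hrad x hx)
        rw [hFb x hx.1 r hr.1, zero_smul, add_zero] at h2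
        exact Submodule.mem_span_singleton.2 ⟨_, h2.symm⟩
      · rwa [Submodule.span_singleton_le_iff_mem]
    have h2 := Submodule.finrank_sup_add_finrank_inf_eq N (radical (diagForm s) F)
    rw [hinf, hsup, finrank_bot, h1, finrank_span_singleton hr0, add_zero] at h2
    rw [hcard, h2]
  -- For `η = -1` the plane cannot occur: `b (τ r) r = 0` gives `τ r = c • r`, and `τ² = -1` becomes
  -- `|c|² = -1`.
  · have h1 := hspan _ (D.tau_mem_biorthogonal (hrad r hr))
    have h2 : monomialForm ι β (monomialTau s ι β r) r = 0 := by
      rw [H.b_eq_zero_comm, ← H.h_eq, hrr]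
    rw [h2, zero_smul, add_zero] at h1
    set c := monomialForm ι β (monomialTau s ι β r) p
    have h3 := H.tau_tau r
    rw [h1, map_smulₛₗ, h1, smul_smul, hη, hσ] at h3
    have h4 : (conj c * c + 1) • r = 0 := by
      rw [add_smul, h3]
      simp
    rcases smul_eq_zero.1 h4 with h5 | h5
    · rw [mul_comm, Complex.mul_conj] at h5
      have h6 : Complex.normSq c + 1 = 0 := by exact_mod_cast h5
      have := Complex.normSq_nonneg c
      linarith
    · exact hr0 h5

end MonomialData

end FiniteLevel

/-! ### From forms related by `τ` to monomial data, and back -/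

section Adapted

variable {I V : Type} [AddCommGroup V] [Module ℂ V] [DecidableEq I]

/-- A basis that is orthonormal up to signs and monomial for the bilinear form. -/
theorem FormTriple.monomialData {h : V →ₗ[ℂ] V →ₛₗ[starRingEnd ℂ] ℂ} {b : V →ₗ[ℂ] V →ₗ[ℂ] ℂ}
    {τ : V →ₛₗ[starRingEnd ℂ] V} {σ η : ℂ} (H : FormTriple h b τ σ η) (E : Module.Basis I ℂ V)
    {s : I → ℂ} (hs : ∀ i, s i = 1 ∨ s i = -1)
    (hE : ∀ i j, h (E i) (E j) = if i = j then s i else 0) {ι : I → I}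
    (hι : ∀ i j, j ≠ ι i → b (E i) (E j) = 0) :
    MonomialData s ι (fun i => b (E i) (E (ι i))) σ η := by
  have hnd : ∀ x, (∀ i, b x (E i) = 0) → x = 0 := by
    intro x hx
    refine H.nondeg x fun y => ?_
    rw [H.h_eq]
    have : b x = 0 := E.ext hx
    rw [this, LinearMap.zero_apply]
  have hnd' : ∀ x, (∀ i, h (E i) x = 0) → x = 0 := by
    intro x hx
    refine H.nondeg x fun y => ?_
    rw [H.h_eq_zero_comm, ← LinearMap.flip_apply]
    have : h.flip x = 0 := E.ext hx
    rw [this, LinearMap.zero_apply]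
  have hβ : ∀ i, b (E i) (E (ι i)) ≠ 0 := by
    intro i h0
    refine E.ne_zero i (hnd _ fun j => ?_)
    by_cases hj : j = ι i
    · rw [hj, h0]
    · exact hι i j hj
  have hσ : σ ≠ 0 := by rcases H.sq_sigma with h | h <;> simp [h]
  have hinv : ∀ i, ι (ι i) = i := by
    intro i
    by_contra hne
    have h1 := hι (ι i) i (Ne.symm hne)
    rw [H.b_symm (E i)] at h1
    exact hβ i ((mul_eq_zero.1 h1).resolve_left hσ)
  have hβι : ∀ i, b (E (ι i)) (E (ι (ι i))) = σ * b (E i) (E (ι i)) := by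
    intro i
    rw [hinv, H.b_symm]
  -- `τ (E k)` is a multiple of `E (ι k)`, since `h (E i) (τ (E k)) = η σ b (E i) (E k)` vanishes
  -- for the other `i`. Its square is computed from this and from `h_conj`.
  have key : ∀ k, b (E (ι k)) (E (ι (ι k))) * conj (b (E (ι k)) (E (ι (ι k)))) * s (ι k)
      = η * s k := by
    intro k
    set c := conj (η * σ * b (E (ι k)) (E (ι (ι k)))) * s (ι k) with hc
    have h1 : τ (E k) = c • E (ι k) := by
      rw [← sub_eq_zero]
      refine hnd' _ fun i => ?_
      rw [map_sub, H.h_tau, map_smulₛₗ, smul_eq_mul, hE]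
      by_cases hi : i = ι k
      · subst hi
        rw [if_pos rfl, hc, map_mul, Complex.conj_conj, conj_sign hs, hinv]
        linear_combination (-(η * σ * b (E (ι k)) (E k))) * sign_mul_self hs (ι k)
      · rw [if_neg hi, hι i k (fun h => hi (by rw [h, hinv]))]
        simp
    have h2 := H.h_conj (E k) (E k)
    rw [h1, map_smulₛₗ, map_smul, LinearMap.smul_apply, smul_eq_mul, smul_eq_mul, hE, if_pos rfl,
      hE, if_pos rfl, conj_sign hs, hc] at h2
    rw [← h2]
    simp only [map_mul, Complex.conj_conj, conj_sign hs]
    have h3 := H.sign_sq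
    have h4 := H.sign_conj
    rw [map_mul] at h4
    have h5 := sign_mul_self hs (ι k)
    have h6 : conj η * conj σ * (η * σ) = 1 := by rw [h4, h3]
    linear_combination (-(b (E (ι k)) (E (ι (ι k))) * conj (b (E (ι k)) (E (ι (ι k)))) * s (ι k)))
      * h6 - (conj η * conj σ * (η * σ) * (b (E (ι k)) (E (ι (ι k))) *
      conj (b (E (ι k)) (E (ι (ι k)))) * s (ι k))) * h5
  -- A positive real number times a sign equals a sign only if the number is one; so `key` yields
  -- both the modulus of the coefficient and the sign of `ι k`.
  have key2 : ∀ k, b (E (ι k)) (E (ι (ι k))) * conj (b (E (ι k)) (E (ι (ι k)))) = 1 ∧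
      s (ι k) = η * s k := by
    intro k
    have h1 := key k
    rw [Complex.mul_conj] at h1 ⊢
    have h2 := Complex.normSq_pos.2 (hβ (ι k))
    set x := Complex.normSq (b (E (ι k)) (E (ι (ι k))))
    have h3 : ∀ e e' e'' : ℝ, (e = 1 ∨ e = -1) → (e' = 1 ∨ e' = -1) → (e'' = 1 ∨ e'' = -1) →
        x * e = e' * e'' → x = 1 ∧ e = e' * e'' := by
      intro e e' e'' h4 h5 h6 h7
      rcases h4 with rfl | rfl <;> rcases h5 with rfl | rfl <;> rcases h6 with rfl | rfl <;>
        constructor <;> linarith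
    have h4 : ∀ z : ℂ, (z = 1 ∨ z = -1) → ∃ e : ℝ, (e = 1 ∨ e = -1) ∧ z = e := by
      rintro z (rfl | rfl)
      · exact ⟨1, Or.inl rfl, by simp⟩
      · exact ⟨-1, Or.inr rfl, by simp⟩
    obtain ⟨e, he, he'⟩ := h4 _ (hs (ι k))
    obtain ⟨e', hee, hee'⟩ := h4 _ H.sq_eta
    obtain ⟨e'', heee, heee'⟩ := h4 _ (hs k)
    rw [he', hee', heee'] at h1 ⊢
    obtain ⟨h5, h6⟩ := h3 e e' e'' he hee heee (by exact_mod_cast h1)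
    rw [h5]
    exact ⟨by simp, by exact_mod_cast h6⟩
  refine ⟨hs, hinv, fun i => (key2 i).2, fun i => ?_, hβι, H.sq_sigma, H.sq_eta⟩
  have := (key2 (ι i)).1
  rwa [hinv] at this

/-- The antilinear map of `V` attached to monomial data. -/
def finsuppTau (s : I → ℂ) (ι : I → I) (β : I → ℂ) : (I →₀ ℂ) →ₛₗ[starRingEnd ℂ] (I →₀ ℂ) where
  toFun y := y.sum fun j a => Finsupp.single (ι j) (s j * (β j)⁻¹ * conj a)
  map_add' x y := by
    apply Finsupp.sum_add_index'
    · simp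
    · intro i a a'
      rw [map_add, mul_add, Finsupp.single_add]
  map_smul' a x := by
    rw [Finsupp.sum_smul_index (by simp), Finsupp.smul_sum]
    refine Finsupp.sum_congr fun i _ => ?_
    rw [Finsupp.smul_single, map_mul, smul_eq_mul]
    congr 1
    ring

omit [DecidableEq I] in
theorem finsuppTau_single (s : I → ℂ) (ι : I → I) (β : I → ℂ) (j : I) (a : ℂ) :
    finsuppTau s ι β (Finsupp.single j a) = Finsupp.single (ι j) (s j * (β j)⁻¹ * conj a) := by
  simp [finsuppTau]

theorem MonomialData.formTriple_finsupp {s : I → ℂ} {ι : I → I} {β : I → ℂ} {σ η : ℂ}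
    (D : MonomialData s ι β σ η) {h : (I →₀ ℂ) →ₗ[ℂ] (I →₀ ℂ) →ₛₗ[starRingEnd ℂ] ℂ}
    {b : (I →₀ ℂ) →ₗ[ℂ] (I →₀ ℂ) →ₗ[ℂ] ℂ}
    (hh : ∀ i j, h (Finsupp.single i 1) (Finsupp.single j 1) = if i = j then s i else 0)
    (hb : ∀ i j, b (Finsupp.single i 1) (Finsupp.single j 1) = if j = ι i then β i else 0) :
    FormTriple h b (finsuppTau s ι β) σ η := by
  have hsingle : ∀ (i : I) (a : ℂ), Finsupp.single i a = a • Finsupp.single i (1 : ℂ) := by simp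
  have hh' : ∀ i j a c, h (Finsupp.single i a) (Finsupp.single j c) =
      if i = j then a * conj c * s i else 0 := by
    intro i j a c
    rw [hsingle i a, hsingle j c, LinearMap.map_smulₛₗ, map_smul, LinearMap.smul_apply, hh]
    (split_ifs <;> simp); ring
  have hb' : ∀ i j a c, b (Finsupp.single i a) (Finsupp.single j c) =
      if j = ι i then a * c * β i else 0 := by
    intro i j a c
    rw [hsingle i a, hsingle j c, LinearMap.map_smulₛₗ, map_smul, LinearMap.smul_apply, hb]
    (split_ifs <;> simp); ring
  have hη : conj η = η := by rcases D.sq_eta with h | h <;> simp [h]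
  have hinj : ∀ i j, ι i = ι j ↔ i = j := fun i j =>
    ⟨fun e => by rw [← D.inv i, e, D.inv], fun e => by rw [e]⟩
  refine ⟨?_, ?_, ?_, ?_, ?_, ?_, D.sq_sigma, D.sq_eta⟩
  · intro x y
    induction x using Finsupp.induction_linear with
    | zero => simp
    | add x x' hx hx' => simp only [map_add, LinearMap.add_apply, hx, hx']
    | single i a =>
      induction y using Finsupp.induction_linear with
      | zero => simp
      | add y y' hy hy' => simp only [map_add, LinearMap.add_apply, hy, hy']
      | single j c =>
        rw [hh', hh']
        by_cases hij : i = j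
        · subst hij
          simp only [if_true, map_mul, Complex.conj_conj, conj_sign D.sq_s]
          ring
        · rw [if_neg hij, if_neg (Ne.symm hij), map_zero]
  · intro x hx
    ext i
    have h1 : ∀ x, h x (Finsupp.single i 1) = x i * s i := by
      intro x
      induction x using Finsupp.induction_linear with
      | zero => simp
      | add x x' hx hx' => simp only [map_add, LinearMap.add_apply, hx, hx', Finsupp.add_apply]; ring
      | single j a =>
        rw [hh', Finsupp.single_apply]
        split_ifs with h <;> simp [h]
    have h2 := hx (Finsupp.single i 1)
    rw [h1] at h2
    exact (mul_eq_zero.1 h2).resolve_right (sign_ne_zero D.sq_s i)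
  · intro x y
    induction x using Finsupp.induction_linear with
    | zero => simp
    | add x x' hx hx' => simp only [map_add, LinearMap.add_apply, hx, hx']
    | single i a =>
      induction y using Finsupp.induction_linear with
      | zero => simp
      | add y y' hy hy' => simp only [map_add, hy, hy']
      | single j c =>
        rw [hh', finsuppTau_single, hb']
        by_cases hij : i = j
        · subst hij
          have := D.beta_ne i
          simp only [if_true]
          field_simp
        · rw [if_neg hij, if_neg (fun e => hij ((hinj j i).1 e).symm)]
  · intro x y
    induction x using Finsupp.induction_linear with
    | zero => simp
    | add x x' hx hx' => simp only [map_add, LinearMap.add_apply, hx, hx', mul_add]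
    | single i a =>
      induction y using Finsupp.induction_linear with
      | zero => simp
      | add y y' hy hy' => simp only [map_add, LinearMap.add_apply, hy, hy', mul_add]
      | single j c =>
        rw [hb', hb']
        by_cases hij : j = ι i
        · subst hij
          rw [if_pos (D.inv i).symm, if_pos rfl, D.beta_iota]
          ring
        · rw [if_neg hij, if_neg (fun e => hij (by rw [e, D.inv])), mul_zero]
  · intro x y
    induction x using Finsupp.induction_linear with
    | zero => simp
    | add x x' hx hx' => simp only [map_add, LinearMap.add_apply, hx, hx', mul_add]
    | single i a =>
      induction y using Finsupp.induction_linear with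
      | zero => simp
      | add y y' hy hy' => simp only [map_add, hy, hy', mul_add]
      | single j c =>
        rw [finsuppTau_single, finsuppTau_single, hh', hh']
        by_cases hij : i = j
        · subst hij
          simp only [if_true, map_mul, map_inv₀, Complex.conj_conj, conj_sign D.sq_s, D.s_iota]
          have h2 := sign_mul_self D.sq_s i
          have h3 : (β i)⁻¹ * (conj (β i))⁻¹ = 1 := by rw [← mul_inv, D.norm_beta i, inv_one]
          linear_combination (η * s i * s i * s i * conj a * c) * h3 + (η * s i * conj a * c) * h2
        · rw [if_neg hij, if_neg (fun e => hij ((hinj i j).1 e))]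
          simp
  · intro x
    induction x using Finsupp.induction_linear with
    | zero => simp
    | add x x' hx hx' => simp only [map_add, hx, hx', smul_add]
    | single i a =>
      rw [finsuppTau_single, finsuppTau_single, D.inv, Finsupp.smul_single]
      congr 1
      have h2 := sign_mul_self D.sq_s i
      have h3 : (β i)⁻¹ * (conj (β i))⁻¹ = 1 := by rw [← mul_inv, D.norm_beta i, inv_one]
      have h4 : σ⁻¹ = σ := by rcases D.sq_sigma with h | h <;> simp [h, inv_neg]
      simp only [map_mul, map_inv₀, Complex.conj_conj, conj_sign D.sq_s, D.s_iota, D.beta_iota,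
        mul_inv, h4, smul_eq_mul]
      linear_combination (η * s i * s i * σ * a) * h3 + (η * σ * a) * h2

end Adapted

/-! ### The four groups with a bilinear form as monomial data -/

namespace RealForm

theorem sgn_sq (i : ℤ) : sgn i = 1 ∨ sgn i = -1 := by
  unfold sgn
  split_ifs <;> simp

/-- The partner of an index in the forms of quaternionic type. -/
def pairIndex (i : ℤ) : ℤ :=
  if 0 < i then (if Odd i then i + 1 else i - 1) else (if Odd i then i - 1 else i + 1)

/-- The signs `(σ, η)` are `(1, 1)` for `SO`, `(-1, 1)` for `Sp`, `(1, -1)` for `SOStar` and `(-1,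
-1)` for `SpR`. For `Sp` the pairing of indices respects the upper bound because `2 * q` is even. -/
theorem exists_coordinate_data (c : RealForm) (hc : ∀ q, c ≠ SU q) :
    ∃ (ρ : c.Idx → c.Idx) (β : c.Idx → ℂ) (σ η : ℂ),
      MonomialData (fun i : c.Idx => sgn i) ρ β σ η ∧
      ∀ i j : c.Idx, c.bCoeff i j = if j = ρ i then β i else 0 := by
  have hs : ∀ (c : RealForm) (i : c.Idx), sgn (i : ℤ) = 1 ∨ sgn (i : ℤ) = -1 :=
    fun c i => sgn_sq i
  have hsgn : ∀ i : ℤ, i ≠ 0 → sgn (-i) = -1 * sgn i := by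
    intro i hi
    unfold sgn
    split_ifs with h1 h2 h2 <;> first | omega | simp
  have hconj : ∀ i : ℤ, sgn i * conj (sgn i) = 1 := by
    intro i
    rcases sgn_sq i with h | h <;> simp [h]
  cases c with
  | SU q => exact absurd rfl (hc q)
  | SO q =>
    refine ⟨id, fun i => sgn i, 1, 1, ⟨hs _, fun i => rfl, fun i => by simp, fun i => hconj i,
      fun i => by simp, Or.inl rfl, Or.inl rfl⟩, fun i j => ?_⟩
    simp only [bCoeff, id, Subtype.ext_iff, eq_comm]
  | Sp q =>
    have hmem : ∀ i : ℤ, (i ≠ 0 ∧ (i.toNat : ℕ∞) ≤ (Sp q).neg) →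
        (pairIndex i ≠ 0 ∧ ((pairIndex i).toNat : ℕ∞) ≤ (Sp q).neg) := by
      rintro i ⟨h0, h1⟩
      have h2 : pairIndex i ≠ 0 := by
        unfold pairIndex
        split_ifs with h3 h4 h4 <;> rw [Int.odd_iff] at h4 <;> omega
      refine ⟨h2, ?_⟩
      simp only [neg] at h1 ⊢
      induction q using ENat.recTopCoe with
      | top => simp
      | coe n =>
        have h3 : i.toNat ≤ 2 * n := by exact_mod_cast h1
        have h4 : (pairIndex i).toNat ≤ 2 * n := by
          unfold pairIndex
          split_ifs with h3 h4 h4 <;> rw [Int.odd_iff] at h4 <;> omega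
        exact_mod_cast h4
    refine ⟨fun i => ⟨pairIndex i, hmem i i.2⟩, fun i => if Odd (i : ℤ) ↔ 0 < (i : ℤ) then
      -1 else 1, -1, 1, ⟨hs _, fun i => ?_, fun i => ?_, fun i => ?_,
      fun i => ?_, Or.inr rfl, Or.inl rfl⟩, fun i j => ?_⟩
    · obtain ⟨i, h0, h1⟩ := i
      refine Subtype.ext ?_
      simp only [pairIndex, Int.odd_iff]
      split_ifs <;> omega
    · obtain ⟨i, h0, h1⟩ := i
      simp only [pairIndex, Int.odd_iff, sgn]
      split_ifs <;> first | omega | simp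
    · split_ifs <;> simp
    · obtain ⟨i, h0, h1⟩ := i
      simp only [pairIndex, Int.odd_iff]
      split_ifs <;> first | omega | simp
    · obtain ⟨i, h0, h1⟩ := i
      obtain ⟨j, h2, h3⟩ := j
      simp only [bCoeff, pairIndex, Int.odd_iff, Subtype.ext_iff]
      split_ifs <;> first | omega | simp
  | SOStar =>
    refine ⟨fun i => ⟨-i, neg_ne_zero.2 i.2.1, by simp [neg]⟩, fun i => 1, 1, -1,
      ⟨hs _, fun i => by simp, fun i => hsgn i i.2.1, fun i => by simp,
      fun i => by simp, Or.inl rfl, Or.inr rfl⟩, fun i j => ?_⟩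
    simp only [bCoeff, Subtype.ext_iff]
    congr 1
    rw [eq_iff_iff]
    constructor <;> intro h <;> omega
  | SpR =>
    refine ⟨fun i => ⟨-i, neg_ne_zero.2 i.2.1, by simp [neg]⟩, fun i => sgn i, -1, -1,
      ⟨hs _, fun i => by simp, fun i => hsgn i i.2.1, fun i => hconj i,
      fun i => hsgn i i.2.1, Or.inr rfl, Or.inr rfl⟩, fun i j => ?_⟩
    simp only [bCoeff, Subtype.ext_iff]
    congr 1
    rw [eq_iff_iff]
    constructor <;> intro h <;> omega

theorem bilin_SU (q : ℕ∞) : (SU q).b = 0 := by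
  refine Finsupp.lhom_ext' fun i => LinearMap.ext_ring ?_
  refine Finsupp.lhom_ext' fun j => LinearMap.ext_ring ?_
  simp only [LinearMap.comp_apply, Finsupp.lsingle_apply, LinearMap.zero_apply]
  rw [b_single]
  rfl

theorem Adapted.h_basis {c : RealForm} {E : Module.Basis c.Idx ℂ c.V} (hE : c.Adapted E)
    (i j : c.Idx) : c.h (E i) (E j) = if i = j then sgn i else 0 := by
  rw [hE.h_eq, hCoeff]
  simp only [Subtype.ext_iff]

/-- The relations between `h`, `b` and `τ` do not involve a basis. They are established on the
coordinate basis and then force the coefficients on any adapted `E` to be of the same kind, with the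
same `σ` and `η`. -/
theorem Adapted.exists_monomialData {c : RealForm} {E : Module.Basis c.Idx ℂ c.V}
    (hE : c.Adapted E) (hc : ∀ q, c ≠ SU q) :
    ∃ (ι : c.Idx → c.Idx) (β : c.Idx → ℂ) (σ η : ℂ),
      MonomialData (fun i : c.Idx => sgn i) ι β σ η ∧
      ∀ i j, c.b (E i) (E j) = if j = ι i then β i else 0 := by
  obtain ⟨ρ, β₀, σ, η, D, hD⟩ := exists_coordinate_data c hc
  have H := D.formTriple_finsupp (h := c.h) (b := c.b)
    (fun i j => by rw [h_single, hCoeff]; simp only [Subtype.ext_iff])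
    (fun i j => by rw [b_single, hD])
  obtain ⟨ι, hι⟩ := hE.b_eq
  refine ⟨ι, _, σ, η, H.monomialData E (fun i => sgn_sq i) hE.h_basis hι, fun i j => ?_⟩
  split_ifs with h
  · rw [h]
  · exact hι i j h

end RealForm

/-! ### Transformations of a finite block, and subspaces that split along it -/

section Blocks

variable {I V : Type} [AddCommGroup V] [Module ℂ V] (E : Module.Basis I ℂ V) (T : Finset I)

/-- The inclusion of the span of the `E i`, `i ∈ T`. -/
def incl : (T → ℂ) →ₗ[ℂ] V := Fintype.linearCombination ℂ fun i : T => E i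

/-- The coordinates with index in `T`. -/
def coords : V →ₗ[ℂ] (T → ℂ) := LinearMap.pi fun i : T => E.coord i

variable {E T}

theorem incl_apply (x : T → ℂ) : incl E T x = ∑ i : T, x i • E i := rfl

theorem coords_apply (x : V) (i : T) : coords E T x i = E.repr x i := rfl

theorem repr_incl [DecidableEq I] (x : T → ℂ) (i : I) :
    E.repr (incl E T x) i = if h : i ∈ T then x ⟨i, h⟩ else 0 := by
  rw [incl_apply, map_sum, Finsupp.finsetSum_apply]
  simp only [map_smul, Finsupp.smul_apply, Module.Basis.repr_self, Finsupp.single_apply, smul_eq_mul]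
  split_ifs with h
  · rw [Finset.sum_eq_single ⟨i, h⟩]
    · simp
    · intro j _ hj
      rw [if_neg (fun e => hj (Subtype.ext e)), mul_zero]
    · simp
  · refine Finset.sum_eq_zero fun j _ => ?_
    rw [if_neg (fun e : (j : I) = i => h (e ▸ j.2)), mul_zero]

theorem coords_incl (x : T → ℂ) : coords E T (incl E T x) = x := by
  classical
  ext i
  rw [coords_apply, repr_incl, dif_pos i.2]

theorem incl_injective : Function.Injective (incl E T) :=
  Function.LeftInverse.injective coords_incl

theorem repr_sub_incl_coords [DecidableEq I] (x : V) (i : I) :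
    E.repr (x - incl E T (coords E T x)) i = if i ∈ T then 0 else E.repr x i := by
  rw [map_sub, Finsupp.sub_apply, repr_incl]
  split_ifs with h
  · rw [coords_apply, sub_self]
  · rw [sub_zero]

theorem incl_coords_of_mem {i : I} (hi : i ∈ T) : incl E T (coords E T (E i)) = E i := by
  classical
  refine (sub_eq_zero.1 ?_).symm
  refine E.repr.map_eq_zero_iff.1 (Finsupp.ext fun j => ?_)
  rw [repr_sub_incl_coords, Module.Basis.repr_self, Finsupp.single_apply]
  split_ifs with h1 h2
  · rfl
  · exact absurd (h2 ▸ hi) h1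
  · rfl

theorem coords_of_not_mem {i : I} (hi : i ∉ T) : coords E T (E i) = 0 := by
  classical
  ext j
  rw [coords_apply, Module.Basis.repr_self, Finsupp.single_apply,
    if_neg (fun e => hi (by rw [e]; exact j.2))]
  rfl

theorem incl_coords_of_support {x : V} (hx : (E.repr x).support ⊆ T) :
    incl E T (coords E T x) = x := by
  classical
  refine (sub_eq_zero.1 ?_).symm
  refine E.repr.map_eq_zero_iff.1 (Finsupp.ext fun j => ?_)
  rw [repr_sub_incl_coords]
  split_ifs with h1
  · rfl
  · exact Finsupp.notMem_support_iff.1 fun h => h1 (hx h)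

theorem span_image_eq_range_incl :
    Submodule.span ℂ (E '' (T : Set I)) = LinearMap.range (incl E T) := by
  rw [incl, Fintype.range_linearCombination]
  congr 1
  ext x
  simp

variable (E T)

/-- The transformation acting by the matrix `A` on the span of the `E i`, `i ∈ T`, and trivially on the
other basis vectors. -/
def blockMap (A : Matrix T T ℂ) : V →ₗ[ℂ] V :=
  LinearMap.id - (incl E T).comp (coords E T) +
    (incl E T).comp (A.mulVecLin.comp (coords E T))

variable {E T}

theorem blockMap_apply (A : Matrix T T ℂ) (x : V) : blockMap E T A x =
    x - incl E T (coords E T x) + incl E T (A.mulVec (coords E T x)) := rfl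

theorem coords_blockMap (A : Matrix T T ℂ) (x : V) :
    coords E T (blockMap E T A x) = A.mulVec (coords E T x) := by
  rw [blockMap_apply, map_add, map_sub, coords_incl, coords_incl, sub_self, zero_add]

theorem blockMap_sub_incl (A : Matrix T T ℂ) (x : V) :
    blockMap E T A x - incl E T (coords E T (blockMap E T A x)) = x - incl E T (coords E T x) := by
  rw [coords_blockMap, blockMap_apply]
  abel

theorem blockMap_incl (A : Matrix T T ℂ) (x : T → ℂ) :
    blockMap E T A (incl E T x) = incl E T (A.mulVec x) := by
  rw [blockMap_apply, coords_incl, sub_self, zero_add]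

theorem blockMap_of_not_mem (A : Matrix T T ℂ) {i : I} (hi : i ∉ T) :
    blockMap E T A (E i) = E i := by
  rw [blockMap_apply, coords_of_not_mem hi, Matrix.mulVec_zero, map_zero, sub_zero, add_zero]

theorem blockMap_mul (A B : Matrix T T ℂ) (x : V) :
    blockMap E T (A * B) x = blockMap E T A (blockMap E T B x) := by
  rw [blockMap_apply A, coords_blockMap, Matrix.mulVec_mulVec, ← coords_blockMap B,
    blockMap_sub_incl, blockMap_apply]

theorem blockMap_one [DecidableEq I] (x : V) : blockMap E T 1 x = x := by
  rw [blockMap_apply, Matrix.one_mulVec, sub_add_cancel]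

variable (E T)

/-- `blockMap` of an invertible matrix as an invertible transformation. -/
def blockEquiv [DecidableEq I] (u : (Matrix T T ℂ)ˣ) : V ≃ₗ[ℂ] V :=
  LinearEquiv.ofLinearMap (blockMap E T u) (blockMap E T (↑u⁻¹ : Matrix T T ℂ))
    (LinearMap.ext fun x => by
      rw [LinearMap.comp_apply, ← blockMap_mul, Units.mul_inv, blockMap_one, LinearMap.id_apply])
    (LinearMap.ext fun x => by
      rw [LinearMap.comp_apply, ← blockMap_mul, Units.inv_mul, blockMap_one, LinearMap.id_apply])

/-- The matrix of `g` on the span of the `E i`, `i ∈ T`. -/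
def blockMatrix (g : V ≃ₗ[ℂ] V) : Matrix T T ℂ := Matrix.of fun i j => E.repr (g (E j)) i

variable {E T}

theorem blockEquiv_apply [DecidableEq I] (u : (Matrix T T ℂ)ˣ) (x : V) :
    blockEquiv E T u x = blockMap E T u x := rfl

theorem coe_blockEquiv [DecidableEq I] (u : (Matrix T T ℂ)ˣ) :
    (blockEquiv E T u : V →ₗ[ℂ] V) = blockMap E T u := rfl

theorem supportedIn_blockEquiv [DecidableEq I] (u : (Matrix T T ℂ)ˣ) :
    SupportedIn E T (blockEquiv E T u) := by
  refine ⟨fun i hi => blockMap_of_not_mem _ hi, fun i hi => ?_⟩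
  rw [span_image_eq_range_incl, blockEquiv_apply, ← incl_coords_of_mem hi, blockMap_incl]
  exact ⟨_, rfl⟩

theorem mem_finitaryGL_of_supportedIn {g : V ≃ₗ[ℂ] V} (hg : SupportedIn E T g) :
    g ∈ finitaryGL E := by
  refine T.finite_toSet.subset fun i hi => ?_
  by_contra h
  exact hi (hg.1 i h)

theorem SupportedIn.eq_blockMap {g : V ≃ₗ[ℂ] V} (hg : SupportedIn E T g) :
    (g : V →ₗ[ℂ] V) = blockMap E T (blockMatrix E T g) := by
  classical
  refine E.ext fun i => ?_
  by_cases hi : i ∈ T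
  · have h1 := hg.2 i hi
    rw [span_image_eq_range_incl] at h1
    obtain ⟨y, hy⟩ := h1
    rw [← incl_coords_of_mem hi, blockMap_incl, incl_coords_of_mem hi, LinearEquiv.coe_coe, ← hy]
    congr 1
    ext j
    have h2 : coords E T (E i) = Pi.single ⟨i, hi⟩ 1 := by
      ext k
      rw [coords_apply, Module.Basis.repr_self, Finsupp.single_apply, Pi.single_apply]
      simp only [Subtype.ext_iff, eq_comm]
    rw [h2, Matrix.mulVec_single_one, Matrix.col_apply, blockMatrix, Matrix.of_apply, ← hy,
      ← coords_apply, coords_incl]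
  · rw [blockMap_of_not_mem _ hi, LinearEquiv.coe_coe, hg.1 i hi]

theorem SupportedIn.apply {g : V ≃ₗ[ℂ] V} (hg : SupportedIn E T g) (x : V) :
    g x = blockMap E T (blockMatrix E T g) x := by
  rw [← hg.eq_blockMap]
  rfl

theorem blockMatrix_eq_of_blockMap [DecidableEq I] {g : V ≃ₗ[ℂ] V} {A : Matrix T T ℂ}
    (h : ∀ x, g x = blockMap E T A x) : blockMatrix E T g = A := by
  ext i j
  rw [blockMatrix, Matrix.of_apply, h, ← coords_apply, coords_blockMap]
  have h2 : coords E T (E j) = Pi.single j 1 := by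
    ext k
    rw [coords_apply, Module.Basis.repr_self, Finsupp.single_apply, Pi.single_apply]
    simp only [Subtype.ext_iff, eq_comm]
  rw [h2, Matrix.mulVec_single_one, Matrix.col_apply]

theorem SupportedIn.mono {S : Finset I} {g : V ≃ₗ[ℂ] V} (hg : SupportedIn E S g) (hST : S ⊆ T) :
    SupportedIn E T g := by
  refine ⟨fun i hi => hg.1 i fun h => hi (hST h), fun i hi => ?_⟩
  by_cases hiS : i ∈ S
  · exact Submodule.span_mono (Set.image_mono (by exact_mod_cast hST)) (hg.2 i hiS)
  · rw [hg.1 i hiS]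
    exact Submodule.subset_span ⟨i, hi, rfl⟩

theorem SupportedIn.map_span_le {g : V ≃ₗ[ℂ] V} (hg : SupportedIn E T g) {x : V}
    (hx : x ∈ Submodule.span ℂ (E '' (T : Set I))) : g x ∈ Submodule.span ℂ (E '' (T : Set I)) := by
  rw [span_image_eq_range_incl] at hx ⊢
  obtain ⟨y, rfl⟩ := hx
  rw [hg.apply, blockMap_incl]
  exact ⟨_, rfl⟩

theorem SupportedIn.mul {g k : V ≃ₗ[ℂ] V} (hg : SupportedIn E T g) (hk : SupportedIn E T k) :
    SupportedIn E T (g * k) := by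
  refine ⟨fun i hi => ?_, fun i hi => ?_⟩
  · rw [LinearEquiv.mul_apply, hk.1 i hi, hg.1 i hi]
  · rw [LinearEquiv.mul_apply]
    exact hg.map_span_le (hk.2 i hi)

theorem SupportedIn.blockMatrix_mul [DecidableEq I] {g k : V ≃ₗ[ℂ] V} (hg : SupportedIn E T g)
    (hk : SupportedIn E T k) :
    blockMatrix E T (g * k) = blockMatrix E T g * blockMatrix E T k :=
  blockMatrix_eq_of_blockMap fun x => by
    rw [LinearEquiv.mul_apply, hg.apply, hk.apply, blockMap_mul]

theorem blockMatrix_one [DecidableEq I] : blockMatrix E T (1 : V ≃ₗ[ℂ] V) = 1 :=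
  blockMatrix_eq_of_blockMap fun x => by
    rw [blockMap_one]
    rfl

theorem supportedIn_one : SupportedIn E T (1 : V ≃ₗ[ℂ] V) :=
  ⟨fun _ _ => rfl, fun i hi => Submodule.subset_span ⟨i, hi, rfl⟩⟩

theorem SupportedIn.inv {g : V ≃ₗ[ℂ] V} (hg : SupportedIn E T g) : SupportedIn E T g⁻¹ := by
  classical
  have hinv : ∀ x, g⁻¹ (g x) = x := fun x => g.symm_apply_apply x
  have hinv' : ∀ x, g (g⁻¹ x) = x := fun x => g.apply_symm_apply x
  have h1 : Function.Injective (Matrix.toLin' (blockMatrix E T g)) := by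
    intro x y hxy
    apply incl_injective (E := E) (T := T)
    apply g.injective
    rw [hg.apply, hg.apply, blockMap_incl, blockMap_incl]
    rw [Matrix.toLin'_apply, Matrix.toLin'_apply] at hxy
    rw [hxy]
  have h2 := LinearMap.surjective_of_injective h1
  refine ⟨fun i hi => ?_, fun i hi => ?_⟩
  · have := hinv (E i)
    rwa [hg.1 i hi] at this
  · obtain ⟨y, hy⟩ := h2 (coords E T (E i))
    rw [span_image_eq_range_incl]
    refine ⟨y, g.injective ?_⟩
    rw [hinv', hg.apply, blockMap_incl, ← Matrix.toLin'_apply, hy, incl_coords_of_mem hi]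

theorem SupportedIn.isUnit_blockMatrix [DecidableEq I] {g : V ≃ₗ[ℂ] V} (hg : SupportedIn E T g) :
    IsUnit (blockMatrix E T g) := by
  refine IsUnit.of_mul_eq_one (blockMatrix E T g⁻¹) ?_
  rw [← hg.blockMatrix_mul hg.inv, mul_inv_cancel, blockMatrix_one]

theorem exists_supportedIn {g : V ≃ₗ[ℂ] V} (hg : g ∈ finitaryGL E) :
    ∃ T₀ : Finset I, ∀ T, T₀ ⊆ T → SupportedIn E T g := by
  classical
  have hfin : {i | g (E i) ≠ E i}.Finite := hg
  refine ⟨hfin.toFinset ∪ hfin.toFinset.biUnion fun i => (E.repr (g (E i))).support,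
    fun T hT => ⟨fun i hi => ?_, fun i hi => ?_⟩⟩
  · by_contra h
    exact hi (hT (Finset.mem_union_left _ (hfin.mem_toFinset.2 h)))
  · by_cases h : g (E i) = E i
    · rw [h]
      exact Submodule.subset_span ⟨i, hi, rfl⟩
    · rw [span_image_eq_range_incl]
      refine ⟨_, incl_coords_of_support fun j hj => hT (Finset.mem_union_right _ ?_)⟩
      exact Finset.mem_biUnion.2 ⟨i, hfin.mem_toFinset.2 h, hj⟩

/-- `F` is the direct sum of a subspace of the span of the `E i`, `i ∈ T`, and of a subspace spanned by other
elements of `E`. -/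
def Splits (E : Module.Basis I ℂ V) (T : Finset I) (F : Submodule ℂ V) : Prop :=
  (∀ x ∈ F, incl E T (coords E T x) ∈ F) ∧ ∀ x ∈ F, ∀ i ∉ T, E.repr x i ≠ 0 → E i ∈ F

/-- All but finitely many vectors of the adapted basis `L` belong to `E`. Once `T` contains the
supports of the exceptional ones, each generator of a member lies in the span of `T` or is a vector
of `E` outside `T`. -/
theorem exists_splits {𝓜 : Set (Submodule ℂ V)} (h𝓜 : WeaklyCompatible E 𝓜) :
    ∃ T₀ : Finset I, ∀ T, T₀ ⊆ T → ∀ F ∈ 𝓜, Splits E T F := by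
  classical
  obtain ⟨L, hfin, hL⟩ := h𝓜
  have hT₁ : {i | E i ∉ Set.range L}.Finite := by
    refine Set.Finite.of_finite_image (f := E) (hfin.subset ?_) E.injective.injOn
    rintro _ ⟨i, hi, rfl⟩
    exact ⟨⟨i, rfl⟩, hi⟩
  let T₁ := hT₁.toFinset
  let K : Finset I := T₁.biUnion fun i => (L.repr (E i)).support
  -- In the `E`-expansion of `L k`, the vectors `E i` with `i ∉ T₁` are vectors of `L` other than `L
  -- k`. The coordinate of `L k` along itself must therefore come from some `i ∈ T₁`.
  have hK : ∀ k, L k ∉ Set.range E → k ∈ K := by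
    intro k hk
    by_contra hkK
    have h1 : ∀ i, E.repr (L k) i • L.repr (E i) k = 0 := by
      intro i
      by_cases hi : i ∈ T₁
      · have : k ∉ (L.repr (E i)).support := fun h => hkK (Finset.mem_biUnion.2 ⟨i, hi, h⟩)
        rw [Finsupp.notMem_support_iff.1 this, smul_zero]
      · have : E i ∈ Set.range L := by
          by_contra h
          exact hi (hT₁.mem_toFinset.2 h)
        obtain ⟨k', hk'⟩ := this
        rw [← hk', Module.Basis.repr_self, Finsupp.single_apply, if_neg, smul_zero]
        rintro rfl
        exact hk ⟨i, hk'.symm⟩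
    have h2 : L.repr (L k) k = 0 := by
      conv_lhs => rw [← E.linearCombination_repr (L k)]
      rw [Finsupp.linearCombination_apply, Finsupp.sum, map_sum, Finsupp.finsetSum_apply]
      refine Finset.sum_eq_zero fun i _ => ?_
      rw [map_smul, Finsupp.smul_apply, h1]
    simp at h2
  refine ⟨T₁ ∪ K.biUnion fun k => (E.repr (L k)).support, fun T hT F hF => ?_⟩
  obtain ⟨s, rfl⟩ := hL F hF
  have hsupp : ∀ k, L k ∉ Set.range E → (E.repr (L k)).support ⊆ T := fun k hk j hj =>
    hT (Finset.mem_union_right _ (Finset.mem_biUnion.2 ⟨k, hK k hk, hj⟩))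
  constructor
  · intro x hx
    have : Submodule.span ℂ (L '' s) ≤
        (Submodule.span ℂ (L '' s)).comap ((incl E T).comp (coords E T)) := by
      rw [Submodule.span_le]
      rintro _ ⟨k, hk, rfl⟩
      have hmem : L k ∈ Submodule.span ℂ (L '' s) := Submodule.subset_span ⟨k, hk, rfl⟩
      change incl E T (coords E T (L k)) ∈ Submodule.span ℂ (L '' s)
      by_cases hkE : L k ∈ Set.range E
      · obtain ⟨i, hi⟩ := hkE
        by_cases hiT : i ∈ T
        · rw [← hi, incl_coords_of_mem hiT, hi]
          exact hmem
        · rw [← hi, coords_of_not_mem hiT, map_zero]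
          exact Submodule.zero_mem _
      · rw [incl_coords_of_support (hsupp k hkE)]
        exact hmem
    exact this hx
  · intro x hx i hi hxi
    by_contra hcon
    apply hxi
    have : Submodule.span ℂ (L '' s) ≤ LinearMap.ker (E.coord i) := by
      rw [Submodule.span_le]
      rintro _ ⟨k, hk, rfl⟩
      have hmem : L k ∈ Submodule.span ℂ (L '' s) := Submodule.subset_span ⟨k, hk, rfl⟩
      change E.repr (L k) i = 0
      by_cases hkE : L k ∈ Set.range E
      · obtain ⟨j, hj⟩ := hkE
        rw [← hj, Module.Basis.repr_self, Finsupp.single_apply, if_neg]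
        rintro rfl
        exact hcon (hj ▸ hmem)
      · exact Finsupp.notMem_support_iff.1 fun h => hi (hsupp k hkE h)
    exact this hx

theorem weaklyCompatible_translate {𝓜 : Set (Submodule ℂ V)} (h𝓜 : WeaklyCompatible E 𝓜)
    {g : V ≃ₗ[ℂ] V} (hg : g ∈ finitaryGL E) : WeaklyCompatible E (translate g 𝓜) := by
  obtain ⟨L, hfin, hL⟩ := h𝓜
  have hg' : {i | g (E i) ≠ E i}.Finite := hg
  refine ⟨L.map g, (hfin.union (hg'.image E)).subset ?_, ?_⟩
  · rintro _ ⟨⟨i, rfl⟩, hi⟩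
    by_cases h : g (E i) = E i
    · refine Or.inl ⟨⟨i, rfl⟩, ?_⟩
      rintro ⟨k, hk⟩
      exact hi ⟨k, by rw [Module.Basis.map_apply, hk, h]⟩
    · exact Or.inr ⟨i, h, rfl⟩
  · rintro _ ⟨F, hF, rfl⟩
    obtain ⟨s, rfl⟩ := hL F hF
    refine ⟨s, ?_⟩
    simp only
    rw [Submodule.map_span, ← Set.image_comp]
    rfl

/-- The part of `F` in the span of the `E i`, `i ∈ T`, in coordinates. -/
def res (E : Module.Basis I ℂ V) (T : Finset I) (F : Submodule ℂ V) : Submodule ℂ (T → ℂ) :=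
  F.comap (incl E T)

theorem Splits.coords_mem {F : Submodule ℂ V} (hF : Splits E T F) {x : V} (hx : x ∈ F) :
    coords E T x ∈ res E T F := hF.1 x hx

theorem Splits.sub_mem {F : Submodule ℂ V} (hF : Splits E T F) {x : V} (hx : x ∈ F) :
    x - incl E T (coords E T x) ∈ F := F.sub_mem hx (hF.1 x hx)

theorem Splits.res_map {F : Submodule ℂ V} (hF : Splits E T F) [DecidableEq I] (A : Matrix T T ℂ) :
    res E T (F.map (blockMap E T A)) = (res E T F).map (Matrix.toLin' A) := by
  ext y
  constructor
  · rintro ⟨x, hx, hxy⟩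
    refine ⟨coords E T x, hF.coords_mem hx, ?_⟩
    rw [Matrix.toLin'_apply, ← coords_blockMap, hxy, coords_incl]
  · rintro ⟨z, hz, rfl⟩
    exact ⟨incl E T z, hz, by rw [blockMap_incl, Matrix.toLin'_apply]⟩

/-- Block maps do not change the component outside `T`, and for a split `F` the components inside
and outside `T` can be chosen independently. -/
theorem Splits.map_le_of_res_le {F : Submodule ℂ V} (hF : Splits E T F) [DecidableEq I]
    {A B : Matrix T T ℂ}
    (h : (res E T F).map (Matrix.toLin' A) ≤ (res E T F).map (Matrix.toLin' B)) :
    F.map (blockMap E T A) ≤ F.map (blockMap E T B) := by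
  rintro _ ⟨x, hx, rfl⟩
  obtain ⟨z, hz, hz'⟩ := h ⟨_, hF.coords_mem hx, rfl⟩
  rw [Matrix.toLin'_apply, Matrix.toLin'_apply] at hz'
  refine ⟨x - incl E T (coords E T x) + incl E T z, F.add_mem (hF.sub_mem hx) hz, ?_⟩
  rw [blockMap_apply B, blockMap_apply A, map_add, map_sub, coords_incl, coords_incl, sub_self,
    zero_add, hz', add_sub_cancel_right]

theorem Splits.map_eq_of_res_eq {F : Submodule ℂ V} (hF : Splits E T F) [DecidableEq I]
    {A B : Matrix T T ℂ}
    (h : (res E T F).map (Matrix.toLin' A) = (res E T F).map (Matrix.toLin' B)) :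
    F.map (blockMap E T A) = F.map (blockMap E T B) :=
  le_antisymm (hF.map_le_of_res_le h.le) (hF.map_le_of_res_le h.ge)

theorem Splits.map {F : Submodule ℂ V} (hF : Splits E T F) (A : Matrix T T ℂ) :
    Splits E T (F.map (blockMap E T A)) := by
  classical
  constructor
  · rintro _ ⟨x, hx, rfl⟩
    rw [coords_blockMap, ← blockMap_incl]
    exact ⟨_, hF.1 x hx, rfl⟩
  · rintro _ ⟨x, hx, rfl⟩ i hi hxi
    refine ⟨E i, hF.2 x hx i hi ?_, blockMap_of_not_mem _ hi⟩
    rw [blockMap_apply, map_add, Finsupp.add_apply, repr_sub_incl_coords, if_neg hi, repr_incl,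
      dif_neg hi, add_zero] at hxi
    exact hxi

section Hermitian

variable [DecidableEq I] {h : V →ₗ[ℂ] V →ₛₗ[starRingEnd ℂ] ℂ} {s : I → ℂ}
  (hs : ∀ i, s i = 1 ∨ s i = -1)
  (hE : ∀ i j, h (E i) (E j) = if i = j then s i else 0)

include hE

theorem h_basis_left (i : I) (z : V) : h (E i) z = s i * conj (E.repr z i) := by
  conv_lhs => rw [← E.linearCombination_repr z]
  rw [Finsupp.linearCombination_apply, Finsupp.sum, map_sum]
  simp only [map_smulₛₗ, hE, smul_eq_mul]
  rw [Finset.sum_eq_single i]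
  · rw [if_pos rfl, mul_comm]
  · intro j _ hj
    rw [if_neg (Ne.symm hj), mul_zero]
  · intro hi
    rw [Finsupp.notMem_support_iff.1 hi, map_zero, zero_mul]

theorem h_incl_left (x : T → ℂ) (z : V) :
    h (incl E T x) z = diagForm (fun i : T => s i) x (coords E T z) := by
  rw [incl_apply, map_sum, LinearMap.sum_apply, diagForm_apply]
  refine Finset.sum_congr rfl fun i _ => ?_
  rw [map_smul, LinearMap.smul_apply, h_basis_left hE, coords_apply, smul_eq_mul]
  ring

include hs

theorem h_herm (x y : V) : h y x = conj (h x y) := by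
  have h1 : ∀ i, h y (E i) = s i * E.repr y i := by
    intro i
    have : h.flip (E i) = s i • E.coord i := by
      refine E.ext fun k => ?_
      rw [LinearMap.flip_apply, hE, LinearMap.smul_apply, Module.Basis.coord_apply,
        Module.Basis.repr_self, Finsupp.single_apply, smul_eq_mul, mul_ite, mul_one, mul_zero]
      split_ifs with hki
      · rw [hki]
      · rfl
    exact LinearMap.congr_fun this y
  rw [← E.linearCombination_repr x, Finsupp.linearCombination_apply, Finsupp.sum]
  simp only [map_sum, map_smulₛₗ, LinearMap.sum_apply, LinearMap.smul_apply, h1,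
    h_basis_left hE, smul_eq_mul, map_mul, Complex.conj_conj, conj_sign hs, RingHom.id_apply]

theorem h_incl_right (x : T → ℂ) (z : V) :
    h z (incl E T x) = diagForm (fun i : T => s i) (coords E T z) x := by
  rw [h_herm hs hE (incl E T x), h_incl_left hE, ← diagForm_herm fun i : T => hs i]

theorem h_decomp (x y : V) : h x y = diagForm (fun i : T => s i) (coords E T x) (coords E T y) +
    h (x - incl E T (coords E T x)) (y - incl E T (coords E T y)) := by
  simp only [map_sub, LinearMap.sub_apply, h_incl_left hE, h_incl_right hs hE, coords_incl]
  ring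

theorem h_blockMap {A : Matrix T T ℂ} (hA : stMap (fun i : T => s i) A * A = 1) (x y : V) :
    h (blockMap E T A x) (blockMap E T A y) = h x y := by
  rw [h_decomp hs hE (T := T), h_decomp hs hE (T := T) x y, blockMap_sub_incl, blockMap_sub_incl,
    coords_blockMap, coords_blockMap, diagForm_mulVec (fun i : T => hs i), Matrix.mulVec_mulVec, hA,
    Matrix.one_mulVec]

omit hs in
theorem mem_radical_of_mem_res {F : Submodule ℂ V} (hF : Splits E T F) {x : T → ℂ} :
    x ∈ radical (diagForm fun i : T => s i) (res E T F) ↔ incl E T x ∈ radical h F := by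
  constructor
  · rintro ⟨hx, hx'⟩
    refine ⟨hx, fun y hy => ?_⟩
    rw [h_incl_left hE]
    exact hx' _ (hF.coords_mem hy)
  · rintro ⟨hx, hx'⟩
    refine ⟨hx, fun y hy => ?_⟩
    have := hx' _ hy
    rwa [h_incl_left hE, coords_incl] at this

/-- If a radical vector had a nonzero coordinate at some `i ∉ T`, splitting would put `E i` into
`F`, and `h` pairs it nontrivially with that vector. Hence the radical lies in the span of `T` and
is finite dimensional. -/
theorem radical_eq_map {F : Submodule ℂ V} (hF : Splits E T F) :
    radical h F = (radical (diagForm fun i : T => s i) (res E T F)).map (incl E T) := by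
  ext x
  constructor
  · intro hx
    have h1 : (E.repr x).support ⊆ T := by
      intro i hi
      by_contra hiT
      have hi0 := Finsupp.mem_support_iff.1 hi
      have h2 := hx.2 _ (hF.2 x hx.1 i hiT hi0)
      rw [h_herm hs hE (E i), h_basis_left hE, map_mul, Complex.conj_conj, conj_sign hs,
        mul_eq_zero] at h2
      exact h2.elim (sign_ne_zero hs i) hi0
    refine ⟨coords E T x, ?_, incl_coords_of_support h1⟩
    change coords E T x ∈ radical _ _
    rwa [mem_radical_of_mem_res hE hF, incl_coords_of_support h1]
  · rintro ⟨y, hy, rfl⟩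
    exact (mem_radical_of_mem_res hE hF).1 hy

theorem finrank_radical_res {F : Submodule ℂ V} (hF : Splits E T F) :
    Module.finrank ℂ (radical (diagForm fun i : T => s i) (res E T F)) =
      Module.finrank ℂ (radical h F) := by
  rw [radical_eq_map hs hE hF]
  exact (Submodule.equivMapOfInjective _ incl_injective _).finrank_eq

theorem res_nondeg_iff {F : Submodule ℂ V} (hF : Splits E T F) :
    (∀ x ∈ res E T F, (∀ y ∈ res E T F, diagForm (fun i : T => s i) x y = 0) → x = 0) ↔
      ∀ x ∈ F, (∀ y ∈ F, h x y = 0) → x = 0 := by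
  have h1 := radical_eq_map hs hE hF
  constructor
  · intro H x hx hx'
    have h2 : x ∈ radical h F := ⟨hx, hx'⟩
    rw [h1] at h2
    obtain ⟨y, hy, rfl⟩ := h2
    rw [H y hy.1 hy.2, map_zero]
  · intro H x hx hx'
    have h2 : x ∈ radical (diagForm fun i : T => s i) (res E T F) := ⟨hx, hx'⟩
    rw [mem_radical_of_mem_res hE hF] at h2
    exact incl_injective ((H _ h2.1 h2.2).trans (map_zero _).symm)

end Hermitian

section Bilinear

variable [DecidableEq I] {b : V →ₗ[ℂ] V →ₗ[ℂ] ℂ} {s : I → ℂ} {ι : I → I} {β : I → ℂ} {σ η : ℂ}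
  (D : MonomialData s ι β σ η) (hb : ∀ i j, b (E i) (E j) = if j = ι i then β i else 0)
  (hT : ∀ i ∈ T, ι i ∈ T)

/-- The restriction of an involution to a stable finite set. -/
def resInv (hT : ∀ i ∈ T, ι i ∈ T) : T → T := fun i => ⟨ι i, hT i i.2⟩

omit [DecidableEq I] in
theorem MonomialData.restrict {s : I → ℂ} (D : MonomialData s ι β σ η) (hT : ∀ i ∈ T, ι i ∈ T) :
    MonomialData (fun i : T => s i) (resInv hT) (fun i : T => β i) σ η :=
  ⟨fun i => D.sq_s i, fun i => Subtype.ext (D.inv i), fun i => D.s_iota i, fun i => D.norm_beta i,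
    fun i => D.beta_iota i, D.sq_sigma, D.sq_eta⟩

include D hb

omit D in
theorem b_basis_left (i : I) (z : V) : b (E i) z = β i * E.repr z (ι i) := by
  conv_lhs => rw [← E.linearCombination_repr z]
  rw [Finsupp.linearCombination_apply, Finsupp.sum, map_sum]
  simp only [map_smul, hb, smul_eq_mul]
  rw [Finset.sum_eq_single (ι i)]
  · rw [if_pos rfl, mul_comm]
  · intro j _ hj
    rw [if_neg hj, mul_zero]
  · intro hi
    rw [Finsupp.notMem_support_iff.1 hi, zero_mul]

theorem b_symm (x y : V) : b y x = σ * b x y := by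
  have h1 : ∀ i, b y (E i) = β (ι i) * E.repr y (ι i) := by
    intro i
    have : b.flip (E i) = β (ι i) • E.coord (ι i) := by
      refine E.ext fun k => ?_
      rw [LinearMap.flip_apply, hb, LinearMap.smul_apply, Module.Basis.coord_apply,
        Module.Basis.repr_self, Finsupp.single_apply, smul_eq_mul, mul_ite, mul_one, mul_zero]
      have h2 : i = ι k ↔ k = ι i := ⟨fun e => by rw [e, D.inv], fun e => by rw [e, D.inv]⟩
      simp only [h2]
      split_ifs with hki
      · rw [hki]
      · rfl
    exact LinearMap.congr_fun this y
  rw [← E.linearCombination_repr x, Finsupp.linearCombination_apply, Finsupp.sum]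
  simp only [map_sum, map_smul, LinearMap.sum_apply, LinearMap.smul_apply, h1,
    b_basis_left hb, smul_eq_mul, D.beta_iota, Finset.mul_sum]
  exact Finset.sum_congr rfl fun i _ => by ring

omit D in
theorem b_incl_left (x : T → ℂ) (z : V) :
    b (incl E T x) z = monomialForm (resInv hT) (fun i : T => β i) x (coords E T z) := by
  rw [incl_apply, map_sum, LinearMap.sum_apply, monomialForm_apply]
  refine Finset.sum_congr rfl fun i _ => ?_
  rw [map_smul, LinearMap.smul_apply, b_basis_left hb, coords_apply, smul_eq_mul, resInv]
  ring

theorem b_incl_right (x : T → ℂ) (z : V) :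
    b z (incl E T x) = monomialForm (resInv hT) (fun i : T => β i) (coords E T z) x := by
  rw [b_symm D hb, b_incl_left hb hT, (D.restrict hT).formTriple.b_symm x]

theorem b_decomp (x y : V) : b x y =
    monomialForm (resInv hT) (fun i : T => β i) (coords E T x) (coords E T y) +
    b (x - incl E T (coords E T x)) (y - incl E T (coords E T y)) := by
  simp only [map_sub, LinearMap.sub_apply, b_incl_left hb hT, b_incl_right D hb hT, coords_incl]
  ring

theorem b_blockMap {A : Matrix T T ℂ}
    (hA : ∀ x y, monomialForm (resInv hT) (fun i : T => β i) (A.mulVec x) (A.mulVec y) =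
      monomialForm (resInv hT) (fun i : T => β i) x y) (x y : V) :
    b (blockMap E T A x) (blockMap E T A y) = b x y := by
  rw [b_decomp D hb hT, b_decomp D hb hT x y, blockMap_sub_incl, blockMap_sub_incl,
    coords_blockMap, coords_blockMap, hA]

omit D in
theorem monomialForm_of_b_blockMap {A : Matrix T T ℂ}
    (hA : ∀ x y, b (blockMap E T A x) (blockMap E T A y) = b x y) (x y : T → ℂ) :
    monomialForm (resInv hT) (fun i : T => β i) (A.mulVec x) (A.mulVec y) =
      monomialForm (resInv hT) (fun i : T => β i) x y := by
  have := hA (incl E T x) (incl E T y)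
  rwa [blockMap_incl, blockMap_incl, b_incl_left hb hT, b_incl_left hb hT, coords_incl,
    coords_incl] at this

-- `b` pairs the coordinate at `i` with that at `ι i`. Stability of `T` under `ι` keeps coordinates
-- inside `T` paired with each other, and likewise those outside.
include hT in
theorem Splits.perp {F : Submodule ℂ V} (hF : Splits E T F) : Splits E T (perp b F) := by
  constructor
  · intro x hx y hy
    rw [b_incl_left hb hT, ← b_incl_right D hb hT]
    exact hx _ (hF.1 y hy)
  · intro x hx i hi hxi y hy
    rw [b_basis_left hb, mul_eq_zero]
    right
    by_contra hne
    have hιi : ι i ∉ T := fun h => hi (by rw [← D.inv i]; exact hT _ h)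
    have h1 := hx _ (hF.2 y hy _ hιi hne)
    rw [b_symm D hb (E (ι i)), b_basis_left hb, D.inv] at h1
    have hσ : σ ≠ 0 := by rcases D.sq_sigma with h | h <;> simp [h]
    simp [hσ, D.beta_ne, hxi] at h1

omit D in
theorem Splits.res_perp {F : Submodule ℂ V} (hF : Splits E T F) :
    res E T (OpenOrbits.perp b F) =
      OpenOrbits.perp (monomialForm (resInv hT) (fun i : T => β i)) (res E T F) := by
  ext x
  constructor
  · intro hx y hy
    have := hx _ hy
    rwa [b_incl_left hb hT, coords_incl] at this
  · intro hx y hy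
    rw [b_incl_left hb hT]
    exact hx _ (hF.coords_mem hy)

end Bilinear

end Blocks

/-! ### Translates of generalized flags and commensurability -/

section FlagLemmas

variable {I V : Type} [AddCommGroup V] [Module ℂ V]

theorem translate_mul (g k : V ≃ₗ[ℂ] V) (𝓕 : Set (Submodule ℂ V)) :
    translate g (translate k 𝓕) = translate (g * k) 𝓕 := by
  rw [translate, translate, translate, ← Set.image_comp]
  congr 1
  funext F
  exact (Submodule.map_comp _ _ _).symm

theorem translate_one (𝓕 : Set (Submodule ℂ V)) : translate (1 : V ≃ₗ[ℂ] V) 𝓕 = 𝓕 := by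
  rw [translate]
  convert Set.image_id 𝓕 using 2
  exact Submodule.map_id _

theorem map_le_map_equiv (g : V ≃ₗ[ℂ] V) {F G : Submodule ℂ V} :
    F.map (g : V →ₗ[ℂ] V) ≤ G.map (g : V →ₗ[ℂ] V) ↔ F ≤ G :=
  Submodule.map_le_map_iff_of_injective g.injective F G

theorem map_lt_map_equiv (g : V ≃ₗ[ℂ] V) {F G : Submodule ℂ V} :
    F.map (g : V →ₗ[ℂ] V) < G.map (g : V →ₗ[ℂ] V) ↔ F < G := by
  rw [lt_iff_le_not_ge, lt_iff_le_not_ge, map_le_map_equiv, map_le_map_equiv]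

theorem isChain_translate {𝓕 : Set (Submodule ℂ V)} (h : IsChain (· ≤ ·) 𝓕) (g : V ≃ₗ[ℂ] V) :
    IsChain (· ≤ ·) (translate g 𝓕) := by
  rintro _ ⟨F, hF, rfl⟩ _ ⟨G, hG, rfl⟩ -
  exact (h.total hF hG).imp (map_le_map_equiv g).2 (map_le_map_equiv g).2

theorem immSucc_translate {𝓕 : Set (Submodule ℂ V)} {F G : Submodule ℂ V} (h : ImmSucc 𝓕 F G)
    (g : V ≃ₗ[ℂ] V) :
    ImmSucc (translate g 𝓕) (F.map (g : V →ₗ[ℂ] V)) (G.map (g : V →ₗ[ℂ] V)) := by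
  obtain ⟨h1, h2, h3, h4⟩ := h
  refine ⟨⟨F, h1, rfl⟩, ⟨G, h2, rfl⟩, (map_lt_map_equiv g).2 h3, ?_⟩
  rintro _ ⟨K, hK, rfl⟩ ⟨h5, h6⟩
  exact h4 K hK ⟨(map_lt_map_equiv g).1 h5, (map_lt_map_equiv g).1 h6⟩

theorem isGeneralizedFlag_translate {𝓕 : Set (Submodule ℂ V)} (h : IsGeneralizedFlag 𝓕)
    (g : V ≃ₗ[ℂ] V) : IsGeneralizedFlag (translate g 𝓕) := by
  refine ⟨isChain_translate h.chain g, ?_, ?_⟩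
  · rintro _ ⟨F, hF, rfl⟩
    rcases h.neighbour F hF with ⟨G, hG⟩ | ⟨G, hG⟩
    · exact Or.inl ⟨_, immSucc_translate hG g⟩
    · exact Or.inr ⟨_, immSucc_translate hG g⟩
  · intro v hv
    obtain ⟨F, G, hFG, hG, hF⟩ := h.cover (g.symm v) (by simpa using hv)
    refine ⟨_, _, immSucc_translate hFG g, ⟨_, hG, g.apply_symm_apply v⟩, ?_⟩
    rintro ⟨x, hx, hxv⟩
    apply hF
    rw [← hxv]
    simpa using hx

theorem isIsotropic_translate {b : V →ₗ[ℂ] V →ₗ[ℂ] ℂ} {𝓕 : Set (Submodule ℂ V)}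
    (h : IsIsotropic b 𝓕) {g : V ≃ₗ[ℂ] V} (hg : g ∈ preserveBilin b) :
    IsIsotropic b (translate g 𝓕) := by
  have hg' : ∀ v w, b (g v) (g w) = b v w := hg
  rintro _ ⟨F, hF, rfl⟩ _ ⟨G, hG, rfl⟩
  rcases h F hF G hG with h1 | h1
  · left
    rintro _ ⟨v, hv, rfl⟩ _ ⟨w, hw, rfl⟩
    exact (hg' v w).trans (h1 v hv w hw)
  · right
    intro v hv
    refine ⟨g.symm v, h1 _ fun w hw => ?_, g.apply_symm_apply v⟩
    rw [← hg', g.apply_symm_apply]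
    exact hv _ ⟨w, hw, rfl⟩

theorem isNondegenerate_translate {h : V →ₗ[ℂ] V →ₛₗ[starRingEnd ℂ] ℂ} {𝓕 : Set (Submodule ℂ V)}
    (hF : IsNondegenerate h 𝓕) {g : V ≃ₗ[ℂ] V} (hg : g ∈ preserveHerm h) :
    IsNondegenerate h (translate g 𝓕) := by
  have hg' : ∀ v w, h (g v) (g w) = h v w := hg
  rintro _ ⟨F, hF', rfl⟩ _ ⟨v, hv, rfl⟩ hvw
  have : v = 0 := hF F hF' v hv fun w hw => (hg' v w).symm.trans (hvw _ ⟨w, hw, rfl⟩)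
  rw [this, map_zero]

/-- By the modular law the dimension of `(K ⊔ U) ⊓ U'` is `dim (K ⊓ U') + dim U - dim (K ⊓ U)`, and
`F ⊔ U = G ⊔ U`. So the finite dimensional space that witnesses commensurability may be enlarged. -/
theorem finrank_inf_eq_of_le {F G U U' : Submodule ℂ V} [FiniteDimensional ℂ U'] (hU : U ≤ U')
    (h1 : F ≤ G ⊔ U) (h2 : G ≤ F ⊔ U)
    (h3 : Module.finrank ℂ ↥(F ⊓ U) = Module.finrank ℂ ↥(G ⊓ U)) :
    Module.finrank ℂ ↥(F ⊓ U') = Module.finrank ℂ ↥(G ⊓ U') := by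
  have : FiniteDimensional ℂ U := Submodule.finiteDimensional_of_le hU
  have hfd : ∀ K : Submodule ℂ V, FiniteDimensional ℂ ↥(K ⊓ U') := fun K =>
    Submodule.finiteDimensional_of_le inf_le_right
  have key : ∀ K : Submodule ℂ V, Module.finrank ℂ ↥((K ⊔ U) ⊓ U') + Module.finrank ℂ ↥(K ⊓ U) =
      Module.finrank ℂ ↥(K ⊓ U') + Module.finrank ℂ U := by
    intro K
    have := hfd K
    have h4 := Submodule.finrank_sup_add_finrank_inf_eq (K ⊓ U') U
    have h5 : K ⊓ U' ⊔ U = (K ⊔ U) ⊓ U' := by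
      rw [sup_comm, sup_comm K, sup_inf_assoc_of_le _ hU]
    rw [h5, inf_assoc, inf_eq_right.2 hU] at h4
    exact h4
  have h4 : F ⊔ U = G ⊔ U :=
    le_antisymm (sup_le h1 le_sup_right) (sup_le h2 le_sup_right)
  have h5 := key F
  have h6 := key G
  rw [h4] at h5
  omega

theorem SupportedIn.sub_mem_span {E : Module.Basis I ℂ V} {T : Finset I} {g : V ≃ₗ[ℂ] V}
    (hg : SupportedIn E T g) (x : V) : g x - x ∈ Submodule.span ℂ (E '' (T : Set I)) := by
  rw [span_image_eq_range_incl, hg.apply, blockMap_apply]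
  refine ⟨(blockMatrix E T g).mulVec (coords E T x) - coords E T x, ?_⟩
  rw [map_sub]
  abel

/-- `g` changes each vector by an element of the span of some finite `T`. Adding this span to `U`
gives a `g`-stable witness. -/
theorem commensurable_translate {E : Module.Basis I ℂ V} {𝓕 𝓖 : Set (Submodule ℂ V)}
    (h : Commensurable E 𝓕 𝓖) {g : V ≃ₗ[ℂ] V} (hg : g ∈ finitaryGL E) :
    Commensurable E 𝓕 (translate g 𝓖) := by
  obtain ⟨hF, hG, φ, U, hU, hφ⟩ := h
  obtain ⟨T, hT⟩ := exists_supportedIn hg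
  have hgT := hT T le_rfl
  refine ⟨hF, weaklyCompatible_translate hG hg, φ.trans (Equiv.Set.image _ 𝓖
    (Submodule.map_injective_of_injective g.injective)),
    U ⊔ Submodule.span ℂ (E '' (T : Set I)), ?_, ?_⟩
  · have : FiniteDimensional ℂ (Submodule.span ℂ (E '' (T : Set I))) :=
      FiniteDimensional.span_of_finite ℂ (T.finite_toSet.image E)
    infer_instance
  · intro F
    set U' := U ⊔ Submodule.span ℂ (E '' (T : Set I)) with hU'
    have hfd : FiniteDimensional ℂ (Submodule.span ℂ (E '' (T : Set I))) :=
      FiniteDimensional.span_of_finite ℂ (T.finite_toSet.image E)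
    have hfd' : FiniteDimensional ℂ U' := by rw [hU']; infer_instance
    obtain ⟨h1, h2, h3⟩ := hφ F
    set K := (φ F : Submodule ℂ V) with hK
    have hval : (((φ.trans (Equiv.Set.image _ 𝓖
      (Submodule.map_injective_of_injective g.injective))) F :
        (fun F : Submodule ℂ V => F.map (g : V →ₗ[ℂ] V)) '' 𝓖) : Submodule ℂ V) =
        K.map (g : V →ₗ[ℂ] V) := rfl
    have hsub : ∀ x, g x - x ∈ U' := fun x => Submodule.mem_sup_right (hgT.sub_mem_span x)
    have hKg : K ≤ K.map (g : V →ₗ[ℂ] V) ⊔ U' := by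
      intro x hx
      have : x = g x + -(g x - x) := by abel
      rw [this]
      exact Submodule.add_mem_sup ⟨x, hx, rfl⟩ (U'.neg_mem (hsub x))
    have hgK : K.map (g : V →ₗ[ℂ] V) ≤ K ⊔ U' := by
      rintro _ ⟨x, hx, rfl⟩
      have : g x = x + (g x - x) := by abel
      exact (this : (g : V →ₗ[ℂ] V) x = _) ▸ Submodule.add_mem_sup hx (hsub x)
    have hUU : U ≤ U' := le_sup_left
    have hgU : U'.map (g : V →ₗ[ℂ] V) = U' := by
      refine Submodule.eq_of_le_of_finrank_eq ?_ (LinearEquiv.finrank_map_eq g U')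
      rintro _ ⟨x, hx, rfl⟩
      have : g x = x + (g x - x) := by abel
      exact (this : (g : V →ₗ[ℂ] V) x = _) ▸ U'.add_mem hx (hsub x)
    refine ⟨?_, ?_, ?_⟩
    · exact h1.trans (sup_le hKg (hUU.trans le_sup_right))
    · exact hgK.trans (sup_le (h2.trans (sup_le le_sup_left (hUU.trans le_sup_right)))
        le_sup_right)
    · refine (finrank_inf_eq_of_le hUU h1 h2 h3).trans ?_
      change _ = Module.finrank ℂ ↥(K.map (g : V →ₗ[ℂ] V) ⊓ U')
      rw [← LinearEquiv.finrank_map_eq g (K ⊓ U')]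
      have : (K ⊓ U').map (g : V →ₗ[ℂ] V) = K.map (g : V →ₗ[ℂ] V) ⊓ U' := by
        rw [Submodule.map_inf _ g.injective, hgU]
      rw [← this]

theorem finrank_res {E : Module.Basis I ℂ V} {T : Finset I} (F : Submodule ℂ V) :
    Module.finrank ℂ (res E T F) =
      Module.finrank ℂ ↥(F ⊓ Submodule.span ℂ (E '' (T : Set I))) := by
  rw [span_image_eq_range_incl, inf_comm, ← Submodule.map_comap_eq]
  exact (Submodule.equivMapOfInjective _ incl_injective _).finrank_eq

/-- Corresponding members of commensurable flags have the same dimension at a large finite level. -/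
theorem exists_finrank_res_eq {E : Module.Basis I ℂ V} {𝓕 𝓖 : Set (Submodule ℂ V)}
    (h : Commensurable E 𝓕 𝓖) : ∃ T₀ : Finset I, ∀ G ∈ 𝓖, ∃ F ∈ 𝓕, ∀ T, T₀ ⊆ T →
      Module.finrank ℂ (res E T F) = Module.finrank ℂ (res E T G) := by
  classical
  obtain ⟨-, -, φ, U, hU, hφ⟩ := h
  obtain ⟨S, hS⟩ := (Submodule.fg_iff_finiteDimensional U).2 hU
  refine ⟨S.biUnion fun x => (E.repr x).support, fun G hG => ⟨φ.symm ⟨G, hG⟩, Subtype.mem _, ?_⟩⟩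
  intro T hT
  have hUT : U ≤ Submodule.span ℂ (E '' (T : Set I)) := by
    rw [← hS, Submodule.span_le]
    intro x hx
    rw [span_image_eq_range_incl]
    exact ⟨_, incl_coords_of_support fun i hi => hT (Finset.mem_biUnion.2 ⟨x, hx, hi⟩)⟩
  have hfd : FiniteDimensional ℂ (Submodule.span ℂ (E '' (T : Set I))) :=
    FiniteDimensional.span_of_finite ℂ (T.finite_toSet.image E)
  obtain ⟨h1, h2, h3⟩ := hφ (φ.symm ⟨G, hG⟩)
  rw [φ.apply_symm_apply] at h1 h2 h3
  rw [finrank_res, finrank_res]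
  exact finrank_inf_eq_of_le hUT h1 h2 h3

/-- A finitary transformation that maps a member of a weakly compatible chain to a member of this chain
fixes it. -/
theorem map_eq_self_of_mem_chain {E : Module.Basis I ℂ V} {𝓜 : Set (Submodule ℂ V)}
    (hC : IsChain (· ≤ ·) 𝓜) (hW : WeaklyCompatible E 𝓜) {g : V ≃ₗ[ℂ] V} (hg : g ∈ finitaryGL E)
    {F : Submodule ℂ V} (hF : F ∈ 𝓜) (hgF : F.map (g : V →ₗ[ℂ] V) ∈ 𝓜) :
    F.map (g : V →ₗ[ℂ] V) = F := by
  classical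
  obtain ⟨T₁, hT₁⟩ := exists_splits hW
  obtain ⟨T₂, hT₂⟩ := exists_supportedIn hg
  set T := T₁ ∪ T₂
  have hs := hT₁ T Finset.subset_union_left
  have hgT := hT₂ T Finset.subset_union_right
  have hsF := hs F hF
  have hsF' := hs _ hgF
  have hres : Module.finrank ℂ (res E T (F.map (g : V →ₗ[ℂ] V))) =
      Module.finrank ℂ (res E T F) := by
    rw [hgT.eq_blockMap, hsF.res_map]
    have hinj : Function.Injective (Matrix.toLin' (blockMatrix E T g)) := by
      have := Matrix.mulVec_injective_iff_isUnit.2 hgT.isUnit_blockMatrix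
      exact fun x y hxy => this (by simpa only [Matrix.toLin'_apply] using hxy)
    exact (Submodule.equivMapOfInjective _ hinj _).finrank_eq.symm
  -- Both subspaces belong to the chain, so their finite parts are comparable; having equal
  -- dimension, they coincide.
  have heq : res E T (F.map (g : V →ₗ[ℂ] V)) = res E T F := by
    rcases hC.total hF hgF with h | h
    · exact (Submodule.eq_of_le_of_finrank_eq (Submodule.comap_mono h) hres.symm).symm
    · exact Submodule.eq_of_le_of_finrank_eq (Submodule.comap_mono h) hres
  have hrest : ∀ x, g x - incl E T (coords E T (g x)) = x - incl E T (coords E T x) := by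
    intro x
    rw [hgT.apply, blockMap_sub_incl]
  apply le_antisymm
  · rintro _ ⟨x, hx, rfl⟩
    have h1 : coords E T (g x) ∈ res E T F := heq ▸ hsF'.coords_mem ⟨x, hx, rfl⟩
    have h2 : g x = (x - incl E T (coords E T x)) + incl E T (coords E T (g x)) := by
      rw [← hrest, sub_add_cancel]
    exact (h2 : (g : V →ₗ[ℂ] V) x = _) ▸ F.add_mem (hsF.sub_mem hx) h1
  · intro x hx
    have h1 : coords E T x ∈ res E T (F.map (g : V →ₗ[ℂ] V)) := heq ▸ hsF.coords_mem hx
    have h2 : x = (g x - incl E T (coords E T (g x))) + incl E T (coords E T x) := by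
      rw [hrest, sub_add_cancel]
    rw [h2]
    exact Submodule.add_mem _ (hsF'.sub_mem ⟨x, hx, rfl⟩) h1

end FlagLemmas

/-! ### Neighbourhoods of the identity in the direct limit topology -/

section LimTopology

variable {I V : Type} [AddCommGroup V] [Module ℂ V] {E : Module.Basis I ℂ V}
  {H : Subgroup (V ≃ₗ[ℂ] V)}

theorem continuous_submatrix_mul (T : Finset I) (B : Matrix T T ℂ) :
    Continuous fun m : I → I → ℂ => (Matrix.of fun i j : T => m i j) * B := by
  have : Continuous fun m : I → I → ℂ => (Matrix.of fun i j : T => m i j : Matrix T T ℂ) :=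
    continuous_pi fun i => continuous_pi fun j => (continuous_apply (j : I)).comp
      (continuous_apply (i : I))
  exact this.matrix_mul continuous_const

/-- Elements of the group of `S` near `g₀` are `u * g₀` with `u` near the identity. The block `T`
may be larger than `S` and may depend on `g₀`, which leaves room to split flags along `T`. -/
theorem isOpen_limTopology [DecidableEq I] {A : Set H}
    (hA : ∀ g₀ ∈ A, ∀ S : Finset I, ∃ T, S ⊆ T ∧ ∃ O ∈ 𝓝 (1 : Matrix T T ℂ), ∀ u : H,
      SupportedIn E T (u : V ≃ₗ[ℂ] V) → blockMatrix E T (u : V ≃ₗ[ℂ] V) ∈ O → u * g₀ ∈ A) :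
    IsOpen[limTopology E H] A := by
  rw [isOpen_iSup_iff]
  intro S
  rw [isOpen_coinduced]
  let m : {g : H // SupportedIn E S (g : V ≃ₗ[ℂ] V)} → I → I → ℂ :=
    fun g i j => E.repr ((g.1 : V ≃ₗ[ℂ] V) (E j)) i
  let _ : TopologicalSpace {g : H // SupportedIn E S (g : V ≃ₗ[ℂ] V)} :=
    TopologicalSpace.induced m inferInstance
  change IsOpen _
  rw [isOpen_iff_mem_nhds]
  rintro ⟨g₀, hg₀S⟩ hg₀
  obtain ⟨T, hST, O, hO, hOA⟩ := hA g₀ hg₀ S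
  have hg₀T := hg₀S.mono hST
  let f : (I → I → ℂ) → Matrix T T ℂ := fun m =>
    (Matrix.of fun i j : T => m i j) * blockMatrix E T ((g₀ : V ≃ₗ[ℂ] V)⁻¹)
  have hf : Continuous f := continuous_submatrix_mul T _
  have hfm : ∀ g : {g : H // SupportedIn E S (g : V ≃ₗ[ℂ] V)},
      f (m g) = blockMatrix E T ((g.1 * g₀⁻¹ : H) : V ≃ₗ[ℂ] V) := by
    intro g
    rw [Subgroup.coe_mul, Subgroup.coe_inv, (g.2.mono hST).blockMatrix_mul hg₀T.inv]
    rfl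
  have hf1 : f (m ⟨g₀, hg₀S⟩) = 1 := by
    rw [hfm, mul_inv_cancel, Subgroup.coe_one, blockMatrix_one]
  have hcont : Continuous fun g => f (m g) := hf.comp continuous_induced_dom
  have hnh := hcont.continuousAt (x := ⟨g₀, hg₀S⟩)
  rw [ContinuousAt, hf1] at hnh
  filter_upwards [hnh hO] with g hg
  have h1 := hOA (g.1 * g₀⁻¹) ?_ ?_
  · rw [inv_mul_cancel_right] at h1
    exact h1
  · rw [Subgroup.coe_mul, Subgroup.coe_inv]
    exact (g.2.mono hST).mul hg₀T.inv
  · rw [← hfm]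
    exact hg

theorem exists_nhds_of_isOpen_limTopology [DecidableEq I] {A : Set H}
    (hA : IsOpen[limTopology E H] A) (h1 : (1 : H) ∈ A) (T : Finset I) :
    ∃ O ∈ 𝓝 (1 : Matrix T T ℂ), ∀ u : H, SupportedIn E T (u : V ≃ₗ[ℂ] V) →
      blockMatrix E T (u : V ≃ₗ[ℂ] V) ∈ O → u ∈ A := by
  rw [isOpen_iSup_iff] at hA
  have hA' := hA T
  rw [isOpen_coinduced, isOpen_induced_iff] at hA'
  obtain ⟨W, hW, hWA⟩ := hA'
  -- Extension by the identity recovers all matrix entries of an element supported in `T` from its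
  -- block.
  let e : Matrix T T ℂ → I → I → ℂ := fun M i j =>
    if h : i ∈ T ∧ j ∈ T then M ⟨i, h.1⟩ ⟨j, h.2⟩ else if i = j then 1 else 0
  have he : Continuous e := by
    refine continuous_pi fun i => continuous_pi fun j => ?_
    simp only [e]
    split_ifs
    · exact (continuous_apply _).comp (continuous_apply _)
    · exact continuous_const
    · exact continuous_const
  have hem : ∀ u : H, SupportedIn E T (u : V ≃ₗ[ℂ] V) →
      e (blockMatrix E T (u : V ≃ₗ[ℂ] V)) = fun i j => E.repr ((u : V ≃ₗ[ℂ] V) (E j)) i := by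
    intro u hu
    funext i j
    simp only [e]
    split_ifs with h2 h3
    · rfl
    · subst h3
      have h4 : i ∉ T := fun h => h2 ⟨h, h⟩
      rw [hu.1 i h4, Module.Basis.repr_self, Finsupp.single_eq_same]
    · by_cases hj : j ∈ T
      · have hi : i ∉ T := fun h => h2 ⟨h, hj⟩
        have h4 := hu.2 j hj
        rw [span_image_eq_range_incl] at h4
        obtain ⟨y, hy⟩ := h4
        rw [← hy, repr_incl, dif_neg hi]
      · rw [hu.1 j hj, Module.Basis.repr_self, Finsupp.single_apply, if_neg (Ne.symm h3)]
  have key : ∀ u : H, SupportedIn E T (u : V ≃ₗ[ℂ] V) →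
      (e (blockMatrix E T (u : V ≃ₗ[ℂ] V)) ∈ W ↔ u ∈ A) := by
    intro u hu
    rw [hem u hu]
    exact Set.ext_iff.1 hWA ⟨u, hu⟩
  refine ⟨e ⁻¹' W, ?_, fun u hu huO => (key u hu).1 huO⟩
  refine (hW.preimage he).mem_nhds ?_
  have := (key 1 supportedIn_one).2 h1
  rwa [Subgroup.coe_one, blockMatrix_one] at this

/-- The inclusion of the elements supported in `T` is continuous. -/
theorem continuous_limTopology_of_entries {X : Type*} [TopologicalSpace X] (T : Finset I) (f : X → H)
    (hf : ∀ x, SupportedIn E T (f x : V ≃ₗ[ℂ] V))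
    (hc : ∀ i j, Continuous fun x => E.repr ((f x : V ≃ₗ[ℂ] V) (E j)) i) :
    @Continuous X H _ (limTopology E H) f := by
  let t : TopologicalSpace {g : H // SupportedIn E T (g : V ≃ₗ[ℂ] V)} :=
    TopologicalSpace.induced (fun g (i j : I) => E.repr ((g.1 : V ≃ₗ[ℂ] V) (E j)) i) inferInstance
  have h1 : Continuous (fun x => (⟨f x, hf x⟩ : {g : H // SupportedIn E T (g : V ≃ₗ[ℂ] V)})) := by
    rw [continuous_induced_rng]
    exact continuous_pi fun i => continuous_pi fun j => hc i j
  have h2 : @Continuous _ H t (limTopology E H)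
      (Subtype.val : {g : H // SupportedIn E T (g : V ≃ₗ[ℂ] V)} → H) := by
    rw [continuous_iff_coinduced_le]
    exact le_iSup (fun S : Finset I => TopologicalSpace.coinduced
      (Subtype.val : {g : H // SupportedIn E S (g : V ≃ₗ[ℂ] V)} → H)
      (TopologicalSpace.induced
        (fun g (i j : I) => E.repr ((g.1 : V ≃ₗ[ℂ] V) (E j)) i)
        (inferInstance : TopologicalSpace (I → I → ℂ)))) T
  exact @Continuous.comp _ _ _ _ t (limTopology E H) _ _ h2 h1

theorem continuous_mul_right_limTopology {k : H} (hk : (k : V ≃ₗ[ℂ] V) ∈ finitaryGL E) :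
    @Continuous H H (limTopology E H) (limTopology E H) fun g => g * k := by
  classical
  rw [continuous_iSup_dom]
  intro S
  rw [continuous_coinduced_dom]
  obtain ⟨T, hT⟩ := exists_supportedIn hk
  let t : TopologicalSpace {g : H // SupportedIn E S (g : V ≃ₗ[ℂ] V)} :=
    TopologicalSpace.induced (fun g (i j : I) => E.repr ((g.1 : V ≃ₗ[ℂ] V) (E j)) i) inferInstance
  have hent : ∀ i j, Continuous fun g : {g : H // SupportedIn E S (g : V ≃ₗ[ℂ] V)} =>
      E.repr ((g.1 : V ≃ₗ[ℂ] V) (E j)) i := by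
    have h0 : Continuous fun (g : {g : H // SupportedIn E S (g : V ≃ₗ[ℂ] V)}) (i j : I) =>
        E.repr ((g.1 : V ≃ₗ[ℂ] V) (E j)) i := continuous_induced_dom
    exact fun i j => continuous_pi_iff.1 (continuous_pi_iff.1 h0 i) j
  refine continuous_limTopology_of_entries (T ∪ S) _ (fun g => ?_) fun i j => ?_
  · exact (g.2.mono Finset.subset_union_right).mul (hT _ Finset.subset_union_left)
  · have : ∀ g : {g : H // SupportedIn E S (g : V ≃ₗ[ℂ] V)},
        E.repr (((g.1 * k : H) : V ≃ₗ[ℂ] V) (E j)) i =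
        ∑ l ∈ (E.repr ((k : V ≃ₗ[ℂ] V) (E j))).support,
          E.repr ((k : V ≃ₗ[ℂ] V) (E j)) l * E.repr ((g.1 : V ≃ₗ[ℂ] V) (E l)) i := by
      intro g
      rw [Subgroup.coe_mul, LinearEquiv.mul_apply]
      conv_lhs => rw [← E.linearCombination_repr ((k : V ≃ₗ[ℂ] V) (E j))]
      rw [Finsupp.linearCombination_apply, Finsupp.sum, map_sum, map_sum, Finsupp.finsetSum_apply]
      simp only [map_smul, Finsupp.smul_apply, smul_eq_mul]
    exact (continuous_finsetSum _ fun l _ => continuous_const.mul (hent i l)).congr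
      fun g => (this g).symm

end LimTopology

/-! ### Orthogonal spaces for the bilinear form -/

section Perp

variable {W : Type*} [AddCommGroup W] [Module ℂ W]

theorem perp_antitone {b : W →ₗ[ℂ] W →ₗ[ℂ] ℂ} {F G : Submodule ℂ W} (h : F ≤ G) :
    perp b G ≤ perp b F := fun _ hx y hy => hx y (h hy)

theorem isChain_perp {b : W →ₗ[ℂ] W →ₗ[ℂ] ℂ} {C : Set (Submodule ℂ W)}
    (hC : IsChain (· ≤ ·) C) (hb : ∀ F ∈ C, ∀ G ∈ C, F ≤ perp b G ∨ perp b G ≤ F) :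
    IsChain (· ≤ ·) (C ∪ perp b '' C) := by
  rintro F hF G hG -
  rcases hF with hF | ⟨F, hF, rfl⟩ <;> rcases hG with hG | ⟨G, hG, rfl⟩
  · exact hC.total hF hG
  · exact hb F hF G hG
  · exact (hb G hG F hF).symm
  · exact (hC.total hG hF).imp perp_antitone perp_antitone

theorem perp_map_equiv {b : W →ₗ[ℂ] W →ₗ[ℂ] ℂ} {g : W ≃ₗ[ℂ] W} (hg : ∀ x y, b (g x) (g y) = b x y)
    (F : Submodule ℂ W) :
    perp b (F.map (g : W →ₗ[ℂ] W)) = (perp b F).map (g : W →ₗ[ℂ] W) := by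
  ext x
  constructor
  · intro hx
    refine ⟨g.symm x, fun y hy => ?_, g.apply_symm_apply x⟩
    rw [← hg, g.apply_symm_apply]
    exact hx _ ⟨y, hy, rfl⟩
  · rintro ⟨y, hy, rfl⟩ _ ⟨z, hz, rfl⟩
    exact (hg y z).trans (hy z hz)

namespace FormTriple

variable {h : W →ₗ[ℂ] W →ₛₗ[starRingEnd ℂ] ℂ} {b : W →ₗ[ℂ] W →ₗ[ℂ] ℂ}
  {τ : W →ₛₗ[starRingEnd ℂ] W} {σ η : ℂ} (H : FormTriple h b τ σ η) {F : Submodule ℂ W}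

include H

theorem tau_mem_perp {n : W} (hn : ∀ y ∈ F, h n y = 0) : τ n ∈ perp b F := by
  intro y hy
  rw [H.b_symm y, ← H.h_eq, H.h_eq_zero_comm.1 (hn y hy), mul_zero]

/-- Every vector is a sum of one in `τ F` and one in `perp b F`, the latter being `τ` of a vector
`h`-orthogonal to `F`. A vector of `perp b F` is `h`-orthogonal to `τ F`, so one in the radical of
`perp b F` is orthogonal to everything. -/
theorem perp_nondeg [FiniteDimensional ℂ W] (hF : ∀ x ∈ F, (∀ y ∈ F, h x y = 0) → x = 0) :
    ∀ x ∈ perp b F, (∀ y ∈ perp b F, h x y = 0) → x = 0 := by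
  intro x hx hx'
  refine H.nondeg x fun z => ?_
  obtain ⟨f, hf, hn⟩ := exists_orthogonal_projection F hF ((η * σ) • τ z)
  have hz : z = τ f + τ ((η * σ) • τ z - f) := by
    rw [← map_add, add_sub_cancel, map_smulₛₗ, H.sign_conj, H.tau_tau, smul_smul, H.sign_sq,
      one_smul]
  rw [hz, map_add, H.h_tau, hx f hf, hx' _ (H.tau_mem_perp hn), mul_zero, add_zero]

theorem perp_perp [FiniteDimensional ℂ W] (hF : ∀ x ∈ F, (∀ y ∈ F, h x y = 0) → x = 0) : perp b (perp b F) = F := by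
  refine le_antisymm (fun x hx => ?_) fun x hx y hy => H.b_eq_zero_comm.1 (hy x hx)
  obtain ⟨f, hf, hn⟩ := exists_orthogonal_projection F hF x
  suffices hxf : x - f = 0 by rwa [sub_eq_zero.1 hxf]
  refine H.nondeg _ fun z => ?_
  obtain ⟨f', hf', hn'⟩ := exists_orthogonal_projection F hF z
  have h1 := hx _ (H.tau_mem_perp hn')
  rw [← H.h_eq] at h1
  rw [← add_sub_cancel f' z, map_add, hn _ hf', LinearMap.map_sub₂, h1,
    H.h_eq_zero_comm.1 (hn' f hf), sub_zero, add_zero]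

theorem finrank_perp [FiniteDimensional ℂ W] (F : Submodule ℂ W) :
    Module.finrank ℂ (perp b F) + Module.finrank ℂ F = Module.finrank ℂ W := by
  have hnd : LinearMap.BilinForm.Nondegenerate b := by
    have h1 : ∀ x, (∀ y, b x y = 0) → x = 0 := fun x hx =>
      H.nondeg x fun y => by rw [H.h_eq, hx]
    exact ⟨h1, fun x hx => h1 x fun y => H.b_eq_zero_comm.1 (hx y)⟩
  have h1 := LinearMap.BilinForm.finrank_orthogonal hnd F
  have h2 : LinearMap.BilinForm.orthogonal b F = perp b F := by
    ext x
    rw [LinearMap.BilinForm.mem_orthogonal_iff, mem_perp]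
    exact forall₂_congr fun y _ => H.b_eq_zero_comm
  rw [h2] at h1
  have := Submodule.finrank_le F
  omega

end FormTriple

end Perp

/-! ### Determinants of unitary matrices -/

section Det

variable {κ : Type*} [Fintype κ] [DecidableEq κ] {s : κ → ℂ}

theorem det_conj_map (A : Matrix κ κ ℂ) :
    (Matrix.of fun i j => conj (A i j)).det = conj A.det := by
  rw [RingHom.map_det]
  rfl

theorem det_stMap (hs : ∀ i, s i = 1 ∨ s i = -1) (A : Matrix κ κ ℂ) :
    (stMap s A).det = conj A.det := by
  have h1 : stMap s A = Matrix.diagonal s * (Matrix.of fun i j => conj (A i j)).transpose *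
      Matrix.diagonal s := by
    ext i j
    rw [Matrix.mul_diagonal, Matrix.diagonal_mul]
    rfl
  rw [h1, Matrix.det_mul, Matrix.det_mul, Matrix.det_transpose, det_conj_map, Matrix.det_diagonal,
    mul_right_comm, ← Finset.prod_mul_distrib]
  simp only [sign_mul_self hs, Finset.prod_const_one, one_mul]

theorem det_mul_conj_det (hs : ∀ i, s i = 1 ∨ s i = -1) {w : Matrix κ κ ℂ}
    (hw : stMap s w * w = 1) : w.det * conj w.det = 1 := by
  rw [← det_stMap hs, mul_comm, ← Matrix.det_mul, hw, Matrix.det_one]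

/-- `θ` is complex conjugation of the entries followed by conjugation with a monomial matrix, and
the latter does not change the determinant. -/
theorem MonomialData.det_thMap {ι : κ → κ} {β : κ → ℂ} {σ η : ℂ} (D : MonomialData s ι β σ η)
    (A : Matrix κ κ ℂ) : (thMap s ι β A).det = conj A.det := by
  set d : κ → ℂ := fun i => s (ι i) * (β (ι i))⁻¹
  set d' : κ → ℂ := fun i => s (ι i) * β (ι i)
  have h1 : thMap s ι β A = Matrix.diagonal d * ((Matrix.of fun i j => conj (A i j)).submatrix
      D.perm D.perm) * Matrix.diagonal d' := by
    ext i j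
    rw [Matrix.mul_diagonal, Matrix.diagonal_mul]
    rfl
  rw [h1, Matrix.det_mul, Matrix.det_mul, Matrix.det_submatrix_equiv_self, det_conj_map,
    Matrix.det_diagonal, Matrix.det_diagonal, mul_right_comm, ← Finset.prod_mul_distrib]
  have h2 : ∀ i, d i * d' i = 1 := by
    intro i
    have h3 := sign_mul_self D.sq_s (ι i)
    have h4 := inv_mul_cancel₀ (D.beta_ne (ι i))
    linear_combination (β (ι i))⁻¹ * β (ι i) * h3 + h4
  simp only [h2, Finset.prod_const_one, one_mul]

/-- Near the identity, the determinant of a unitary `θ`-invariant matrix is one. -/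
theorem MonomialData.det_eq_one {ι : κ → κ} {β : κ → ℂ} {σ η : ℂ} (D : MonomialData s ι β σ η)
    {w : Matrix κ κ ℂ} (hw : stMap s w * w = 1) (hθ : thMap s ι β w = w) (hre : 0 < w.det.re) :
    w.det = 1 := by
  have h1 := det_mul_conj_det D.sq_s hw
  rw [← D.det_thMap, hθ] at h1
  rcases mul_self_eq_one_iff.1 h1 with h2 | h2
  · exact h2
  · rw [h2] at hre
    norm_num at hre

/-- A unitary matrix becomes one of determinant one after multiplication by a scalar of absolute value
one. -/
theorem exists_smul_det_eq_one [Nonempty κ] (hs : ∀ i, s i = 1 ∨ s i = -1) {w : Matrix κ κ ℂ}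
    (hw : stMap s w * w = 1) : ∃ z : ℂ, z ≠ 0 ∧ stMap s (z • w) * (z • w) = 1 ∧ (z • w).det = 1 := by
  have h1 := det_mul_conj_det hs hw
  have h0 : w.det ≠ 0 := left_ne_zero_of_mul_eq_one h1
  -- A root of the inverse determinant of order the size of the matrix; it has modulus one because
  -- the determinant has.
  obtain ⟨z, hz⟩ := IsAlgClosed.exists_pow_nat_eq (w.det)⁻¹ (Fintype.card_pos (α := κ))
  have hz0 : z ≠ 0 := by
    rintro rfl
    rw [zero_pow Fintype.card_ne_zero] at hz
    exact inv_ne_zero h0 hz.symm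
  have hzz : z * conj z = 1 := by
    rw [Complex.mul_conj]
    have h2 : Complex.normSq z ^ Fintype.card κ = 1 := by
      rw [← map_pow, hz, map_inv₀]
      rw [Complex.mul_conj] at h1
      rw [inv_eq_one]
      exact_mod_cast h1
    rw [(pow_eq_one_iff_of_nonneg (Complex.normSq_nonneg z) Fintype.card_ne_zero).1 h2]
    simp
  refine ⟨z, hz0, ?_, ?_⟩
  · have h2 : stMap s (z • w) = conj z • stMap s w := by
      ext i j
      simp only [stMap_apply, Matrix.smul_apply, smul_eq_mul, map_mul]
      ring
    rw [h2, Matrix.smul_mul, Matrix.mul_smul, smul_smul, hw, mul_comm, hzz, one_smul]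
  · rw [Matrix.det_smul, hz, inv_mul_cancel₀ h0]

end Det

/-! ### Independence of the determinant from the block -/

section DetOne

variable {I V : Type} [AddCommGroup V] [Module ℂ V] [DecidableEq I] {E : Module.Basis I ℂ V}

/-- The larger block is triangular with respect to `S` and its complement, with an identity block on
the complement. Hence determinant one can be tested on a common block of two transformations. -/
theorem SupportedIn.det_blockMatrix_mono {S T : Finset I} {g : V ≃ₗ[ℂ] V} (hg : SupportedIn E S g)
    (hST : S ⊆ T) : (blockMatrix E T g).det = (blockMatrix E S g).det := by
  rw [Matrix.twoBlockTriangular_det (blockMatrix E T g) fun i => (i : I) ∈ S]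
  · have h1 : (blockMatrix E T g).toSquareBlockProp (fun i => ¬ (i : I) ∈ S) = 1 := by
      ext i j
      change E.repr (g (E j)) i = _
      rw [hg.1 _ j.2, Module.Basis.repr_self, Finsupp.single_apply, Matrix.one_apply]
      simp only [Subtype.ext_iff, eq_comm]
    let e : {i : T // (i : I) ∈ S} ≃ S :=
      ⟨fun i => ⟨i.1, i.2⟩, fun i => ⟨⟨i.1, hST i.2⟩, i.2⟩, fun _ => rfl, fun _ => rfl⟩
    rw [h1, Matrix.det_one, mul_one, ← Matrix.det_submatrix_equiv_self e (blockMatrix E S g)]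
    rfl
  · intro i hi j hj
    have h1 := hg.2 j hj
    rw [span_image_eq_range_incl] at h1
    obtain ⟨y, hy⟩ := h1
    rw [blockMatrix, Matrix.of_apply, ← hy, repr_incl, dif_neg hi]

theorem HasDetOne.mul {g k : V ≃ₗ[ℂ] V} (hg : HasDetOne E g) (hk : HasDetOne E k) :
    HasDetOne E (g * k) := by
  obtain ⟨S, hS, hS'⟩ := hg
  obtain ⟨T, hT, hT'⟩ := hk
  have h1 := hS.mono (Finset.subset_union_left (s₂ := T))
  have h2 := hT.mono (Finset.subset_union_right (s₁ := S))
  refine ⟨S ∪ T, h1.mul h2, ?_⟩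
  change (blockMatrix E (S ∪ T) (g * k)).det = 1
  rw [h1.blockMatrix_mul h2, Matrix.det_mul, hS.det_blockMatrix_mono Finset.subset_union_left,
    hT.det_blockMatrix_mono Finset.subset_union_right]
  exact (congrArg₂ _ hS' hT').trans (one_mul 1)

theorem hasDetOne_blockEquiv {T : Finset I} {w : (Matrix T T ℂ)ˣ}
    (hw : (w : Matrix T T ℂ).det = 1) : HasDetOne E (blockEquiv E T w) := by
  refine ⟨T, supportedIn_blockEquiv w, ?_⟩
  change (blockMatrix E T (blockEquiv E T w)).det = 1
  rw [blockMatrix_eq_of_blockMap (A := (w : Matrix T T ℂ)) fun x => blockEquiv_apply w x, hw]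

theorem hasDetOne_one : HasDetOne E (1 : V ≃ₗ[ℂ] V) :=
  ⟨∅, supportedIn_one, Matrix.det_isEmpty⟩

end DetOne

/-! ### Lifting the finite dimensional results to flags in `V` -/

section Steps

variable {I V : Type} [AddCommGroup V] [Module ℂ V] [DecidableEq I] {E : Module.Basis I ℂ V}
  {T : Finset I} {h : V →ₗ[ℂ] V →ₛₗ[starRingEnd ℂ] ℂ} {b : V →ₗ[ℂ] V →ₗ[ℂ] ℂ} {s : I → ℂ}

/-- A matrix that is unitary for `diagForm s` as an invertible matrix. -/
def unitaryUnit {κ : Type*} [Fintype κ] [DecidableEq κ] {s : κ → ℂ} (w : Matrix κ κ ℂ)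
    (hw : stMap s w * w = 1) : (Matrix κ κ ℂ)ˣ := ⟨w, stMap s w, mul_eq_one_comm.1 hw, hw⟩

theorem blockEquiv_mem_preserveHerm (hs : ∀ i, s i = 1 ∨ s i = -1)
    (hE : ∀ i j, h (E i) (E j) = if i = j then s i else 0) {w : Matrix T T ℂ}
    (hw : stMap (fun i : T => s i) w * w = 1) :
    blockEquiv E T (unitaryUnit w hw) ∈ preserveHerm h := fun x y => h_blockMap hs hE hw x y

theorem blockEquiv_mem_finitaryGL (w : (Matrix T T ℂ)ˣ) : blockEquiv E T w ∈ finitaryGL E :=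
  mem_finitaryGL_of_supportedIn (supportedIn_blockEquiv w)

theorem map_eq_map_blockEquiv {F : Submodule ℂ V} (hF : Splits E T F) {u : V ≃ₗ[ℂ] V}
    (hu : SupportedIn E T u) {w : (Matrix T T ℂ)ˣ} (hw : (res E T F).map (Matrix.toLin' (w : Matrix T T ℂ)) =
      (res E T F).map (Matrix.toLin' (blockMatrix E T u))) :
    F.map (blockEquiv E T w : V →ₗ[ℂ] V) = F.map (u : V →ₗ[ℂ] V) := by
  rw [coe_blockEquiv, hu.eq_blockMap]
  exact hF.map_eq_of_res_eq hw

omit [DecidableEq I] in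
theorem isChain_res {𝓜 : Set (Submodule ℂ V)} (hC : IsChain (· ≤ ·) 𝓜) :
    IsChain (· ≤ ·) (res E T '' 𝓜) := by
  rintro _ ⟨F, hF, rfl⟩ _ ⟨G, hG, rfl⟩ -
  exact (hC.total hF hG).imp (fun h => Submodule.comap_mono h) fun h => Submodule.comap_mono h

theorem translate_congr {g k : V ≃ₗ[ℂ] V} {𝓜 : Set (Submodule ℂ V)}
    (h : ∀ F ∈ 𝓜, F.map (g : V →ₗ[ℂ] V) = F.map (k : V →ₗ[ℂ] V)) : translate g 𝓜 = translate k 𝓜 :=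
  Set.image_congr h

/-- Near the identity, the translates of a nondegenerate chain are translates by unitary transformations of
determinant one. -/
theorem exists_unitary_translate_of_no_bilin (hs : ∀ i, s i = 1 ∨ s i = -1)
    (hE : ∀ i j, h (E i) (E j) = if i = j then s i else 0) {𝓜 : Set (Submodule ℂ V)}
    (hC : IsChain (· ≤ ·) 𝓜) (hsplit : ∀ F ∈ 𝓜, Splits E T F) (hnd : IsNondegenerate h 𝓜)
    (hT : T.Nonempty) :
    ∃ O ∈ 𝓝 (1 : Matrix T T ℂ), ∀ u : V ≃ₗ[ℂ] V, SupportedIn E T u → blockMatrix E T u ∈ O →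
      ∃ w : Matrix T T ℂ, ∃ hw : stMap (fun i : T => s i) w * w = 1, w.det = 1 ∧
        translate (blockEquiv E T (unitaryUnit w hw)) 𝓜 = translate u 𝓜 := by
  have hne : Nonempty T := hT.to_subtype
  have hs' : ∀ i : T, s i = 1 ∨ s i = -1 := fun i => hs i
  have hev := eventually_exists_unitary_map_of_no_bilin hs' (isChain_res (E := E) (T := T) hC)
    (by rintro _ ⟨F, hF, rfl⟩
        exact (res_nondeg_iff hs hE (hsplit F hF)).2 (hnd F hF)) univ_mem
  refine ⟨_, hev, fun u hu huO => ?_⟩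
  obtain ⟨w, -, hw, hwF⟩ := huO
  -- A nonzero scalar fixes every subspace of the block, so the determinant is corrected without
  -- changing the translated flag.
  obtain ⟨z, hz0, hzw, hdet⟩ := exists_smul_det_eq_one hs' hw
  refine ⟨z • w, hzw, hdet, translate_congr fun F hF => map_eq_map_blockEquiv (hsplit F hF) hu ?_⟩
  rw [← hwF _ ⟨F, hF, rfl⟩]
  change (res E T F).map (Matrix.toLin' (z • w)) = _
  rw [map_smul, Submodule.map_smul _ _ _ hz0]

section Bilinear

variable {ι : I → I} {β : I → ℂ} {σ η : ℂ} (D : MonomialData s ι β σ η)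
  (hE : ∀ i j, h (E i) (E j) = if i = j then s i else 0)
  (hb : ∀ i j, b (E i) (E j) = if j = ι i then β i else 0)
  (hT : ∀ i ∈ T, ι i ∈ T)

include D

theorem MonomialData.exists_stable_finset (S : Finset I) :
    ∃ T, S ⊆ T ∧ ∀ i ∈ T, ι i ∈ T := by
  refine ⟨S ∪ S.image ι, Finset.subset_union_left, fun i hi => ?_⟩
  rcases Finset.mem_union.1 hi with hi | hi
  · exact Finset.mem_union_right _ (Finset.mem_image_of_mem _ hi)
  · obtain ⟨j, hj, rfl⟩ := Finset.mem_image.1 hi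
    rw [D.inv]
    exact Finset.mem_union_left _ hj

include hb

theorem blockEquiv_mem_preserveBilin {w : Matrix T T ℂ}
    (hw : stMap (fun i : T => s i) w * w = 1)
    (hθ : thMap (fun i : T => s i) (resInv hT) (fun i : T => β i) w = w) :
    blockEquiv E T (unitaryUnit w hw) ∈ preserveBilin b :=
  fun x y => b_blockMap D hb hT ((D.restrict hT).preserves_bilin hw hθ) x y

include hE

/-- Near the identity, the translates of a nondegenerate isotropic chain by transformations that preserve the
bilinear form are translates by unitary ones. -/
theorem exists_unitary_translate {𝓜 : Set (Submodule ℂ V)}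
    (hC : IsChain (· ≤ ·) 𝓜) (hsplit : ∀ F ∈ 𝓜, Splits E T F) (hnd : IsNondegenerate h 𝓜)
    (hiso : IsIsotropic b 𝓜) {O' : Set (Matrix T T ℂ)} (hO' : O' ∈ 𝓝 1) :
    ∃ O ∈ 𝓝 (1 : Matrix T T ℂ), ∀ u ∈ preserveBilin b, SupportedIn E T u →
      blockMatrix E T u ∈ O → ∃ w ∈ O', ∃ hw : stMap (fun i : T => s i) w * w = 1,
        thMap (fun i : T => s i) (resInv hT) (fun i : T => β i) w = w ∧
        translate (blockEquiv E T (unitaryUnit w hw)) 𝓜 = translate u 𝓜 := by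
  have D' := D.restrict hT
  have hnd' : ∀ F ∈ res E T '' 𝓜, ∀ x ∈ F, (∀ y ∈ F, diagForm (fun i : T => s i) x y = 0) →
      x = 0 := by
    rintro _ ⟨F, hF, rfl⟩
    exact (res_nondeg_iff D.sq_s hE (hsplit F hF)).2 (hnd F hF)
  -- The chain is enlarged by the `b`-orthogonal spaces. It remains a nondegenerate chain, and is
  -- closed under `perp` since `perp_perp` holds for nondegenerate members.
  have hev := D'.eventually_exists_unitary_map
    (C := res E T '' 𝓜 ∪ perp (monomialForm (resInv hT) fun i : T => β i) '' (res E T '' 𝓜))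
    (isChain_perp (isChain_res hC) ?_) ?_ ?_ hO'
  · refine ⟨_, hev, fun u hub hu huO => ?_⟩
    obtain ⟨w, hwO, hw, hθ, hwF⟩ := huO (monomialForm_of_b_blockMap hb hT fun x y => by
      rw [← hu.apply, ← hu.apply]
      exact hub x y)
    exact ⟨w, hwO, hw, hθ, translate_congr fun F hF =>
      map_eq_map_blockEquiv (hsplit F hF) hu (hwF _ (Or.inl ⟨F, hF, rfl⟩))⟩
  · rintro _ ⟨F, hF, rfl⟩ _ ⟨G, hG, rfl⟩
    rw [← Splits.res_perp hb hT (hsplit G hG)]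
    exact (hiso F hF G hG).imp (fun h1 => Submodule.comap_mono h1) fun h1 => Submodule.comap_mono h1
  · rintro F (hF | ⟨F, hF, rfl⟩)
    · exact hnd' F hF
    · exact D'.formTriple.perp_nondeg (hnd' F hF)
  · rintro F (hF | ⟨F, hF, rfl⟩)
    · exact Or.inr ⟨F, hF, rfl⟩
    · rw [D'.formTriple.perp_perp (hnd' F hF)]
      exact Or.inl hF

end Bilinear

section Degenerate

theorem finrank_radical_map_of_mem_preserveHerm {k : V ≃ₗ[ℂ] V} (hk : k ∈ preserveHerm h)
    (F : Submodule ℂ V) :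
    Module.finrank ℂ (radical h (F.map (k : V →ₗ[ℂ] V))) = Module.finrank ℂ (radical h F) := by
  have hk' : ∀ v w, h (k v) (k w) = h v w := hk
  have : radical h (F.map (k : V →ₗ[ℂ] V)) = (radical h F).map (k : V →ₗ[ℂ] V) := by
    ext x
    constructor
    · rintro ⟨⟨y, hy, rfl⟩, hx⟩
      exact ⟨y, ⟨hy, fun z hz => (hk' y z).symm.trans (hx _ ⟨z, hz, rfl⟩)⟩, rfl⟩
    · rintro ⟨y, ⟨hy, hy'⟩, rfl⟩
      refine ⟨⟨y, hy, rfl⟩, ?_⟩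
      rintro _ ⟨z, hz, rfl⟩
      exact (hk' y z).trans (hy' z hz)
  rw [this]
  exact LinearEquiv.finrank_map_eq k _

theorem finrank_radical_map_blockEquiv_lt (hs : ∀ i, s i = 1 ∨ s i = -1)
    (hE : ∀ i j, h (E i) (E j) = if i = j then s i else 0) {F : Submodule ℂ V}
    (hF : Splits E T F) (u : (Matrix T T ℂ)ˣ)
    (hlt : Module.finrank ℂ (radical (diagForm fun i : T => s i)
      ((res E T F).map (Matrix.toLin' (u : Matrix T T ℂ)))) <
      Module.finrank ℂ (radical (diagForm fun i : T => s i) (res E T F))) :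
    Module.finrank ℂ (radical h (F.map (blockEquiv E T u : V →ₗ[ℂ] V))) <
      Module.finrank ℂ (radical h F) := by
  rwa [coe_blockEquiv, ← finrank_radical_res hs hE hF,
    ← finrank_radical_res hs hE (hF.map (u : Matrix T T ℂ)), hF.res_map]

theorem exists_less_degenerate_of_no_bilin (hs : ∀ i, s i = 1 ∨ s i = -1)
    (hE : ∀ i j, h (E i) (E j) = if i = j then s i else 0) {F : Submodule ℂ V}
    (hF : Splits E T F) (hdeg : ¬ ∀ x ∈ F, (∀ y ∈ F, h x y = 0) → x = 0)
    {O : Set (Matrix T T ℂ)} (hO : O ∈ 𝓝 1) :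
    ∃ u : (Matrix T T ℂ)ˣ, (u : Matrix T T ℂ) ∈ O ∧
      Module.finrank ℂ (radical h (F.map (blockEquiv E T u : V →ₗ[ℂ] V))) <
        Module.finrank ℂ (radical h F) := by
  rw [← res_nondeg_iff hs hE hF] at hdeg
  obtain ⟨_, huO, ⟨u, rfl⟩, hlt⟩ := exists_finrank_radical_lt_of_no_bilin (fun i : T => hs i) hdeg hO
  exact ⟨u, huO, finrank_radical_map_blockEquiv_lt hs hE hF u hlt⟩

variable {ι : I → I} {β : I → ℂ} {σ η : ℂ} (D : MonomialData s ι β σ η)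
  (hE : ∀ i j, h (E i) (E j) = if i = j then s i else 0)
  (hb : ∀ i j, b (E i) (E j) = if j = ι i then β i else 0)
  (hT : ∀ i ∈ T, ι i ∈ T)

include D hE hb

theorem exists_less_degenerate {F : Submodule ℂ V}
    (hF : Splits E T F) (hdeg : ¬ ∀ x ∈ F, (∀ y ∈ F, h x y = 0) → x = 0)
    (hiso : ∀ x ∈ F, ∀ y ∈ F, b x y = 0)
    (hLag : η = 1 → T.card = 2 * Module.finrank ℂ (res E T F) → ∏ i : T, s i = 1)
    (hT : ∀ i ∈ T, ι i ∈ T) {O : Set (Matrix T T ℂ)} (hO : O ∈ 𝓝 1) :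
    ∃ u : (Matrix T T ℂ)ˣ, (u : Matrix T T ℂ) ∈ O ∧ blockEquiv E T u ∈ preserveBilin b ∧
      Module.finrank ℂ (radical h (F.map (blockEquiv E T u : V →ₗ[ℂ] V))) <
        Module.finrank ℂ (radical h F) := by
  rw [← res_nondeg_iff D.sq_s hE hF] at hdeg
  obtain ⟨_, huO, ⟨u, rfl⟩, hub, hlt⟩ := (D.restrict hT).exists_finrank_radical_lt hdeg
    (fun x hx y hy => by
      rw [← coords_incl (E := E) y, ← b_incl_left hb hT]
      exact hiso _ hx _ hy)
    (fun _ hη hcard => hLag hη (by rwa [Fintype.card_coe] at hcard)) hO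
  exact ⟨u, huO, fun x y => b_blockMap D hb hT hub x y,
    finrank_radical_map_blockEquiv_lt D.sq_s hE hF u hlt⟩

/-- At the level of `T`, the map `τ` takes a radical vector of `F` to a radical vector of its
`b`-orthogonal space. -/
theorem perp_degenerate (hT : ∀ i ∈ T, ι i ∈ T) {F : Submodule ℂ V} (hF : Splits E T F)
    (hdeg : ¬ ∀ x ∈ F, (∀ y ∈ F, h x y = 0) → x = 0) :
    ¬ ∀ x ∈ perp b F, (∀ y ∈ perp b F, h x y = 0) → x = 0 := by
  have H := (D.restrict hT).formTriple
  rw [← res_nondeg_iff D.sq_s hE hF] at hdeg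
  rw [← res_nondeg_iff D.sq_s hE (Splits.perp D hb hT hF), Splits.res_perp hb hT hF]
  intro hnd
  refine hdeg fun x hx hx' => ?_
  have h1 := hnd _ (H.tau_mem_perp hx') fun y hy => by rw [H.tau_h, hy x hx]; simp
  have h2 := H.tau_tau x
  rw [h1, map_zero, eq_comm, smul_eq_zero] at h2
  exact h2.resolve_left H.sign_ne

omit hE in
theorem finrank_res_perp (hT : ∀ i ∈ T, ι i ∈ T) {F : Submodule ℂ V} (hF : Splits E T F) :
    Module.finrank ℂ (res E T (perp b F)) + Module.finrank ℂ (res E T F) = T.card := by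
  rw [Splits.res_perp hb hT hF, (D.restrict hT).formTriple.finrank_perp,
    Module.finrank_fintype_fun_eq_card, Fintype.card_coe]

omit [DecidableEq I] D hE hb in
theorem finrank_res_span (A : Set I) [DecidablePred (· ∈ A)] :
    Module.finrank ℂ (res E T (Submodule.span ℂ (E '' A))) = (T.filter (· ∈ A)).card := by
  have h1 : Submodule.span ℂ (E '' A) ⊓ Submodule.span ℂ (E '' (T : Set I)) =
      Submodule.span ℂ (E '' ((T.filter (· ∈ A) : Finset I) : Set I)) := by
    ext x
    simp only [Submodule.mem_inf, Module.Basis.mem_span_image, Finset.coe_filter,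
      Set.subset_def, Set.mem_ofPred_eq, Finset.mem_coe]
    exact ⟨fun hx i hi => ⟨hx.2 i hi, hx.1 i hi⟩, fun hx => ⟨fun i hi => (hx i hi).2,
      fun i hi => (hx i hi).1⟩⟩
  rw [finrank_res, h1, span_image_eq_range_incl, LinearMap.finrank_range_of_inj incl_injective,
    Module.finrank_fintype_fun_eq_card, Fintype.card_coe]

omit hE in
/-- A stable finite set of indices that is cut into halves by a Lagrangian coordinate subspace has an even number
of negative signs. -/
theorem prod_sign_eq_one (hη : η = 1) (hT : ∀ i ∈ T, ι i ∈ T) {A : Set I}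
    (hiso : (∀ v ∈ Submodule.span ℂ (E '' A), ∀ w ∈ Submodule.span ℂ (E '' A), b v w = 0) ∨
      ∀ v, (∀ w ∈ Submodule.span ℂ (E '' A), b v w = 0) → v ∈ Submodule.span ℂ (E '' A))
    (hcard : T.card = 2 * Module.finrank ℂ (res E T (Submodule.span ℂ (E '' A)))) :
    ∏ i : T, s i = 1 := by
  classical
  rw [finrank_res_span] at hcard
  -- Such a `B` contains exactly one index from each pair `i`, `ι i` of `T`, and for `η = 1` both
  -- have the same sign. In the isotropic case `B` consists of the indices in `A`, in the
  -- coisotropic case of those not in `A`.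
  have key : ∀ B ⊆ T, T.card = 2 * B.card → (∀ i ∈ B, ι i ∉ B) → ∏ i : T, s i = 1 := by
    intro B hB hBcard hdisj
    have hinj : Set.InjOn ι (B : Set I) := fun i _ j _ hij => by rw [← D.inv i, hij, D.inv]
    have h1 : T = B ∪ B.image ι := by
      refine (Finset.eq_of_subset_of_card_le (Finset.union_subset hB ?_) ?_).symm
      · intro i hi
        obtain ⟨j, hj, rfl⟩ := Finset.mem_image.1 hi
        exact hT _ (hB hj)
      · rw [Finset.card_union_of_disjoint, Finset.card_image_of_injOn hinj, hBcard, two_mul]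
        rw [Finset.disjoint_left]
        intro i hi hi'
        obtain ⟨j, hj, rfl⟩ := Finset.mem_image.1 hi'
        exact hdisj j hj hi
    have h2 : Disjoint B (B.image ι) := by
      rw [Finset.disjoint_left]
      intro i hi hi'
      obtain ⟨j, hj, rfl⟩ := Finset.mem_image.1 hi'
      exact hdisj j hj hi
    rw [Finset.prod_coe_sort T s, h1, Finset.prod_union h2, Finset.prod_image hinj,
      ← Finset.prod_mul_distrib]
    refine Finset.prod_eq_one fun i _ => ?_
    rw [D.s_iota, hη, one_mul, sign_mul_self D.sq_s]
  rcases hiso with hiso | hiso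
  · refine key _ (Finset.filter_subset _ _) hcard fun i hi hi' => ?_
    have h1 := hiso _ (Submodule.subset_span ⟨i, (Finset.mem_filter.1 hi).2, rfl⟩) _
      (Submodule.subset_span ⟨_, (Finset.mem_filter.1 hi').2, rfl⟩)
    rw [hb, if_pos rfl] at h1
    exact D.beta_ne i h1
  · refine key (T.filter (· ∉ A)) (Finset.filter_subset _ _) ?_ fun i hi hi' => ?_
    · have := Finset.card_filter_add_card_filter_not (s := T) (· ∈ A)
      omega
    · have h1 : E (ι i) ∈ Submodule.span ℂ (E '' A) := by
        refine hiso _ fun w hw => ?_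
        rw [b_basis_left hb, D.inv]
        rw [Module.Basis.mem_span_image] at hw
        rw [Finsupp.notMem_support_iff.1 fun h2 => (Finset.mem_filter.1 hi).2 (hw h2), mul_zero]
      rw [Module.Basis.mem_span_image, Module.Basis.repr_self] at h1
      exact (Finset.mem_filter.1 hi').2 (h1 (by simp))

end Degenerate

end Steps

/-! ### Openness of real orbits and the two implications -/

namespace RealForm

variable {c : RealForm} {E : Module.Basis c.Idx ℂ c.V}

theorem mem_unitaryGroup_of_mem_realGroup {g : c.V ≃ₗ[ℂ] c.V} (hg : g ∈ realGroup c E) :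
    g ∈ unitaryGroup c E := by
  cases c with
  | SU q => exact hg.1
  | SO q =>
    obtain ⟨g, -, rfl⟩ := hg
    exact g.2
  | Sp q => exact hg
  | SOStar => exact hg.1
  | SpR => exact hg

theorem one_mem_realGroup : (1 : c.V ≃ₗ[ℂ] c.V) ∈ realGroup c E := by
  cases c with
  | SU q => exact ⟨one_mem _, hasDetOne_one⟩
  | SO q => exact ⟨1, @mem_connectedComponent _ (limTopology E (unitaryGroup (SO q) E)) 1, rfl⟩
  | Sp q => exact one_mem (unitaryGroup (Sp q) E)
  | SOStar => exact ⟨one_mem _, hasDetOne_one⟩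
  | SpR => exact one_mem (unitaryGroup SpR E)

theorem translate_mem_flagManifold {𝓕 𝓛 : Set (Submodule ℂ c.V)} (h𝓛 : 𝓛 ∈ flagManifold c E 𝓕)
    {g : c.V ≃ₗ[ℂ] c.V} (hg : g ∈ complexGroup c E) : translate g 𝓛 ∈ flagManifold c E 𝓕 :=
  ⟨isGeneralizedFlag_translate h𝓛.1 g, isIsotropic_translate h𝓛.2.1 hg.2,
    commensurable_translate h𝓛.2.2 hg.1⟩

/-- An orbit is open as soon as it contains, with each of its points, the translates by transformations near
the identity. -/
theorem isOpen_realOrbit {𝓕 : Set (Submodule ℂ c.V)} {𝓕₁ : flagManifold c E 𝓕}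
    (H : ∀ k ∈ realGroup c E, ∀ S : Finset c.Idx, ∃ T, S ⊆ T ∧ ∃ O ∈ 𝓝 (1 : Matrix T T ℂ),
      ∀ u ∈ complexGroup c E, SupportedIn E T u → blockMatrix E T u ∈ O →
        ∃ k' ∈ realGroup c E, translate u (translate k 𝓕₁.1) = translate k' 𝓕₁.1) :
    IsOpen (c.realOrbit E 𝓕 𝓕₁) := by
  rw [@isOpen_induced_iff _ _ (orbitTopology c E)]
  refine ⟨{𝓜 | ∃ k ∈ realGroup c E, 𝓜 = translate k 𝓕₁.1}, ?_, rfl⟩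
  rw [isOpen_iSup_iff]
  intro 𝓛
  rw [isOpen_coinduced]
  refine isOpen_limTopology fun g₀ hg₀ S => ?_
  obtain ⟨k, hk, hk'⟩ := hg₀
  obtain ⟨T, hST, O, hO, hTO⟩ := H k hk S
  refine ⟨T, hST, O, hO, fun u hu huO => ?_⟩
  obtain ⟨k', hk₁, hk₂⟩ := hTO u u.2 hu huO
  refine ⟨k', hk₁, ?_⟩
  change translate ((u : c.V ≃ₗ[ℂ] c.V) * (g₀ : c.V ≃ₗ[ℂ] c.V)) 𝓛 = _
  rw [← translate_mul, show translate (g₀ : c.V ≃ₗ[ℂ] c.V) 𝓛 = _ from hk', hk₂]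

/-- The members of a flag with open orbit are moved by transformations near the identity in the same way as by
unitary transformations. -/
theorem exists_map_eq_of_isOpen_realOrbit {𝓕 : Set (Submodule ℂ c.V)} {𝓕₁ : flagManifold c E 𝓕}
    (H : IsOpen (c.realOrbit E 𝓕 𝓕₁)) (T : Finset c.Idx) : ∃ O ∈ 𝓝 (1 : Matrix T T ℂ),
      ∀ u ∈ complexGroup c E, SupportedIn E T u → blockMatrix E T u ∈ O →
        ∃ k ∈ unitaryGroup c E, ∀ F ∈ 𝓕₁.1,
          F.map (u : c.V →ₗ[ℂ] c.V) = F.map (k : c.V →ₗ[ℂ] c.V) := by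
  rw [@isOpen_induced_iff _ _ (orbitTopology c E)] at H
  obtain ⟨W, hW, hWo⟩ := H
  rw [isOpen_iSup_iff] at hW
  have hW' := hW 𝓕₁.1
  rw [isOpen_coinduced] at hW'
  have hmem : ∀ 𝓜 : flagManifold c E 𝓕, 𝓜.1 ∈ W ↔ ∃ k ∈ realGroup c E, 𝓜.1 = translate k 𝓕₁.1 :=
    fun 𝓜 => Set.ext_iff.1 hWo 𝓜
  obtain ⟨O, hO, hOW⟩ := exists_nhds_of_isOpen_limTopology hW'
    (by change translate 1 𝓕₁.1 ∈ W
        rw [translate_one, hmem]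
        exact ⟨1, one_mem_realGroup, (translate_one _).symm⟩) T
  refine ⟨O, hO, fun u hu huT huO => ?_⟩
  obtain ⟨k, hk, huk⟩ := (hmem ⟨_, translate_mem_flagManifold 𝓕₁.2 hu⟩).1 (hOW ⟨u, hu⟩ huT huO)
  have hk' := mem_unitaryGroup_of_mem_realGroup hk
  refine ⟨k, hk', fun F hF => ?_⟩
  -- A priori `k⁻¹ * u` only permutes the members; being finitary, it fixes each of them.
  have h1 : translate (k⁻¹ * u) 𝓕₁.1 = 𝓕₁.1 := by
    rw [← translate_mul]
    change translate k⁻¹ (translate u 𝓕₁.1) = _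
    rw [show translate u 𝓕₁.1 = translate k 𝓕₁.1 from huk, translate_mul, inv_mul_cancel,
      translate_one]
  have h2 := map_eq_self_of_mem_chain 𝓕₁.2.1.chain 𝓕₁.2.2.2.2.1
    (mul_mem (inv_mem hk'.1.1) hu.1) hF (h1.subset ⟨F, hF, rfl⟩)
  conv_rhs => rw [← h2]
  rw [← Submodule.map_comp]
  congr 1
  exact LinearMap.ext fun x => (k.apply_symm_apply (u x)).symm

/-- For `Sp` and `SpR` there is no further condition. For `SOStar` the determinant is `1` or `-1`,
hence `1` near the identity. For `SO` the Cayley path, moved by `k`, stays in the identity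
component. -/
theorem exists_realGroup_mul_of_bilin {ι : c.Idx → c.Idx} {β : c.Idx → ℂ} {σ η : ℂ}
    (hE : c.Adapted E) (hc : ∀ q, c ≠ SU q)
    (D : MonomialData (fun i : c.Idx => sgn i) ι β σ η)
    (hb : ∀ i j, c.b (E i) (E j) = if j = ι i then β i else 0) {T : Finset c.Idx}
    (hT : ∀ i ∈ T, ι i ∈ T) : ∃ O ∈ 𝓝 (1 : Matrix T T ℂ), ∀ w ∈ O,
      ∀ hw : stMap (fun i : T => sgn (i : c.Idx)) w * w = 1,
      thMap (fun i : T => sgn (i : c.Idx)) (resInv hT) (fun i : T => β i) w = w →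
      ∀ k ∈ realGroup c E, blockEquiv E T (unitaryUnit w hw) * k ∈ realGroup c E := by
  have hmem : ∀ w (hw : stMap (fun i : T => sgn (i : c.Idx)) w * w = 1),
      thMap (fun i : T => sgn (i : c.Idx)) (resInv hT) (fun i : T => β i) w = w →
      blockEquiv E T (unitaryUnit w hw) ∈ unitaryGroup c E := fun w hw hθ =>
    ⟨⟨blockEquiv_mem_finitaryGL _, blockEquiv_mem_preserveBilin D hb hT hw hθ⟩,
      blockEquiv_mem_preserveHerm D.sq_s hE.h_basis hw⟩
  cases c with
  | SU q => exact absurd rfl (hc q)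
  | Sp q => exact ⟨_, univ_mem, fun w _ hw hθ k hk => mul_mem (hmem w hw hθ) hk⟩
  | SpR => exact ⟨_, univ_mem, fun w _ hw hθ k hk => mul_mem (hmem w hw hθ) hk⟩
  | SOStar =>
    have hdet : Continuous fun w : Matrix T T ℂ => w.det.re :=
      Complex.continuous_re.comp continuous_id.matrix_det
    refine ⟨{w | 0 < w.det.re}, (isOpen_lt continuous_const hdet).mem_nhds (by simp),
      fun w hwO hw hθ k hk => ⟨mul_mem (hmem w hw hθ) hk.1, HasDetOne.mul ?_ hk.2⟩⟩
    exact hasDetOne_blockEquiv ((D.restrict hT).det_eq_one hw hθ hwO)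
  | SO q =>
    refine ⟨_, (D.restrict hT).eventually_exists_path, ?_⟩
    rintro w hwO hw hθ _ ⟨k, hk, rfl⟩
    obtain ⟨γ, hγ, hγ0, hγ1, hγu⟩ := hwO hw hθ
    let t := limTopology E (unitaryGroup (SO q) E)
    let f : unitInterval → unitaryGroup (SO q) E := fun r =>
      ⟨blockEquiv E T (unitaryUnit (γ r) (hγu r).1), hmem _ (hγu r).1 (hγu r).2⟩
    have hf : Continuous f := by
      refine continuous_limTopology_of_entries T f (fun r => supportedIn_blockEquiv _) fun i j => ?_
      change Continuous fun r => E.repr (blockMap E T (γ r) (E j)) i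
      simp only [blockMap_apply, map_add, Finsupp.add_apply, repr_incl]
      refine continuous_const.add ?_
      split_ifs
      · exact continuous_pi_iff.1 (hγ.matrix_mulVec continuous_const) _
      · exact continuous_const
    have hf0 : f 0 = 1 := by
      refine Subtype.ext (LinearEquiv.ext fun x => ?_)
      change blockMap E T (γ 0) x = x
      rw [hγ0, blockMap_one]
    have hf1 : f 1 = ⟨blockEquiv E T (unitaryUnit w hw), hmem w hw hθ⟩ := by
      refine Subtype.ext (LinearEquiv.ext fun x => ?_)
      change blockMap E T (γ 1) x = blockMap E T w x
      rw [hγ1]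
    have h1 : f 1 ∈ connectedComponent (1 : unitaryGroup (SO q) E) :=
      (isPreconnected_range hf).subset_connectedComponent ⟨0, hf0⟩ ⟨1, rfl⟩
    have h2 := (continuous_mul_right_limTopology (E := E) (k := k)
      k.2.1.1).image_connectedComponent_subset 1 ⟨_, h1, rfl⟩
    rw [one_mul, ← connectedComponent_eq hk, hf1] at h2
    exact ⟨_, h2, rfl⟩

theorem isOpen_realOrbit_of_isNondegenerate (hE : c.Adapted E) {𝓕 : Set (Submodule ℂ c.V)}
    (𝓕₁ : flagManifold c E 𝓕) (hnd : IsNondegenerate c.h 𝓕₁.1) :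
    IsOpen (c.realOrbit E 𝓕 𝓕₁) := by
  refine isOpen_realOrbit fun k hk S => ?_
  have hku := mem_unitaryGroup_of_mem_realGroup hk
  have hC := isChain_translate 𝓕₁.2.1.chain k
  have hiso := isIsotropic_translate 𝓕₁.2.2.1 hku.1.2
  have hnd' := isNondegenerate_translate hnd hku.2
  obtain ⟨T₀, hT₀⟩ := exists_splits (weaklyCompatible_translate 𝓕₁.2.2.2.2.1 hku.1.1)
  by_cases hc : ∃ q, c = SU q
  · obtain ⟨q, rfl⟩ := hc
    -- The index `-1` always exists; inserting it makes the block nonempty, as the correction of the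
    -- determinant by a scalar requires.
    have hT₀S : T₀ ⊆ insert ⟨-1, by simp⟩ (T₀ ∪ S) :=
      Finset.subset_union_left.trans (Finset.subset_insert _ _)
    obtain ⟨O, hO, hOw⟩ := exists_unitary_translate_of_no_bilin (fun i => sgn_sq _) hE.h_basis hC
      (hT₀ _ hT₀S) hnd' (Finset.insert_nonempty _ _)
    refine ⟨_, Finset.subset_union_right.trans (Finset.subset_insert _ _), O, hO,
      fun u hu huT huO => ?_⟩
    obtain ⟨w, hw, hdet, hwu⟩ := hOw u huT huO
    refine ⟨_, ⟨mul_mem ⟨⟨blockEquiv_mem_finitaryGL (unitaryUnit w hw), fun x y => ?_⟩,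
      blockEquiv_mem_preserveHerm (fun i => sgn_sq _) hE.h_basis hw⟩ hku,
      (hasDetOne_blockEquiv hdet).mul hk.2⟩, ?_⟩
    · rw [bilin_SU]
      rfl
    · rw [← hwu, translate_mul]
  · have hc' : ∀ q, c ≠ SU q := fun q h => hc ⟨q, h⟩
    obtain ⟨ι, β, σ, η, D, hb⟩ := hE.exists_monomialData hc'
    obtain ⟨T, hST, hT⟩ := D.exists_stable_finset (T₀ ∪ S)
    obtain ⟨O', hO', hOk⟩ := exists_realGroup_mul_of_bilin hE hc' D hb hT
    obtain ⟨O, hO, hOw⟩ := exists_unitary_translate D hE.h_basis hb hT hC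
      (hT₀ T (Finset.subset_union_left.trans hST)) hnd' hiso hO'
    refine ⟨T, Finset.subset_union_right.trans hST, O, hO, fun u hu huT huO => ?_⟩
    obtain ⟨w, hwO, hw, hθ, hwu⟩ := hOw u hu.2 huT huO
    exact ⟨_, hOk w hwO hw hθ k hk, by rw [← hwu, translate_mul]⟩

theorem isNondegenerate_of_isOpen_realOrbit (hE : c.Adapted E) {𝓕 : Set (Submodule ℂ c.V)}
    (h𝓕E : Compatible E 𝓕) (h𝓕b : IsIsotropic c.b 𝓕) (𝓕₁ : flagManifold c E 𝓕)
    (H : IsOpen (c.realOrbit E 𝓕 𝓕₁)) : IsNondegenerate c.h 𝓕₁.1 := by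
  intro F hF
  by_contra hdeg
  obtain ⟨T₀, hT₀⟩ := exists_splits 𝓕₁.2.2.2.2.1
  by_cases hc : ∃ q, c = SU q
  · obtain ⟨q, rfl⟩ := hc
    obtain ⟨O, hO, hOk⟩ := exists_map_eq_of_isOpen_realOrbit H T₀
    obtain ⟨u, huO, hlt⟩ := exists_less_degenerate_of_no_bilin (fun i => sgn_sq _) hE.h_basis
      (hT₀ T₀ le_rfl F hF) hdeg hO
    obtain ⟨k, hk, hku⟩ := hOk (blockEquiv E T₀ u)
      ⟨blockEquiv_mem_finitaryGL u, fun x y => by rw [bilin_SU]; rfl⟩ (supportedIn_blockEquiv u)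
      (by rwa [blockMatrix_eq_of_blockMap fun x => blockEquiv_apply u x])
    rw [hku F hF, finrank_radical_map_of_mem_preserveHerm hk.2] at hlt
    exact lt_irrefl _ hlt
  · obtain ⟨ι, β, σ, η, D, hb⟩ := hE.exists_monomialData fun q h => hc ⟨q, h⟩
    obtain ⟨T₁, hT₁⟩ := exists_finrank_res_eq 𝓕₁.2.2.2
    obtain ⟨T, hST, hT⟩ := D.exists_stable_finset (T₀ ∪ T₁)
    have hFT := hT₀ T (Finset.subset_union_left.trans hST) F hF
    obtain ⟨F₀, hF₀, hfin⟩ := hT₁ F hF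
    have hfin := hfin T (Finset.subset_union_right.trans hST)
    obtain ⟨A, hA⟩ := h𝓕E F₀ hF₀
    -- The corresponding member of `𝓕` is a coordinate subspace with the same dimension at level
    -- `T`, so the product of signs can be computed there.
    have hLag : η = 1 → T.card = 2 * Module.finrank ℂ (res E T F) →
        ∏ i : T, sgn (i : c.Idx) = 1 := by
      intro hη hcard
      have h1 := h𝓕b F₀ hF₀ F₀ hF₀
      rw [hA] at h1 hfin
      exact prod_sign_eq_one D hb hη hT h1 (by rw [hfin, hcard])
    obtain ⟨O, hO, hOk⟩ := exists_map_eq_of_isOpen_realOrbit H T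
    -- `K` stands for `F` or its `b`-orthogonal space, whichever is isotropic. If equal translates
    -- of `F` gave equal translates of `K`, a small `u` that lowers the radical of `K` would act on
    -- `K` as a unitary `k`, which preserves the dimension of the radical.
    have key : ∀ K : Submodule ℂ c.V, Splits E T K →
        (¬ ∀ x ∈ K, (∀ y ∈ K, c.h x y = 0) → x = 0) → (∀ x ∈ K, ∀ y ∈ K, c.b x y = 0) →
        (T.card = 2 * Module.finrank ℂ (res E T K) → T.card = 2 * Module.finrank ℂ (res E T F)) →
        ¬ ∀ u ∈ complexGroup c E, ∀ k ∈ unitaryGroup c E,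
          F.map (u : c.V →ₗ[ℂ] c.V) = F.map (k : c.V →ₗ[ℂ] c.V) →
          K.map (u : c.V →ₗ[ℂ] c.V) = K.map (k : c.V →ₗ[ℂ] c.V) := by
      intro K hK hKdeg hKb hcard hmap
      obtain ⟨u, huO, hub, hlt⟩ := exists_less_degenerate D hE.h_basis hb hK hKdeg hKb
        (fun hη h1 => hLag hη (hcard h1)) hT hO
      have huG : blockEquiv E T u ∈ complexGroup c E := ⟨blockEquiv_mem_finitaryGL u, hub⟩
      obtain ⟨k, hk, hku⟩ := hOk _ huG (supportedIn_blockEquiv u)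
        (by rwa [blockMatrix_eq_of_blockMap fun x => blockEquiv_apply u x])
      rw [hmap _ huG k hk (hku F hF), finrank_radical_map_of_mem_preserveHerm hk.2] at hlt
      exact lt_irrefl _ hlt
    rcases 𝓕₁.2.2.1 F hF F hF with hiso | hiso
    · exact key F hFT hdeg hiso id fun u _ k _ h1 => h1
    -- In the coisotropic case `perp c.b F` is isotropic and degenerate. It has half the dimension
    -- at level `T` exactly when `F` has, and it is moved along with `F` by transformations that
    -- preserve `b`.
    · refine key (perp c.b F) (Splits.perp D hb hT hFT) (perp_degenerate D hE.h_basis hb hT hFT hdeg)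
        (fun x hx y hy => hx y (hiso y hy)) (fun h1 => ?_) fun u hu k hk h1 => ?_
      · have := finrank_res_perp D hb hT hFT
        omega
      · rw [← perp_map_equiv hu.2, ← perp_map_equiv hk.1.2, h1]

end RealForm

end OpenOrbits

end

theorem theorem3p2 (c : OpenOrbits.RealForm)
    (E : Module.Basis c.Idx ℂ c.V) (hE : c.Adapted E)
    (𝓕 : Set (Submodule ℂ c.V))
    (h𝓕 : OpenOrbits.IsGeneralizedFlag 𝓕)
    (h𝓕E : OpenOrbits.Compatible E 𝓕)
    (h𝓕b : OpenOrbits.IsIsotropic c.b 𝓕)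
    (𝓕₁ : c.flagManifold E 𝓕) :
    IsOpen (c.realOrbit E 𝓕 𝓕₁) ↔ OpenOrbits.IsNondegenerate c.h 𝓕₁.1 :=
  ⟨OpenOrbits.RealForm.isNondegenerate_of_isOpen_realOrbit hE h𝓕E h𝓕b 𝓕₁,
    OpenOrbits.RealForm.isOpen_realOrbit_of_isNondegenerate hE 𝓕₁⟩
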